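/- **Setting.** A strict partition is a sequence $\lambda=(\lambda_1>\lambda_2>\dots>0)$ of positive integers (possibly empty); $\mathsf{SD}_\lambda=\{(i,j)\in\mathbb Z^2: 0<i\le j<i+\lambda_i\}$ is its shifted diagram, $|\lambda|=|\mathsf{SD}_\lambda|$, and $\mu\subseteq\lambda$ means $\mu_i\le\lambda_i$ for all $i$; then $\mathsf{SD}_{\lambda/\mu}=\mathsf{SD}_\lambda\setminus\mathsf{SD}_\mu$ and $|\lambda/\mu|=|\mathsf{SD}_{\lambda/\mu}|$. A semistandard set-valued shifted tableau $T$ of shape $\lambda/\mu$ fills each box of $\mathsf{SD}_{\lambda/\mu}$ with a nonempty finite subset of $\{1'<1<2'<2<\cdots\}$ so that rows and columns are weakly increasing ($\max A\le\min B$ whenever $A$ precedes $B$), no unprimed number occurs in two boxes of a column, and no primed number occurs in two boxes of a row. Let $|T|$ be the sum of the sizes of its entries and $x^T=\prod_i x_i^{m_i}$, where $m_i$ is the number of occurrences of $i$ and $i'$ in $T$. In $\mathbb Z[\beta][[x_1,x_2,\dots]]$ put $$GQ_{\lambda/\mu}=\sum_T\beta^{|T|-|\lambda/\mu|}x^T,$$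 and let $GP_{\lambda/\mu}$ be the same sum restricted to the $T$ with no primed number in a diagonal box $(i,i)$; both are $0$ if $\mu\not\subseteq\lambda$. Write $GP_\lambda=GP_{\lambda/\emptyset}$, $GQ_\lambda=GQ_{\lambda/\emptyset}$. Let $\mathsf{Rem}(\mu)$ be the set of boxes of $\mathsf{SD}_\mu$ whose removal leaves the shifted diagram of a strict partition. For $\mu\subseteq\lambda$ define $$GP_{\lambda/\!/\mu}=\sum_{\nu\subseteq\mu,\ \mathsf{SD}_{\mu/\nu}\subseteq\mathsf{Rem}(\mu)}\beta^{|\mu/\nu|}GP_{\lambda/\nu}$$ (sum over strict partitions $\nu$), define $GQ_{\lambda/\!/\mu}$ likewise from the $GQ_{\lambda/\nu}$, and set both to $0$ if $\mu\not\subseteq\lambda$. Let $$\Delta(x;y)=\prod_{i,j\ge1}\frac{1-\overline{x_i}\,y_j}{1-x_iy_j},\qquad \overline{x_i}=\frac{-x_i}{1+\beta x_i}.$$ Let $gp_\lambda,gq_\lambda\in\mathbb Z[\beta][[x_1,x_2,\dots]]$ be the unique families, indexed by strict partitions, with $$\sum_\lambda GQ_\lambda(x)\,gp_\lambda(y)=\sum_\lambda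 GP_\lambda(x)\,gq_\lambda(y)=\Delta(x;y),$$ and let $a^\lambda_{\mu\nu},b^\lambda_{\mu\nu}\in\mathbb Z$, zero when $|\lambda|<|\mu|+|\nu|$, be the unique integers with $$GP_\mu GP_\nu=\sum_\lambda a^\lambda_{\mu\nu}\beta^{|\lambda|-|\mu|-|\nu|}GP_\lambda,\qquad GQ_\mu GQ_\nu=\sum_\lambda b^\lambda_{\mu\nu}\beta^{|\lambda|-|\mu|-|\nu|}GQ_\lambda$$ (possibly infinite sums). Set $$gq_{\lambda/\mu}=\sum_\nu a^\lambda_{\mu\nu}\beta^{|\lambda|-|\mu|-|\nu|}gq_\nu,\qquad gp_{\lambda/\mu}=\sum_\nu b^\lambda_{\mu\nu}\beta^{|\lambda|-|\mu|-|\nu|}gp_\nu .$$ All infinite sums and products are of formal power series, taken coefficientwise. **Theorem.** The families $gp_\lambda$, $gq_\lambda$ and the integers $a^\lambda_{\mu\nu}$, $b^\lambda_{\mu\nu}$ described above exist and are unique, and for all strict partitions $\mu$ and $\nu$ $$\sum_\lambda GP_{\lambda/\!/\mu}(x)\,gq_{\lambda/\nu}(y)=\Delta(x;y)\sum_\kappa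 GP_{\nu/\!/\kappa}(x)\,gq_{\mu/\kappa}(y)$$ and $$\sum_\lambda GQ_{\lambda/\!/\mu}(x)\,gp_{\lambda/\nu}(y)=\Delta(x;y)\sum_\kappa GQ_{\nu/\!/\kappa}(x)\,gp_{\mu/\kappa}(y),$$ where $\lambda$ and $\kappa$ range over all strict partitions. (The sums over $\lambda$ may be infinite; only $\kappa\subseteq\nu$ contribute to the sums over $\kappa$.) -/

import Mathlib

open scoped MvPowerSeries.WithPiTopology

noncomputable section

/-! ### Strict partitions and shifted diagrams -/

/-- A strict partition `λ₁ > λ₂ > ⋯ > 0`, recorded as the infinite sequence of its parts followed by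
zeros; the part `λ_{i+1}` is `part i`. (Such a sequence is eventually zero.) -/
@[ext]
structure StrictPartition where
  part : ℕ → ℕ
  strict : ∀ i, part i ≠ 0 → part (i + 1) < part i
  stop_zero : ∀ i, part i = 0 → part (i + 1) = 0

namespace StrictPartition

/-- Containment `μ ⊆ λ`: `μ_i ≤ λ_i` for all `i`. -/
instance : HasSubset StrictPartition := ⟨fun μ la => ∀ i, μ.part i ≤ la.part i⟩

/-- The shifted diagram `{(i, j) : i ≤ j < i + λ_i}`, with rows and columns numbered from `0`
(see `mem_diagram`). -/
def diagram (la : StrictPartition) : Finset (ℕ × ℕ) :=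
  (Finset.range (la.part 0) ×ˢ Finset.range (la.part 0)).filter
    fun p => p.1 ≤ p.2 ∧ p.2 < p.1 + la.part p.1

theorem add_part_le (la : StrictPartition) (i : ℕ) (h : la.part i ≠ 0) :
    i + la.part i ≤ la.part 0 := by
  induction i with
  | zero => simp
  | succ i ih =>
    have h0 : la.part i ≠ 0 := fun h0 => h (la.stop_zero i h0)
    have h1 := la.strict i h0
    have h2 := ih h0
    omega

theorem mem_diagram (la : StrictPartition) (p : ℕ × ℕ) :
    p ∈ la.diagram ↔ p.1 ≤ p.2 ∧ p.2 < p.1 + la.part p.1 := by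
  simp only [diagram, Finset.mem_filter, Finset.mem_product, Finset.mem_range]
  refine ⟨fun h => h.2, fun h => ⟨?_, h⟩⟩
  have h0 : la.part p.1 ≠ 0 := by omega
  have := la.add_part_le p.1 h0
  omega

/-- `|λ|`, the number of boxes of the shifted diagram. -/
def size (la : StrictPartition) : ℕ := la.diagram.card

/-- The boxes of the shifted skew diagram of `λ/μ`. -/
def skewDiagram (la μ : StrictPartition) : Finset (ℕ × ℕ) := la.diagram \ μ.diagram

/-- The removable boxes of `μ`: those whose removal leaves the shifted diagram of a strict
partition. -/
def removable (μ : StrictPartition) : Set (ℕ × ℕ) :=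
  {p | p ∈ μ.diagram ∧ ∃ ν : StrictPartition, ν.diagram = μ.diagram.erase p}

theorem diagram_injective : Function.Injective diagram := by
  have key : ∀ a b : StrictPartition, a.diagram = b.diagram → ∀ i, a.part i ≤ b.part i := by
    intro a b h i
    rcases Nat.eq_zero_or_pos (a.part i) with h0 | h0
    · omega
    · have h1 : (i, i + a.part i - 1) ∈ a.diagram := (a.mem_diagram _).2 ⟨by simp; omega, by simp; omega⟩
      rw [h, mem_diagram] at h1
      simp only at h1
      omega
  intro a b h
  ext i
  exact le_antisymm (key a b h i) (key b a h.symm i)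

theorem diagram_subset {μ la : StrictPartition} (h : μ ⊆ la) : μ.diagram ⊆ la.diagram := by
  intro p hp
  rw [mem_diagram] at hp ⊢
  have := h p.1
  omega

theorem finite_subset (μ : StrictPartition) : {ν : StrictPartition | ν ⊆ μ}.Finite :=
  Set.Finite.of_finite_image
    ((μ.diagram.powerset.finite_toSet).subset (by
      rintro _ ⟨ν, hν, rfl⟩
      simpa using diagram_subset hν))
    diagram_injective.injOn

end StrictPartition

/-! ### Power series rings

`ℤ[β]` is `Polynomial ℤ`, with `β = Polynomial.X`. The variables `x₁, x₂, …` are indexed by `ℕ`,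
and two alphabets `x`, `y` are indexed by `ℕ ⊕ ℕ`. Infinite sums and products of formal power series
are taken coefficientwise: coefficients carry the discrete topology and power series the product
topology. -/

instance : TopologicalSpace (Polynomial ℤ) := ⊥

instance : DiscreteTopology (Polynomial ℤ) := ⟨rfl⟩

/-- `ℤ[β][[x₁, x₂, …]]`. -/
abbrev Series : Type := MvPowerSeries ℕ (Polynomial ℤ)

/-- `ℤ[β][[x₁, x₂, …, y₁, y₂, …]]`. -/
abbrev Series₂ : Type := MvPowerSeries (ℕ ⊕ ℕ) (Polynomial ℤ)

/-- The parameter `β`. -/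
def β : Polynomial ℤ := Polynomial.X

/-- `f ↦ f(x)`. -/
def inX (f : Series) : Series₂ := MvPowerSeries.rename (Function.Embedding.inl : ℕ ↪ ℕ ⊕ ℕ) f

/-- `f ↦ f(y)`. -/
def inY (f : Series) : Series₂ := MvPowerSeries.rename (Function.Embedding.inr : ℕ ↪ ℕ ⊕ ℕ) f

/-- The variable `x_{i+1}`. -/
def xvar (i : ℕ) : Series₂ := MvPowerSeries.X (Sum.inl i)

/-- The variable `y_{j+1}`. -/
def yvar (j : ℕ) : Series₂ := MvPowerSeries.X (Sum.inr j)

/-- `x̄ = -x / (1 + β x)` for `x = x_{i+1}`. -/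
def xbar (i : ℕ) : Series₂ :=
  -xvar i * MvPowerSeries.invOfUnit (1 + MvPowerSeries.C β * xvar i) 1

/-- The factor `(1 - x̄_i y_j) / (1 - x_i y_j)` of the Cauchy kernel. -/
def cauchyFactor (p : ℕ × ℕ) : Series₂ :=
  (1 - xbar p.1 * yvar p.2) * MvPowerSeries.invOfUnit (1 - xvar p.1 * yvar p.2) 1

/-- The Cauchy kernel `Δ(x;y) = ∏_{i,j} (1 - x̄_i y_j) / (1 - x_i y_j)`. -/
def Δ : Series₂ := ∏' p : ℕ × ℕ, cauchyFactor p

/-- The infinite product defining `Δ` converges. -/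
theorem multipliable_cauchyFactor : Multipliable cauchyFactor := by
  let w : ℕ ⊕ ℕ → ℕ := Sum.elim id id
  have hw : ∀ p : ℕ × ℕ, ((p.1 + p.2 : ℕ) : ℕ∞) ≤ (cauchyFactor p - 1).weightedOrder w := by
    intro p
    have hinv : (1 - xvar p.1 * yvar p.2) *
        MvPowerSeries.invOfUnit (1 - xvar p.1 * yvar p.2) 1 = 1 :=
      MvPowerSeries.mul_invOfUnit _ _ (by simp [xvar, yvar])
    have hX : ∀ s : ℕ ⊕ ℕ,
        (MvPowerSeries.X s : Series₂).weightedOrder w = (w s : ℕ∞) := by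
      intro s
      rw [MvPowerSeries.X, MvPowerSeries.weightedOrder_monomial_of_ne_zero w one_ne_zero]
      simp [Finsupp.weight_single]
    have hfac : cauchyFactor p - 1 = xvar p.1 * yvar p.2 *
        ((1 + MvPowerSeries.invOfUnit (1 + MvPowerSeries.C β * xvar p.1) 1) *
          MvPowerSeries.invOfUnit (1 - xvar p.1 * yvar p.2) 1) := by
      unfold cauchyFactor xbar
      linear_combination hinv
    rw [hfac]
    refine le_trans ?_ (MvPowerSeries.le_weightedOrder_mul w)
    refine le_trans ?_ (le_add_of_nonneg_right zero_le)
    refine le_trans ?_ (MvPowerSeries.le_weightedOrder_mul w)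
    rw [xvar, yvar, hX, hX]
    simp [w]
  rw [← Nat.pairEquiv.symm.multipliable_iff]
  have htend : Filter.Tendsto
      (fun n => (cauchyFactor (Nat.pairEquiv.symm n) - 1).weightedOrder w) Filter.atTop
      (nhds ⊤) := by
    rw [ENat.tendsto_nhds_top_iff_natCast_lt]
    intro N
    have hfin : {n : ℕ | (Nat.pairEquiv.symm n).1 + (Nat.pairEquiv.symm n).2 ≤ N}.Finite := by
      refine Set.Finite.preimage (f := Nat.pairEquiv.symm)
        (s := {p : ℕ × ℕ | p.1 + p.2 ≤ N}) Nat.pairEquiv.symm.injective.injOn ?_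
      refine (Finset.finite_toSet (Finset.range (N + 1) ×ˢ Finset.range (N + 1))).subset ?_
      intro p hp
      simp only [Set.mem_ofPred_eq] at hp
      simp only [Finset.coe_product, Finset.coe_range, Set.mem_prod, Set.mem_Iio]
      omega
    have hev := hfin.compl_mem_cofinite
    rw [Nat.cofinite_eq_atTop] at hev
    filter_upwards [hev] with n hn
    refine lt_of_lt_of_le ?_ (hw _)
    simp only [Set.mem_compl_iff, Set.mem_ofPred_eq, not_le] at hn
    exact_mod_cast hn
  have h := MvPowerSeries.WithPiTopology.multipliable_one_add_of_tendsto_weightedOrder_atTop_nhds_top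
    htend
  simpa [Function.comp_def] using h

/-! ### Set-valued shifted tableaux

The half-integers `1' < 1 < 2' < 2 < ⋯` (with `m' = m - 1/2`) are encoded by the natural numbers
`0 < 1 < 2 < 3 < ⋯`, so `k` stands for `(k + 1) / 2`: it is primed if and only if `k` is even, and it
contributes the variable with index `k / 2` (indices from `0`). -/

/-- Semistandard set-valued shifted tableaux whose set of boxes is `D` (primes are allowed on the
diagonal). -/
@[ext]
structure SetShYTQ (D : Finset (ℕ × ℕ)) where
  entry : ℕ × ℕ → Finset ℕ
  /-- the boxes of `D`, and only they, are filled, by nonempty sets -/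
  nonempty_iff : ∀ p, (entry p).Nonempty ↔ p ∈ D
  /-- rows are weakly increasing -/
  row_le : ∀ i j j', j < j' → ∀ a ∈ entry (i, j), ∀ b ∈ entry (i, j'), a ≤ b
  /-- columns are weakly increasing -/
  col_le : ∀ i i' j, i < i' → ∀ a ∈ entry (i, j), ∀ b ∈ entry (i', j), a ≤ b
  /-- no unprimed number occurs in two boxes of a column -/
  col_unprimed : ∀ i i' j, i ≠ i' → ∀ a ∈ entry (i, j), a ∈ entry (i', j) → Even a
  /-- no primed number occurs in two boxes of a row -/
  row_primed : ∀ i j j', j ≠ j' → ∀ a ∈ entry (i, j), a ∈ entry (i, j') → ¬ Even a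

namespace SetShYTQ

variable {D : Finset (ℕ × ℕ)}

/-- `|T| = ∑ |T_{ij}|`. -/
def total (T : SetShYTQ D) : ℕ := ∑ p ∈ D, (T.entry p).card

/-- The exponent vector of `x^T`. -/
def weight (T : SetShYTQ D) : ℕ →₀ ℕ := ∑ p ∈ D, ∑ k ∈ T.entry p, Finsupp.single (k / 2) 1

/-- The term `β^{|T| - |D|} x^T`. -/
def term (T : SetShYTQ D) : Series :=
  MvPowerSeries.monomial T.weight (β ^ (T.total - D.card))

/-- No primed number occurs in a diagonal box. -/
def DiagonalUnprimed (T : SetShYTQ D) : Prop := ∀ i, ∀ a ∈ T.entry (i, i), ¬ Even a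

theorem finite_weight_eq (d : ℕ →₀ ℕ) : {T : SetShYTQ D | T.weight = d}.Finite := by
  classical
  let B : Finset ℕ := d.support.biUnion fun i => {2 * i, 2 * i + 1}
  have hB : ∀ T : SetShYTQ D, T.weight = d → ∀ p ∈ D, T.entry p ⊆ B := by
    intro T hT p hp k hk
    have h1 : 1 ≤ T.weight (k / 2) := by
      rw [weight, Finsupp.finsetSum_apply]
      refine le_trans ?_ (Finset.single_le_sum (fun _ _ => Nat.zero_le _) hp)
      rw [Finsupp.finsetSum_apply]
      refine le_trans ?_ (Finset.single_le_sum (fun _ _ => Nat.zero_le _) hk)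
      simp
    refine Finset.mem_biUnion.2 ⟨k / 2, ?_, ?_⟩
    · rw [Finsupp.mem_support_iff, ← hT]; omega
    · simp only [Finset.mem_insert, Finset.mem_singleton]; omega
  let F : SetShYTQ D → (D → Finset ℕ) := fun T p => T.entry p
  have hF : Function.Injective F := by
    intro S T h
    ext1
    funext p
    by_cases hp : p ∈ D
    · exact congrFun h ⟨p, hp⟩
    · have hS : S.entry p = ∅ :=
        Finset.not_nonempty_iff_eq_empty.1 fun h => hp ((S.nonempty_iff p).1 h)
      have hT : T.entry p = ∅ :=
        Finset.not_nonempty_iff_eq_empty.1 fun h => hp ((T.nonempty_iff p).1 h)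
      rw [hS, hT]
  refine Set.Finite.of_finite_image (f := F) ?_ hF.injOn
  refine (Set.Finite.pi' (t := fun _ : D => (↑B.powerset : Set (Finset ℕ)))
    fun _ => B.powerset.finite_toSet).subset ?_
  rintro _ ⟨T, hT, rfl⟩ p
  simpa using hB T hT p p.2

theorem summable_term (P : SetShYTQ D → Prop) :
    Summable fun T : {T : SetShYTQ D // P T} => T.1.term := by
  classical
  rw [MvPowerSeries.WithPiTopology.summable_iff_summable_coeff]
  intro d
  refine summable_of_hasFiniteSupport
    (((finite_weight_eq d).preimage Subtype.val_injective.injOn).subset ?_)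
  intro T hT
  by_contra hne
  refine hT ?_
  simp only [term, MvPowerSeries.coeff_monomial]
  exact if_neg fun h => hne h.symm

end SetShYTQ

/-! ### `K`-theoretic Schur `P`- and `Q`-functions and their skew versions -/

open Classical in
/-- `GP_{λ/μ}`. -/
def GPskew (la μ : StrictPartition) : Series :=
  if μ ⊆ la then ∑' T : {T : SetShYTQ (la.skewDiagram μ) // T.DiagonalUnprimed}, T.1.term else 0

open Classical in
/-- `GQ_{λ/μ}`. -/
def GQskew (la μ : StrictPartition) : Series :=
  if μ ⊆ la then ∑' T : SetShYTQ (la.skewDiagram μ), T.term else 0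

/-- The empty partition. -/
def emptyPartition : StrictPartition := ⟨fun _ => 0, by simp, by simp⟩

/-- `GP_λ`. -/
def GP (la : StrictPartition) : Series := GPskew la emptyPartition

/-- `GQ_λ`. -/
def GQ (la : StrictPartition) : Series := GQskew la emptyPartition

/-- The strict partitions `ν ⊆ μ` obtained by removing some removable boxes from `μ`. -/
def removals (μ : StrictPartition) : Set StrictPartition :=
  {ν | ν ⊆ μ ∧ ↑(μ.skewDiagram ν) ⊆ μ.removable}

open Classical in
/-- `GP_{λ//μ}`. -/
def GPsskew (la μ : StrictPartition) : Series :=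
  if μ ⊆ la then
    ∑ᶠ ν ∈ removals μ, MvPowerSeries.C (β ^ (μ.skewDiagram ν).card) * GPskew la ν
  else 0

open Classical in
/-- `GQ_{λ//μ}`. -/
def GQsskew (la μ : StrictPartition) : Series :=
  if μ ⊆ la then
    ∑ᶠ ν ∈ removals μ, MvPowerSeries.C (β ^ (μ.skewDiagram ν).card) * GQskew la ν
  else 0

/-! ### Dual functions -/

/-- The family `g` is dual to the family `G`: `∑_λ G_λ(x) g_λ(y) = Δ(x;y)`. -/
def IsDualFamily (G g : StrictPartition → Series) : Prop :=
  HasSum (fun la => inX (G la) * inY (g la)) Δ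

/-- The family dual to `G`. -/
def dualFamily (G : StrictPartition → Series) : StrictPartition → Series :=
  Classical.epsilon (IsDualFamily G)

/-- `gp_λ`, dual to `GQ_λ`. -/
def gp : StrictPartition → Series := dualFamily GQ

/-- `gq_λ`, dual to `GP_λ`. -/
def gq : StrictPartition → Series := dualFamily GP

/-- The integers `c λ` are the coefficients in
`G_μ G_ν = ∑_λ c_λ β^{|λ| - |μ| - |ν|} G_λ`, where no negative power of `β` occurs, that is,
`c_λ = 0` if `|λ| < |μ| + |ν|`. -/
def IsProductExpansion (G : StrictPartition → Series) (μ ν : StrictPartition)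
    (c : StrictPartition → ℤ) : Prop :=
  (∀ la, la.size < μ.size + ν.size → c la = 0) ∧
    HasSum (fun la => MvPowerSeries.C (Polynomial.C (c la) * β ^ (la.size - (μ.size + ν.size))) * G la)
      (G μ * G ν)

/-- The coefficients of `G_λ` in the expansion of `G_μ G_ν`; for `G = GP` (respectively `GQ`) these
are the integers `a^λ_{μν}` (respectively `b^λ_{μν}`). -/
def structureCoeff (G : StrictPartition → Series) (μ ν : StrictPartition) : StrictPartition → ℤ :=
  Classical.epsilon (IsProductExpansion G μ ν)

/-- `gq_{λ/μ} = ∑_ν a^λ_{μν} β^{|λ| - |μ| - |ν|} gq_ν`. -/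
def gqSkew (la μ : StrictPartition) : Series :=
  ∑ᶠ ν, MvPowerSeries.C
    (Polynomial.C (structureCoeff GP μ ν la) * β ^ (la.size - (μ.size + ν.size))) * gq ν

/-- `gp_{λ/μ} = ∑_ν b^λ_{μν} β^{|λ| - |μ| - |ν|} gp_ν`. -/
def gpSkew (la μ : StrictPartition) : Series :=
  ∑ᶠ ν, MvPowerSeries.C
    (Polynomial.C (structureCoeff GQ μ ν la) * β ^ (la.size - (μ.size + ν.size))) * gp ν

end

/-!
Everything rests on a description of `GP` and `GQ` by commuting transfer operators. Let `u_i`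
(`StrictPartition.peel`) act on functions of strict partitions by removing the removable box on
diagonal `i`, or by keeping it with weight `β`. These operators satisfy the relations of a quotient
of the idCoxeter algebra of type B, so `h_i(x) = 1 + x u_i` satisfy the Yang–Baxter equation, and
`T(x) = h_N(x) ⋯ h_1(x) h_0(x)^ε h_1(x) ⋯ h_N(x)`, with `ε = 1` for `GP` and `ε = 2` for `GQ`,
satisfies Sklyanin's reflection equation. Reading a set-valued tableau letter by letter shows that
`GP_{λ//μ}(x_0, …, x_{n-1})`, or `GQ_{λ//μ}`, is the matrix coefficient of `T(x_{n-1}) ⋯ T(x_0)` at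
`(λ, μ)` (`fillSum_letterPairsBelow`, `coeff_Gsskew`). Writing `x ⊕ y = x + y + β x y`, three
consequences follow.

* The product of the matrices of two alphabets gives the coproduct
  `G_λ(z, x) = ∑_κ G_κ(z) G_{λ//κ}(x)` (`coeff_splice_Gfun`).
* The `T(x)` commute, and `T(x) T(y) ≡ 1` modulo `x ⊕ y`, so `GP_λ` and `GQ_λ` are symmetric and have
  the K-theoretic cancellation property: they lie in `cancellationRing`.
* For `ε = 2`, `T(x) ≡ 1` modulo `x ⊕ x = x (2 + β x)`, so `GQ_λ` is a combination of multiples of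
  `∏_{i ∈ S} (x_i ⊕ x_i)` by series in the variables `x_i`, `i ∈ S`: it lies in `doubleRing`.

The leading exponent of an element of `cancellationRing` is a strict partition
(`coeff_eq_zero_of_forall_expo`), while `GP_λ` and `GQ_λ` have leading exponent `λ` with coefficient
`1` and `2^{ℓ(λ)}`. In `doubleRing` leading coefficients are divisible by `2^{ℓ(λ)}`
(`two_pow_dvd_coeff`). Hence elimination of leading terms expands every element of these rings
uniquely in the `GP_λ` or the `GQ_λ` (`exists_expansion`, `eq_zero_of_forall_sum_mul_eq_zero`).
Applied to products, with a homogeneity argument to see that the coefficients are integers times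
powers of `β`, this gives the structure constants. The coefficients of `y^b` in `Δ(x;y)` lie in these
rings too, since the factors of `Δ` have the same properties as `T(x)`
(`cauchyFactor_mul_cauchyFactor`, `cauchyFactor_eq_one_add`). This gives the dual families.

For the skew Cauchy identity, multiply both sides by `G_μ(z)` and sum over `μ`. The definition of
the skew dual functions gives `∑_μ G_μ(z) g_{μ/κ}(y) = G_κ(z) Δ(z;y)` (`sum_coeff_smul_dualSkew`).
With the coproduct, both sides become `G_ν(z, x) Δ(z, x; y)`, where
`Δ(z, x; y) = Δ(z; y) Δ(x; y)`. By the linear independence of the `G_μ(z)` the identity holds for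
each `μ` (`hasSum_skewCauchy`). The two cases are treated together: a Boolean `q` is true for `GQ`
and false for `GP`.
-/


noncomputable section

namespace StrictPartition

/-! ### Corners of strict partitions -/

theorem part_lt_of_lt (la : StrictPartition) {r s : ℕ} (h : r < s) (hr : la.part r ≠ 0) :
    la.part s < la.part r := by
  induction s, h using Nat.le_induction with
  | base => exact la.strict r hr
  | succ s _ ih =>
    rcases Nat.eq_zero_or_pos (la.part s) with h0 | h0
    · rw [la.stop_zero s h0]; omega
    · exact (la.strict s h0.ne').trans ih

theorem part_anti (la : StrictPartition) {r s : ℕ} (h : r ≤ s) : la.part s ≤ la.part r := by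
  induction s, h using Nat.le_induction with
  | base => exact le_rfl
  | succ s _ ih =>
    rcases Nat.eq_zero_or_pos (la.part s) with h0 | h0
    · rw [la.stop_zero s h0]; omega
    · exact (la.strict s h0.ne').le.trans ih

theorem eq_of_part_eq (la : StrictPartition) {r s : ℕ} (h : la.part r = la.part s)
    (hr : la.part r ≠ 0) : r = s := by
  rcases lt_trichotomy r s with h1 | h1 | h1
  · have := la.part_lt_of_lt h1 hr; omega
  · exact h1
  · have := la.part_lt_of_lt h1 (h ▸ hr); omega

/-- The diagonal `k` contains the last box of some row, that is, `k + 1` is a part. -/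
def Site (la : StrictPartition) (k : ℕ) : Prop := ∃ r, la.part r = k + 1

/-- A strict partition is determined by its set of parts. -/
theorem ext_site {la μ : StrictPartition} (h : ∀ k, la.Site k ↔ μ.Site k) : la = μ := by
  have key : ∀ n, ∀ la μ : StrictPartition, (∀ k, la.Site k ↔ μ.Site k) →
      (∀ i < n, la.part i = μ.part i) → la.part n ≤ μ.part n := by
    intro n la μ h hn
    by_contra! hlt
    obtain ⟨r, hr⟩ := (h (la.part n - 1)).1 ⟨n, by omega⟩
    have hrn : r < n := by
      by_contra! hc
      have := μ.part_anti hc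
      omega
    have h1 := hn r hrn
    have := la.eq_of_part_eq (r := r) (s := n) (by omega) (by omega)
    omega
  ext n
  induction n using Nat.strong_induction_on with
  | _ n ih =>
    exact le_antisymm (key n la μ h ih)
      (key n μ la (fun k => (h k).symm) fun i hi => (ih i hi).symm)

/-- The diagonal `i` (boxes `(r, r + i)`) contains a removable box: `i + 1` is a part, and `i` is not
a part unless `i = 0`. -/
def HasCorner (la : StrictPartition) (i : ℕ) : Prop :=
  la.Site i ∧ ∀ j, j + 1 = i → ¬ la.Site j

theorem HasCorner.next_lt {la : StrictPartition} {i r : ℕ} (h : la.HasCorner i)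
    (hr : la.part r = i + 1) (hi : i ≠ 0) : la.part (r + 1) < i := by
  have h1 := la.strict r (by omega)
  by_contra! hc
  exact h.2 (i - 1) (by omega) ⟨r + 1, by omega⟩

open Classical in
/-- The partition obtained by removing the removable box on diagonal `i`; it is `la` if there is no
such box. -/
def down (la : StrictPartition) (i : ℕ) : StrictPartition where
  part r := if la.HasCorner i ∧ la.part r = i + 1 then i else la.part r
  strict r hr := by
    by_cases h : la.HasCorner i
    · simp only [h, true_and] at hr ⊢
      by_cases h1 : la.part r = i + 1
      · rw [if_pos h1] at hr ⊢
        have h2 := h.next_lt h1 hr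
        rw [if_neg (by omega)]
        exact h2
      · rw [if_neg h1] at hr ⊢
        have h2 := la.strict r hr
        split_ifs <;> omega
    · simp only [h, false_and, if_false] at hr ⊢
      exact la.strict r hr
  stop_zero r hr := by
    by_cases h : la.HasCorner i
    · simp only [h, true_and] at hr ⊢
      by_cases h1 : la.part r = i + 1
      · rw [if_pos h1] at hr
        have h2 := la.strict r (by omega)
        rw [if_neg (by omega)]
        omega
      · rw [if_neg h1] at hr
        have h2 := la.stop_zero r hr
        rw [if_neg (by omega), h2]
    · simp only [h, false_and, if_false] at hr ⊢
      exact la.stop_zero r hr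

theorem down_part_self {la : StrictPartition} {i r : ℕ} (h : la.HasCorner i)
    (hr : la.part r = i + 1) : (la.down i).part r = i := by
  simp [down, h, hr]

theorem down_part_of_ne {la : StrictPartition} {i r : ℕ} (hr : la.part r ≠ i + 1) :
    (la.down i).part r = la.part r := by
  simp [down, hr]

theorem site_down {la : StrictPartition} {i : ℕ} (h : la.HasCorner i) (k : ℕ) :
    (la.down i).Site k ↔ k + 1 = i ∨ (k ≠ i ∧ la.Site k) := by
  constructor
  · rintro ⟨r, hr⟩
    by_cases h1 : la.part r = i + 1
    · rw [down_part_self h h1] at hr; left; omega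
    · rw [down_part_of_ne h1] at hr
      right
      exact ⟨by omega, r, hr⟩
  · rintro (h1 | ⟨h1, r, hr⟩)
    · obtain ⟨r, hr⟩ := h.1
      exact ⟨r, by rw [down_part_self h hr, h1]⟩
    · exact ⟨r, by rw [down_part_of_ne (by omega), hr]⟩

theorem not_hasCorner_down_self {la : StrictPartition} {i : ℕ} (h : la.HasCorner i) :
    ¬ (la.down i).HasCorner i := by
  rintro ⟨h1, -⟩
  rw [site_down h] at h1
  omega

theorem not_hasCorner_succ {la : StrictPartition} {i : ℕ} (h : la.HasCorner i) :
    ¬ la.HasCorner (i + 1) := fun h1 => h1.2 i rfl h.1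

theorem not_hasCorner_pred {la : StrictPartition} {i : ℕ} (h : la.HasCorner (i + 1)) :
    ¬ la.HasCorner i := fun h1 => h.2 i rfl h1.1

theorem not_hasCorner_up_down_up {la : StrictPartition} {i : ℕ} (h : la.HasCorner (i + 1))
    (h1 : (la.down (i + 1)).HasCorner i) : ¬ ((la.down (i + 1)).down i).HasCorner (i + 1) := by
  rintro ⟨h2, -⟩
  rw [site_down h1, site_down h] at h2
  omega

theorem not_hasCorner_down_up_down {la : StrictPartition} {i : ℕ} (hi : i ≠ 0)
    (h : la.HasCorner i) (h1 : (la.down i).HasCorner (i + 1)) :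
    ¬ ((la.down i).down (i + 1)).HasCorner i := by
  rintro ⟨-, h2⟩
  refine h2 (i - 1) (by omega) ?_
  rw [site_down h1, site_down h]
  omega

theorem hasCorner_down_iff {la : StrictPartition} {i j : ℕ} (h : la.HasCorner i)
    (hij : i + 2 ≤ j ∨ j + 2 ≤ i) : (la.down i).HasCorner j ↔ la.HasCorner j := by
  simp only [HasCorner, site_down h]
  constructor
  · rintro ⟨h1, h2⟩
    refine ⟨h1.elim (fun h3 => by omega) And.right, fun k hk hs => h2 k hk ?_⟩
    exact Or.inr ⟨by omega, hs⟩
  · rintro ⟨h1, h2⟩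
    refine ⟨Or.inr ⟨by omega, h1⟩, fun k hk => ?_⟩
    rintro (h3 | h3)
    · omega
    · exact h2 k hk h3.2

theorem down_comm {la : StrictPartition} {i j : ℕ} (hi : la.HasCorner i) (hj : la.HasCorner j)
    (hij : i + 2 ≤ j ∨ j + 2 ≤ i) : (la.down i).down j = (la.down j).down i := by
  apply ext_site
  intro k
  rw [site_down ((hasCorner_down_iff hi hij).2 hj), site_down hi,
    site_down ((hasCorner_down_iff hj hij.symm).2 hi), site_down hj]
  by_cases h : la.Site k <;> simp only [h, and_true, and_false, or_false] <;> omega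

/-! ### Diagrams, sizes and containment -/

theorem down_subset (la : StrictPartition) (i : ℕ) : la.down i ⊆ la := by
  intro r
  simp only [down]
  split_ifs with h <;> omega

theorem subset_refl (la : StrictPartition) : la ⊆ la := fun _ => le_rfl

theorem subset_trans {la μ ν : StrictPartition} (h : la ⊆ μ) (h' : μ ⊆ ν) : la ⊆ ν :=
  fun r => (h r).trans (h' r)

theorem subset_iff_diagram {μ la : StrictPartition} : μ ⊆ la ↔ μ.diagram ⊆ la.diagram := by
  refine ⟨diagram_subset, fun h i => ?_⟩
  rcases Nat.eq_zero_or_pos (μ.part i) with h0 | h0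
  · omega
  · have h1 : (i, i + μ.part i - 1) ∈ μ.diagram :=
      (μ.mem_diagram _).2 ⟨by simp; omega, by simp; omega⟩
    have := (la.mem_diagram _).1 (h h1)
    simp only at this
    omega

/-- The partitions contained in `la`. -/
def lower (la : StrictPartition) : Finset StrictPartition := (finite_subset la).toFinset

@[simp]
theorem mem_lower {la μ : StrictPartition} : μ ∈ la.lower ↔ μ ⊆ la := by simp [lower]

theorem empty_subset (la : StrictPartition) : emptyPartition ⊆ la := fun _ => Nat.zero_le _

@[simp]
theorem diagram_empty : emptyPartition.diagram = ∅ := by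
  ext p; simp [mem_diagram, emptyPartition]

@[simp]
theorem size_empty : emptyPartition.size = 0 := by simp [size]

theorem eq_empty_of_subset {μ : StrictPartition} (h : μ ⊆ emptyPartition) :
    μ = emptyPartition := by
  ext r
  exact Nat.le_zero.1 (h r)

theorem part_le_size (la : StrictPartition) (r : ℕ) : la.part r ≤ la.size := by
  have : (Finset.range (la.part 0)).card ≤ la.size :=
    Finset.card_le_card_of_injOn (fun j => (0, j))
      (fun j hj => by simpa [mem_diagram] using hj) (fun a _ b _ h => by simpa using h)
  rw [Finset.card_range] at this
  exact (la.part_anti (Nat.zero_le r)).trans this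

theorem part_eq_zero_of_le {la : StrictPartition} {r : ℕ} (h : la.part 0 ≤ r) :
    la.part r = 0 := by
  by_contra h0
  have := la.add_part_le r h0
  omega

theorem finite_size_le (M : ℕ) : {la : StrictPartition | la.size ≤ M}.Finite := by
  refine Set.Finite.of_finite_image (f := diagram) ?_ diagram_injective.injOn
  refine ((Finset.range M ×ˢ Finset.range M).powerset.finite_toSet).subset ?_
  rintro _ ⟨la, hla, rfl⟩
  simp only [Finset.coe_powerset, Set.mem_preimage, Set.mem_powerset_iff, Finset.coe_subset]
  intro p hp
  have h1 := la.part_le_size 0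
  have h2 : la.size ≤ M := hla
  have h3 := hp
  simp only [diagram, Finset.mem_filter, Finset.mem_product, Finset.mem_range] at h3
  simp only [Finset.mem_product, Finset.mem_range]
  omega

/-- The strict partitions of size at most `M`. -/
def sizeLE (M : ℕ) : Finset StrictPartition := (finite_size_le M).toFinset

@[simp]
theorem mem_sizeLE {M : ℕ} {la : StrictPartition} : la ∈ sizeLE M ↔ la.size ≤ M := by
  simp [sizeLE]

/-- The sequence of parts as an exponent vector. -/
def expo (la : StrictPartition) : ℕ →₀ ℕ :=
  Finsupp.onFinset (Finset.range (la.part 0)) la.part fun r hr => by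
    by_contra h
    exact hr (part_eq_zero_of_le (by simpa using h))

@[simp]
theorem expo_apply (la : StrictPartition) (r : ℕ) : la.expo r = la.part r := rfl

theorem expo_injective : Function.Injective expo := fun a b h => by
  ext r
  simpa using DFunLike.congr_fun h r

theorem card_diagram_rows (la : StrictPartition) (s : Finset ℕ) :
    (la.diagram.filter fun p => p.1 ∈ s).card = ∑ r ∈ s, la.part r := by
  have : la.diagram.filter (fun p => p.1 ∈ s) =
      (s.sigma fun r => Finset.Ico r (r + la.part r)).image fun x => (x.1, x.2) := by
    ext ⟨r, c⟩
    simp only [Finset.mem_filter, mem_diagram, Finset.mem_image, Finset.mem_sigma, Finset.mem_Ico,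
      Prod.mk.injEq, Sigma.exists]
    constructor
    · rintro ⟨h1, h2⟩
      exact ⟨r, c, ⟨h2, h1⟩, rfl, rfl⟩
    · rintro ⟨_, _, ⟨h2, h1⟩, rfl, rfl⟩
      exact ⟨h1, h2⟩
  rw [this, Finset.card_image_of_injective, Finset.card_sigma]
  · simp
  · rintro ⟨a, b⟩ ⟨c, d⟩ h
    simpa using h

theorem degree_expo (la : StrictPartition) : la.expo.degree = la.size := by
  have h1 : la.expo.degree = ∑ r ∈ Finset.range (la.part 0), la.part r := by
    rw [Finsupp.degree_apply]
    refine Finset.sum_subset (fun r hr => ?_) fun r _ hr => by simpa using hr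
    by_contra hc
    exact (Finsupp.mem_support_iff.1 hr) (part_eq_zero_of_le (by simpa using hc))
  rw [h1, ← card_diagram_rows, size, Finset.filter_true_of_mem]
  intro p hp
  simp only [diagram, Finset.mem_filter, Finset.mem_product] at hp
  exact hp.1.1

theorem diagram_down {la : StrictPartition} {i r : ℕ} (h : la.HasCorner i)
    (hr : la.part r = i + 1) : (la.down i).diagram = la.diagram.erase (r, r + i) := by
  ext ⟨s, c⟩
  rw [Finset.mem_erase, mem_diagram, mem_diagram]
  simp only [ne_eq, Prod.mk.injEq, not_and]
  by_cases hs : la.part s = i + 1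
  · obtain rfl := la.eq_of_part_eq (hs.trans hr.symm) (by omega)
    rw [down_part_self h hs]
    omega
  · rw [down_part_of_ne hs]
    have : s ≠ r := fun e => hs (e ▸ hr)
    simp [this]

theorem size_down {la : StrictPartition} {i : ℕ} (h : la.HasCorner i) :
    (la.down i).size + 1 = la.size := by
  obtain ⟨r, hr⟩ := h.1
  rw [size, size, diagram_down h hr, Finset.card_erase_add_one]
  rw [mem_diagram]
  simp only
  omega

/-- A box is removable iff it is the last one of its row and its diagonal has a corner. -/
theorem mem_removable_iff (la : StrictPartition) (p : ℕ × ℕ) :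
    p ∈ la.removable ↔ p.1 ≤ p.2 ∧ la.part p.1 = p.2 - p.1 + 1 ∧ la.HasCorner (p.2 - p.1) := by
  obtain ⟨r, c⟩ := p
  simp only [removable, Set.mem_ofPred_eq, mem_diagram]
  constructor
  · rintro ⟨⟨h1, h2⟩, ν, hν⟩
    have mem : ∀ s d, (s ≤ d ∧ d < s + ν.part s) ↔ ((s, d) ≠ (r, c) ∧ s ≤ d ∧ d < s + la.part s) := by
      intro s d
      have := ν.mem_diagram (s, d)
      rw [hν, Finset.mem_erase, la.mem_diagram] at this
      exact this.symm
    have h3 : la.part r = c - r + 1 := by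
      have a1 := mem r (r + la.part r - 1)
      have a2 := mem r c
      simp only [ne_eq, Prod.mk.injEq, true_and, not_true_eq_false, false_and, iff_false] at a1 a2
      omega
    refine ⟨h1, h3, ⟨r, h3⟩, ?_⟩
    rintro j hj ⟨s, hs⟩
    have hs2 : s = r + 1 := by
      have a1 : r < s := by
        by_contra! hc
        have := la.part_anti hc
        omega
      by_contra hne
      have a2 := la.part_lt_of_lt (r := r + 1) (s := s) (by omega)
        (fun h0 => by have := la.part_anti (show r + 1 ≤ s by omega); omega)
      have a3 := la.strict r (by omega)
      omega
    subst hs2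
    have hr : ν.part r = c - r := by
      have a1 := mem r c
      have a2 := mem r (c - 1)
      simp only [ne_eq, Prod.mk.injEq, true_and, not_true_eq_false, false_and, iff_false] at a1 a2
      omega
    have hr1 : ν.part (r + 1) = c - r := by
      have a1 := mem (r + 1) c
      have a2 := mem (r + 1) (c + 1)
      simp only [ne_eq, Prod.mk.injEq] at a1 a2
      omega
    have := ν.strict r (by omega)
    omega
  · rintro ⟨h1, h2, h3⟩
    refine ⟨⟨h1, by omega⟩, la.down (c - r), ?_⟩
    rw [diagram_down h3 h2]
    congr 2
    omega

end StrictPartition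

/-! ### Transfer operators in a quotient of the type B idCoxeter algebra -/

/-- The generators `u 0, u 1, …` satisfy the relations of the idCoxeter algebra of type B with
parameter `b`, strengthened to those of its quotient acting on strict partitions. -/
structure IsIdCoxeter {A E : Type*} [CommRing A] [Ring E] [Algebra A E] (b : A) (u : ℕ → E) :
    Prop where
  sq : ∀ i, u i * u i = b • u i
  comm : ∀ i j, i + 2 ≤ j → u i * u j = u j * u i
  high_low_high : ∀ i, u (i + 1) * u i * u (i + 1) = 0
  low_high_low : ∀ i, u (i + 1) * u (i + 2) * u (i + 1) = 0

section Algebra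

variable {A E : Type*} [CommRing A] [Ring E] [Algebra A E]

/-- The multiplicative formal group law `x ⊕ y = x + y + b x y`. -/
def fgl (b x y : A) : A := x + y + b * x * y

/-- The factor `1 + x u`. -/
def fac (u : E) (x : A) : E := 1 + x • u

/-- The transfer operator `h_N(x) ⋯ h₁(x) h₀(x)^ε h₁(x) ⋯ h_N(x)`, where `h_i(x) = 1 + x u_i` and `ε`
is `2` or `1` according to `q`. -/
def transfer (q : Bool) (u : ℕ → E) (x : A) : ℕ → E
  | 0 => if q then fac (u 0) x * fac (u 0) x else fac (u 0) x
  | N + 1 => fac (u (N + 1)) x * transfer q u x N * fac (u (N + 1)) x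

variable {b : A}

theorem fac_mul_fac {a : E} (ha : a * a = b • a) (x y : A) :
    fac a x * fac a y = fac a (fgl b x y) := by
  simp only [fac, fgl, mul_add, add_mul, smul_mul_assoc, mul_smul_comm, mul_one, one_mul, smul_add,
    ha]
  module

/-- The Yang–Baxter equation. -/
theorem fac_yangBaxter {a c : E} (ha : a * a = b • a) (hc : c * c = b • c) (hac : a * c * a = 0)
    (hca : c * a * c = 0) (x y : A) :
    fac a x * fac c (fgl b x y) * fac a y = fac c y * fac a (fgl b x y) * fac c x := by
  simp only [fac, fgl, mul_add, add_mul, smul_mul_assoc, mul_smul_comm, mul_one, one_mul, smul_add,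
    ha, hc, hac, hca]
  module

/-- The reflection equation for a single boundary factor. -/
theorem fac_reflection {a c : E} (ha : a * a = b • a) (hc : c * c = b • c)
    (hca : c * a * c = 0) (p y : A) :
    fac c p * fac a (fgl b p y) * fac c (fgl b (fgl b p y) y) * fac a y =
      fac a y * fac c (fgl b (fgl b p y) y) * fac a (fgl b p y) * fac c p := by
  have h2 : c * a * a = b • (c * a) := by rw [mul_assoc, ha, mul_smul_comm]
  have h3 : a * c * c = b • (a * c) := by rw [mul_assoc, hc, mul_smul_comm]
  have h5 : a * c * a * c = 0 := by rw [mul_assoc, mul_assoc, ← mul_assoc c, hca, mul_zero]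
  simp only [fac, fgl, mul_add, add_mul, smul_mul_assoc, mul_smul_comm, mul_one, one_mul, smul_add,
    ha, hc, hca, h2, h3, h5, zero_mul]
  module

theorem fac_sq_reflection {a c : E} (ha : a * a = b • a) (hc : c * c = b • c)
    (hca : c * a * c = 0) (p y : A) :
    fac c p * (fac a (fgl b p y) * fac a (fgl b p y)) * fac c (fgl b (fgl b p y) y) *
        (fac a y * fac a y) =
      (fac a y * fac a y) * fac c (fgl b (fgl b p y) y) *
        (fac a (fgl b p y) * fac a (fgl b p y)) * fac c p := by
  have h2 : c * a * a = b • (c * a) := by rw [mul_assoc, ha, mul_smul_comm]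
  have h3 : a * c * c = b • (a * c) := by rw [mul_assoc, hc, mul_smul_comm]
  have h5 : a * c * a * c = 0 := by rw [mul_assoc, mul_assoc, ← mul_assoc c, hca, mul_zero]
  simp only [fac_mul_fac ha]
  simp only [fac, fgl, mul_add, add_mul, smul_mul_assoc, mul_smul_comm, mul_one, one_mul, smul_add,
    ha, hc, hca, h2, h3, h5, zero_mul]
  module

theorem fac_comm {a c : E} (h : a * c = c * a) (x y : A) : Commute (fac a x) (fac c y) := by
  have : Commute a c := h
  exact ((Commute.one_left _).add_left ((((Commute.one_right a).add_right
    (this.smul_right y))).smul_left x))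

theorem transfer_comm_fac {u : ℕ → E} (hu : IsIdCoxeter b u) (q : Bool) (x y : A) {N j : ℕ}
    (hj : N + 2 ≤ j) : Commute (transfer q u x N) (fac (u j) y) := by
  induction N with
  | zero =>
    have h := fac_comm (hu.comm 0 j hj) x y
    cases q
    · exact h
    · exact h.mul_left h
  | succ N ih =>
    have h := fac_comm (hu.comm (N + 1) j hj) x y
    exact (h.mul_left (ih (by omega))).mul_left h

/-- Sklyanin's reflection equation: conjugation by `h_N(x)` on both sides preserves it, by the
Yang–Baxter equation. -/
theorem transfer_reflection {u : ℕ → E} (hu : IsIdCoxeter b u) (q : Bool) (p y : A) (N : ℕ) :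
    fac (u (N + 1)) p * transfer q u (fgl b p y) N * fac (u (N + 1)) (fgl b (fgl b p y) y) *
        transfer q u y N =
      transfer q u y N * fac (u (N + 1)) (fgl b (fgl b p y) y) * transfer q u (fgl b p y) N *
        fac (u (N + 1)) p := by
  induction N with
  | zero =>
    cases q
    · exact fac_reflection (hu.sq 0) (hu.sq 1) (hu.high_low_high 0) p y
    · exact fac_sq_reflection (hu.sq 0) (hu.sq 1) (hu.high_low_high 0) p y
  | succ N ih =>
    simp only [transfer]
    set x := fgl b p y with hx
    set s := fgl b x y with hs
    set a := u (N + 1)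
    set c := u (N + 2)
    set K := transfer q u x N with hK
    set L := transfer q u y N with hL
    have ybe : ∀ z w, fac a z * fac c (fgl b z w) * fac a w =
        fac c w * fac a (fgl b z w) * fac c z :=
      fac_yangBaxter (hu.sq _) (hu.sq _) (hu.low_high_low N) (hu.high_low_high _)
    have hKc : ∀ z, K * fac c z = fac c z * K :=
      fun z => transfer_comm_fac hu q x z (N := N) (j := N + 2) le_rfl
    have hLc : ∀ z, L * fac c z = fac c z * L :=
      fun z => transfer_comm_fac hu q y z (N := N) (j := N + 2) le_rfl
    have e1 := ybe x y
    have e2 := ybe p y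
    have e3 := ybe y x
    have hsym : fgl b y x = s := by simp only [fgl, hs]; ring
    have hsym' : fgl b y p = x := by simp only [fgl, hx]; ring
    have e4 := ybe y p
    rw [← hs] at e1
    rw [← hx] at e2
    rw [hsym] at e3
    rw [hsym'] at e4
    calc fac c p * (fac a x * K * fac a x) * fac c s * (fac a y * L * fac a y)
        = fac c p * fac a x * K * (fac a x * fac c s * fac a y) * L * fac a y := by
          simp only [mul_assoc]
      _ = fac c p * fac a x * (K * fac c y) * fac a s * (fac c x * L) * fac a y := by
          rw [e1]; simp only [mul_assoc]
      _ = (fac c p * fac a x * fac c y) * K * fac a s * L * fac c x * fac a y := by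
          rw [hKc, ← hLc]; simp only [mul_assoc]
      _ = fac a y * fac c x * (fac a p * K * fac a s * L) * fac c x * fac a y := by
          rw [← e4]; simp only [mul_assoc]
      _ = fac a y * fac c x * L * fac a s * K * (fac a p * fac c x * fac a y) := by
          rw [ih]; simp only [mul_assoc]
      _ = fac a y * (fac c x * L) * fac a s * (K * fac c y) * fac a x * fac c p := by
          rw [e2]; simp only [mul_assoc]
      _ = fac a y * L * (fac c x * fac a s * fac c y) * K * fac a x * fac c p := by
          rw [hKc, ← hLc]; simp only [mul_assoc]
      _ = fac a y * L * fac a y * fac c s * (fac a x * K * fac a x) * fac c p := by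
          rw [← e3]; simp only [mul_assoc]

theorem transfer_comm {u : ℕ → E} (hu : IsIdCoxeter b u) (q : Bool) (p y : A) (N : ℕ) :
    transfer q u (fgl b p y) N * transfer q u y N =
      transfer q u y N * transfer q u (fgl b p y) N := by
  cases N with
  | zero =>
    have h := fac_comm (a := u 0) (c := u 0) rfl (fgl b p y) y
    cases q
    · exact h
    · exact (h.mul_left h).mul_right (h.mul_left h)
  | succ N =>
    simp only [transfer]
    have h := transfer_reflection hu q p y N
    set x := fgl b p y with hx
    set a := u (N + 1)
    have h1 : ∀ z w, fac a z * fac a w = fac a (fgl b z w) := fac_mul_fac (hu.sq _)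
    have hsym' : fgl b y p = x := by simp only [fgl, hx]; ring
    have hsym : fgl b y x = fgl b x y := by simp only [fgl]; ring
    calc fac a x * transfer q u x N * fac a x * (fac a y * transfer q u y N * fac a y)
        = fac a x * transfer q u x N * (fac a x * fac a y) * transfer q u y N * fac a y := by
          simp only [mul_assoc]
      _ = fac a y * (fac a p * transfer q u x N * fac a (fgl b x y) * transfer q u y N) *
            fac a y := by
          rw [h1, show fac a x = fac a y * fac a p by rw [h1, hsym']]; simp only [mul_assoc]
      _ = fac a y * transfer q u y N * (fac a (fgl b x y)) * transfer q u x N *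
            (fac a p * fac a y) := by
          rw [h]; simp only [mul_assoc]
      _ = fac a y * transfer q u y N * fac a y * (fac a x * transfer q u x N * fac a x) := by
          rw [h1 p y, ← hx, ← hsym, ← h1 y x]; simp only [mul_assoc]

/-- `T(x) T(y) ≡ 1` modulo `x ⊕ y`. -/
theorem exists_transfer_mul_eq {u : ℕ → E} (hu : IsIdCoxeter b u) (q : Bool) (x y : A) (N : ℕ) :
    ∃ M : E, transfer q u x N * transfer q u y N = 1 + fgl b x y • M := by
  induction N with
  | zero =>
    have h1 : ∀ z w, fac (u 0) z * fac (u 0) w = fac (u 0) (fgl b z w) := fac_mul_fac (hu.sq _)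
    cases q
    · exact ⟨u 0, h1 x y⟩
    · refine ⟨(2 + b * fgl b x y) • u 0, ?_⟩
      simp only [transfer, if_true]
      rw [mul_assoc, ← mul_assoc (fac (u 0) x) (fac (u 0) y), h1 x y,
        ← fac_comm (a := u 0) (c := u 0) rfl y (fgl b x y), ← mul_assoc, h1, h1]
      rw [fac, smul_smul]
      congr 2
      simp only [fgl]; ring
  | succ N ih =>
    obtain ⟨M, hM⟩ := ih
    set a := u (N + 1)
    have h1 : ∀ z w, fac a z * fac a w = fac a (fgl b z w) := fac_mul_fac (hu.sq _)
    have h2 : fac a (fgl b x y) = 1 + fgl b x y • a := rfl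
    refine ⟨a + fac a x * M * fac a y + fac a x * transfer q u x N * a * transfer q u y N * fac a y,
      ?_⟩
    calc fac a x * transfer q u x N * fac a x * (fac a y * transfer q u y N * fac a y)
        = fac a x * transfer q u x N * (fac a x * fac a y) * transfer q u y N * fac a y := by
          simp only [mul_assoc]
      _ = fac a x * (transfer q u x N * transfer q u y N) * fac a y +
          fgl b x y • (fac a x * transfer q u x N * a * transfer q u y N * fac a y) := by
          rw [h1, h2]
          simp only [mul_add, add_mul, mul_one, mul_assoc, smul_mul_assoc, mul_smul_comm]
      _ = _ := by
          rw [hM]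
          simp only [mul_add, add_mul, mul_one, smul_mul_assoc, mul_smul_comm]
          rw [h1, h2]
          module

/-- The operator `M` with `T(x) = 1 + (x ⊕ x) M` (see `transfer_true_eq`). -/
def transferQuot (u : ℕ → E) (x : A) : ℕ → E
  | 0 => u 0
  | N + 1 => u (N + 1) + fac (u (N + 1)) x * transferQuot u x N * fac (u (N + 1)) x

theorem transfer_true_eq {u : ℕ → E} (hu : IsIdCoxeter b u) (x : A) (N : ℕ) :
    transfer true u x N = 1 + fgl b x x • transferQuot u x N := by
  induction N with
  | zero => exact fac_mul_fac (hu.sq 0) x x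
  | succ N ih =>
    have h1 := fac_mul_fac (hu.sq (N + 1)) x x
    rw [transfer, ih, transferQuot]
    simp only [mul_add, add_mul, mul_one, smul_mul_assoc, mul_smul_comm]
    rw [h1, fac]
    module

end Algebra

/-! ### The action on functions of strict partitions -/

namespace StrictPartition

section Peel

variable {A : Type*} [CommRing A]

open Classical in
/-- The operator `u_i` on functions of strict partitions, which keeps the removable box on diagonal
`i`, with weight `b`, or removes it. -/
def peel (b : A) (i : ℕ) : Module.End A (StrictPartition → A) where
  toFun F la := if la.HasCorner i then b * F la + F (la.down i) else 0
  map_add' F G := by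
    funext la
    simp only [Pi.add_apply]
    split_ifs <;> ring
  map_smul' c F := by
    funext la
    simp only [Pi.smul_apply, smul_eq_mul, RingHom.id_apply]
    split_ifs <;> ring

theorem peel_apply_of_hasCorner (b : A) {i : ℕ} (F : StrictPartition → A) {la : StrictPartition}
    (h : la.HasCorner i) : peel b i F la = b * F la + F (la.down i) := if_pos h

theorem peel_apply_of_not_hasCorner (b : A) {i : ℕ} (F : StrictPartition → A)
    {la : StrictPartition} (h : ¬ la.HasCorner i) : peel b i F la = 0 := if_neg h

theorem isIdCoxeter_peel (b : A) : IsIdCoxeter b (peel b) where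
  sq i := by
    refine LinearMap.ext fun F => funext fun la => ?_
    change peel b i (peel b i F) la = b * peel b i F la
    by_cases h : la.HasCorner i
    · rw [peel_apply_of_hasCorner b _ h, peel_apply_of_not_hasCorner b _ (not_hasCorner_down_self h),
        add_zero]
    · rw [peel_apply_of_not_hasCorner b _ h, peel_apply_of_not_hasCorner b _ h, mul_zero]
  comm i j hij := by
    refine LinearMap.ext fun F => funext fun la => ?_
    change peel b i (peel b j F) la = peel b j (peel b i F) la
    by_cases hi : la.HasCorner i <;> by_cases hj : la.HasCorner j
    · have h1 := (hasCorner_down_iff hi (.inl hij)).2 hj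
      have h2 := (hasCorner_down_iff hj (.inr hij)).2 hi
      simp only [peel_apply_of_hasCorner b _ hi, peel_apply_of_hasCorner b _ hj,
        peel_apply_of_hasCorner b _ h1, peel_apply_of_hasCorner b _ h2,
        down_comm hi hj (.inl hij)]
      ring
    · have h1 := mt (hasCorner_down_iff hi (.inl hij)).1 hj
      simp [peel_apply_of_hasCorner b _ hi, peel_apply_of_not_hasCorner b _ hj,
        peel_apply_of_not_hasCorner b _ h1]
    · have h2 := mt (hasCorner_down_iff hj (.inr hij)).1 hi
      simp [peel_apply_of_not_hasCorner b _ hi, peel_apply_of_hasCorner b _ hj,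
        peel_apply_of_not_hasCorner b _ h2]
    · simp [peel_apply_of_not_hasCorner b _ hi, peel_apply_of_not_hasCorner b _ hj]
  high_low_high i := by
    refine LinearMap.ext fun F => funext fun la => ?_
    change peel b (i + 1) (peel b i (peel b (i + 1) F)) la = 0
    by_cases h : la.HasCorner (i + 1)
    · rw [peel_apply_of_hasCorner b _ h, peel_apply_of_not_hasCorner b _ (not_hasCorner_pred h)]
      by_cases h1 : (la.down (i + 1)).HasCorner i
      · rw [peel_apply_of_hasCorner b _ h1,
          peel_apply_of_not_hasCorner b _ (not_hasCorner_down_self h),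
          peel_apply_of_not_hasCorner b _ (not_hasCorner_up_down_up h h1)]
        simp
      · rw [peel_apply_of_not_hasCorner b _ h1]
        simp
    · rw [peel_apply_of_not_hasCorner b _ h]
  low_high_low i := by
    refine LinearMap.ext fun F => funext fun la => ?_
    change peel b (i + 1) (peel b (i + 2) (peel b (i + 1) F)) la = 0
    by_cases h : la.HasCorner (i + 1)
    · rw [peel_apply_of_hasCorner b _ h, peel_apply_of_not_hasCorner b _ (not_hasCorner_succ h)]
      by_cases h1 : (la.down (i + 1)).HasCorner (i + 2)
      · rw [peel_apply_of_hasCorner b _ h1,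
          peel_apply_of_not_hasCorner b _ (not_hasCorner_down_self h),
          peel_apply_of_not_hasCorner b _ (not_hasCorner_down_up_down (by omega) h h1)]
        simp
      · rw [peel_apply_of_not_hasCorner b _ h1]
        simp
    · rw [peel_apply_of_not_hasCorner b _ h]

end Peel

end StrictPartition

/-! ### Products of transfer operators -/

namespace StrictPartition

section Evolution

variable {A : Type*} [CommRing A] {b : A}

theorem fac_peel_apply (i : ℕ) (x : A) (F : StrictPartition → A) (la : StrictPartition) :
    fac (peel b i) x F la = F la + x * peel b i F la := rfl

theorem transfer_induction {E : Type*} [Ring E] [Algebra A E] {P : E → Prop} {u : ℕ → E} {x : A}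
    (hu : ∀ i, P (fac (u i) x)) (hmul : ∀ a c, P a → P c → P (a * c)) (q : Bool) (N : ℕ) :
    P (transfer q u x N) := by
  induction N with
  | zero => cases q <;> simp [transfer, hu, hmul]
  | succ N ih => exact hmul _ _ (hmul _ _ (hu _) ih) (hu _)

/-- `T(x_{n-1}) ⋯ T(x_0)`, where `T` involves the diagonals up to `N`. -/
def evol (b : A) (q : Bool) (N : ℕ) (x : ℕ → A) : ℕ → Module.End A (StrictPartition → A)
  | 0 => 1
  | n + 1 => transfer q (peel b) (x n) N * evol b q N x n

theorem evol_congr {q : Bool} {N n : ℕ} {x y : ℕ → A} (h : ∀ i < n, x i = y i) :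
    evol b q N x n = evol b q N y n := by
  induction n with
  | zero => rfl
  | succ n ih => rw [evol, evol, ih fun i hi => h i (by omega), h n (by omega)]

theorem evol_add {q : Bool} {N : ℕ} (x : ℕ → A) (n m : ℕ) :
    evol b q N x (n + m) = evol b q N (fun i => x (n + i)) m * evol b q N x n := by
  induction m with
  | zero => simp [evol]
  | succ m ih => rw [← add_assoc, evol, ih, evol, mul_assoc]

theorem evol_induction {P : Module.End A (StrictPartition → A) → Prop} {x : ℕ → A} {n : ℕ}
    (hone : P 1) (hu : ∀ j < n, ∀ i, P (fac (peel b i) (x j)))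
    (hmul : ∀ a c, P a → P c → P (a * c)) (q : Bool) (N : ℕ) : P (evol b q N x n) := by
  induction n with
  | zero => exact hone
  | succ n ih =>
    exact hmul _ _ (transfer_induction (hu n (by omega)) hmul q N)
      (ih fun j hj => hu j (by omega))

/-- The value at `la` after applying the operators depends only on the values at the partitions
contained in `la`. -/
theorem evol_apply_congr {q : Bool} {N n : ℕ} {x : ℕ → A} {F G : StrictPartition → A}
    {la : StrictPartition} (h : ∀ μ ⊆ la, F μ = G μ) :
    evol b q N x n F la = evol b q N x n G la := by
  refine evol_induction (P := fun T => ∀ (F G : StrictPartition → A) (la : StrictPartition),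
    (∀ μ ⊆ la, F μ = G μ) → T F la = T G la) ?_ ?_ ?_ q N F G la h
  · intro F G la h
    exact h la (subset_refl la)
  · intro j _ i F G la h
    rw [fac_peel_apply, fac_peel_apply, h la (subset_refl la)]
    by_cases hc : la.HasCorner i
    · rw [peel_apply_of_hasCorner b _ hc, peel_apply_of_hasCorner b _ hc, h la (subset_refl la),
        h _ (down_subset la i)]
    · rw [peel_apply_of_not_hasCorner b _ hc, peel_apply_of_not_hasCorner b _ hc]
  · intro S T hS hT F G la h
    refine hS (T F) (T G) la fun μ hμ => hT F G μ fun ν hν => h ν (subset_trans hν hμ)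

open Classical in
/-- The matrix coefficient of `T(x_{n-1}) ⋯ T(x_0)` at `(la, μ)`: the value at `la` of the image of the
indicator function of `μ`. -/
def matCoeff (b : A) (q : Bool) (N : ℕ) (x : ℕ → A) (n : ℕ) (la μ : StrictPartition) : A :=
  evol b q N x n (Pi.single μ 1) la

theorem evol_apply_eq_sum {q : Bool} {N n : ℕ} (x : ℕ → A) (F : StrictPartition → A)
    (la : StrictPartition) :
    evol b q N x n F la = ∑ μ ∈ la.lower, F μ * matCoeff b q N x n la μ := by
  classical
  have h : ∀ ν ⊆ la, F ν = (∑ μ ∈ la.lower, F μ • (Pi.single μ 1 : StrictPartition → A)) ν := by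
    intro ν hν
    rw [Finset.sum_apply, Finset.sum_eq_single ν]
    · simp
    · intro μ _ hμ
      simp [hμ.symm]
    · intro h
      simp [hν] at h
  rw [evol_apply_congr h, map_sum, Finset.sum_apply]
  refine Finset.sum_congr rfl fun μ _ => ?_
  rw [map_smul]
  simp only [matCoeff, Pi.smul_apply, smul_eq_mul]

theorem matCoeff_add {q : Bool} {N : ℕ} (x : ℕ → A) (n m : ℕ) (la μ : StrictPartition) :
    matCoeff b q N x (n + m) la μ = ∑ κ ∈ la.lower,
      matCoeff b q N x n κ μ * matCoeff b q N (fun i => x (n + i)) m la κ := by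
  rw [matCoeff, evol_add]
  exact evol_apply_eq_sum _ _ _

theorem evol_map {A' : Type*} [CommRing A'] (φ : A →+* A') {q : Bool} {N n : ℕ} (x : ℕ → A)
    (F : StrictPartition → A) (la : StrictPartition) :
    φ (evol b q N x n F la) =
      evol (φ b) q N (fun i => φ (x i)) n (fun μ => φ (F μ)) la := by
  have h1 : ∀ y i (F : StrictPartition → A), (fun μ => φ (fac (peel b i) y F μ)) =
      fac (peel (φ b) i) (φ y) (fun μ => φ (F μ)) := by
    intro y i F
    funext la
    rw [fac_peel_apply, fac_peel_apply]
    by_cases hc : la.HasCorner i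
    · simp [peel_apply_of_hasCorner _ _ hc]
    · simp [peel_apply_of_not_hasCorner _ _ hc]
  have h2 : ∀ y (F : StrictPartition → A), (fun μ => φ (transfer q (peel b) y N F μ)) =
      transfer q (peel (φ b)) (φ y) N (fun μ => φ (F μ)) := by
    intro y
    induction N with
    | zero =>
      intro F
      cases q
      · exact h1 y 0 F
      · simp only [transfer, if_true, Module.End.mul_apply]
        rw [h1, h1]
    | succ N ih =>
      intro F
      simp only [transfer, Module.End.mul_apply]
      rw [h1, ih, h1]
  have h3 : (fun μ => φ (evol b q N x n F μ)) =
      evol (φ b) q N (fun i => φ (x i)) n (fun μ => φ (F μ)) := by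
    induction n with
    | zero => rfl
    | succ n ih =>
      simp only [evol, Module.End.mul_apply]
      rw [h2, ih]
  exact congrFun h3 la

theorem matCoeff_map {A' : Type*} [CommRing A'] (φ : A →+* A') {q : Bool} {N n : ℕ} (x : ℕ → A)
    (la μ : StrictPartition) :
    φ (matCoeff b q N x n la μ) = matCoeff (φ b) q N (fun i => φ (x i)) n la μ := by
  classical
  have h : (fun ν => φ ((Pi.single μ 1 : StrictPartition → A) ν)) = Pi.single μ 1 := by
    funext ν
    simp only [Pi.single_apply]
    split_ifs <;> simp
  rw [matCoeff, evol_map, matCoeff, ← h]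

theorem transfer_zero (q : Bool) (N : ℕ) : transfer q (peel b) (0 : A) N = 1 :=
  transfer_induction (P := fun T => T = 1) (fun i => by simp [fac])
    (fun a c ha hc => by rw [ha, hc, one_mul]) q N

/-- Symmetry: two adjacent factors commute. The commutation is available for `x_i = p ⊕ x_{i+1}`, which
is no restriction where `1 + b x_{i+1}` is invertible. -/
theorem evol_swap {q : Bool} {N n i : ℕ} (x : ℕ → A) (hi : i + 1 < n) {p : A}
    (hp : x i = fgl b p (x (i + 1))) :
    evol b q N (fun j => x (Equiv.swap i (i + 1) j)) n = evol b q N x n := by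
  induction n, hi using Nat.le_induction with
  | base =>
    have h1 : evol b q N (fun j => x (Equiv.swap i (i + 1) j)) i = evol b q N x i :=
      evol_congr fun j hj => by rw [Equiv.swap_apply_of_ne_of_ne (by omega) (by omega)]
    rw [evol, evol, evol, evol, h1, Equiv.swap_apply_left, Equiv.swap_apply_right, ← mul_assoc,
      ← mul_assoc, hp, transfer_comm (isIdCoxeter_peel b)]
  | succ n hn ih =>
    rw [evol, evol, ih, Equiv.swap_apply_of_ne_of_ne (by omega) (by omega)]

/-- Modulo `x_i ⊕ x_{i+1}`, the product does not depend on `x_i` and `x_{i+1}`. -/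
theorem exists_evol_eq {q : Bool} {N n i : ℕ} (x : ℕ → A) (hi : i + 1 < n) :
    ∃ M, evol b q N x n =
      evol b q N (fun j => if j = i ∨ j = i + 1 then 0 else x j) n +
        fgl b (x i) (x (i + 1)) • M := by
  induction n, hi using Nat.le_induction with
  | base =>
    obtain ⟨M, hM⟩ := exists_transfer_mul_eq (isIdCoxeter_peel b) q (x (i + 1)) (x i) N
    refine ⟨M * evol b q N x i, ?_⟩
    have h1 : evol b q N (fun j => if j = i ∨ j = i + 1 then 0 else x j) i = evol b q N x i :=
      evol_congr fun j hj => if_neg (by omega)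
    have hsym : fgl b (x (i + 1)) (x i) = fgl b (x i) (x (i + 1)) := by simp only [fgl]; ring
    rw [evol, evol, evol, evol, h1, if_pos (by simp), if_pos (by simp), transfer_zero, one_mul,
      one_mul, ← mul_assoc, hM, add_mul, one_mul, smul_mul_assoc, hsym]
  | succ n hn ih =>
    obtain ⟨M, hM⟩ := ih
    refine ⟨transfer q (peel b) (x n) N * M, ?_⟩
    rw [evol, evol, hM, if_neg (by omega), mul_add, mul_smul_comm]

theorem fac_peel_mem {B : AddSubgroup A} {x : A} (hb : ∀ f ∈ B, b * f ∈ B)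
    (hx : ∀ f ∈ B, x * f ∈ B) (i : ℕ) {F : StrictPartition → A} (hF : ∀ μ, F μ ∈ B)
    (la : StrictPartition) : peel b i F la ∈ B ∧ fac (peel b i) x F la ∈ B := by
  have h1 : peel b i F la ∈ B := by
    by_cases hc : la.HasCorner i
    · rw [peel_apply_of_hasCorner b _ hc]
      exact B.add_mem (hb _ (hF _)) (hF _)
    · rw [peel_apply_of_not_hasCorner b _ hc]
      exact B.zero_mem
  exact ⟨h1, B.add_mem (hF _) (hx _ h1)⟩

theorem transferQuot_mem {B : AddSubgroup A} {x : A} (hb : ∀ f ∈ B, b * f ∈ B)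
    (hx : ∀ f ∈ B, x * f ∈ B) (N : ℕ) {F : StrictPartition → A} (hF : ∀ μ, F μ ∈ B)
    (la : StrictPartition) : transferQuot (peel b) x N F la ∈ B := by
  induction N generalizing F la with
  | zero => exact (fac_peel_mem hb hx 0 hF la).1
  | succ N ih =>
    exact B.add_mem (fac_peel_mem hb hx _ hF la).1
      (fac_peel_mem hb hx _ (fun μ => ih (fun ν => (fac_peel_mem hb hx _ hF ν).2) μ) la).2

end Evolution

end StrictPartition

/-! ### Boxes next to a corner -/

namespace StrictPartition

theorem add_part_anti (la : StrictPartition) {r s : ℕ} (h : r ≤ s) (hs : la.part s ≠ 0) :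
    s + la.part s ≤ r + la.part r := by
  induction s, h using Nat.le_induction with
  | base => exact le_rfl
  | succ s _ ih =>
    have h0 : la.part s ≠ 0 := fun h0 => hs (la.stop_zero s h0)
    have h1 := la.strict s h0
    have h2 := ih h0
    omega

/-- No box of the diagram lies to the right of or below the removable box `(r, r + i)`. -/
theorem HasCorner.not_mem {la : StrictPartition} {i r : ℕ} (h : la.HasCorner i)
    (hr : la.part r = i + 1) {p : ℕ × ℕ}
    (hp : (p.1 = r ∧ r + i < p.2) ∨ (p.2 = r + i ∧ r < p.1)) : p ∉ la.diagram := by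
  obtain ⟨s, c⟩ := p
  rw [mem_diagram]
  simp only at hp ⊢
  rintro ⟨h1, h2⟩
  rcases hp with ⟨rfl, h3⟩ | ⟨rfl, h3⟩
  · omega
  · have h4 := la.add_part_anti (r := r + 1) (s := s) h3 (by omega)
    have h5 := h.next_lt hr (by omega)
    omega

/-- A removable box of `la` lying in `μ ⊆ la` is removable from `μ`. -/
theorem HasCorner.mem_removable {la μ : StrictPartition} {i r : ℕ} (h : la.HasCorner i)
    (hr : la.part r = i + 1) (hμ : μ ⊆ la) (hp : (r, r + i) ∈ μ.diagram) :
    (r, r + i) ∈ μ.removable := by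
  rw [mem_diagram] at hp
  rw [mem_removable_iff]
  simp only at hp ⊢
  have h1 := hμ r
  have h2 : r + i - r = i := by omega
  have h3 : μ.part r = i + 1 := by omega
  refine ⟨by omega, by omega, ?_⟩
  rw [h2]
  refine ⟨⟨r, h3⟩, ?_⟩
  rintro j hj ⟨s, hs⟩
  have h4 : r < s := by
    by_contra! hc
    have := μ.part_anti hc
    omega
  have h5 := la.part_lt_of_lt h4 (by omega)
  have h6 := hμ s
  exact h.2 j hj ⟨s, by omega⟩

end StrictPartition

/-! ### Fillings and transfer operators -/

open StrictPartition

/-- A set-valued shifted tableau, given as the set of pairs (box, letter), on the boxes of `la`: all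
boxes outside `μ` are filled, and some removable boxes of `μ` may be filled too. The pairs
(letter, diagonal) that occur have to belong to `P`. -/
structure IsFilling (P : Finset (ℕ × ℕ)) (la μ : StrictPartition) (T : Finset ((ℕ × ℕ) × ℕ)) :
    Prop where
  sub : μ ⊆ la
  cover : ∀ p ∈ la.diagram, p ∉ μ.diagram → ∃ k, (p, k) ∈ T
  box : ∀ s ∈ T, s.1 ∈ la.diagram
  rem : ∀ s ∈ T, s.1 ∈ μ.diagram → s.1 ∈ μ.removable
  letter : ∀ s ∈ T, (s.2, s.1.2 - s.1.1) ∈ P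
  row : ∀ s ∈ T, ∀ t ∈ T, s.1.1 = t.1.1 → s.1.2 < t.1.2 → s.2 < t.2 ∨ (s.2 = t.2 ∧ ¬ Even s.2)
  col : ∀ s ∈ T, ∀ t ∈ T, s.1.2 = t.1.2 → s.1.1 < t.1.1 → s.2 < t.2 ∨ (s.2 = t.2 ∧ Even s.2)

open Classical in
/-- The finite set of fillings. -/
def fillings (P : Finset (ℕ × ℕ)) (la μ : StrictPartition) : Finset (Finset ((ℕ × ℕ) × ℕ)) :=
  (la.diagram ×ˢ P.image Prod.fst).powerset.filter (IsFilling P la μ)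

theorem mem_fillings {P : Finset (ℕ × ℕ)} {la μ : StrictPartition} {T : Finset ((ℕ × ℕ) × ℕ)} :
    T ∈ fillings P la μ ↔ IsFilling P la μ T := by
  simp only [fillings, Finset.mem_filter, Finset.mem_powerset, and_iff_right_iff_imp]
  intro h s hs
  exact Finset.mem_product.2 ⟨h.box s hs, Finset.mem_image_of_mem Prod.fst (h.letter s hs)⟩

/-- The exponent vector of a filling. -/
def fillWeight (T : Finset ((ℕ × ℕ) × ℕ)) : ℕ →₀ ℕ := ∑ s ∈ T, Finsupp.single (s.2 / 2) 1

/-- The term `β^{|T| - |λ| + |μ|} x^T` of a filling; the exponent of `β` is not truncated, by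
`IsFilling.size_le`. -/
def fillTerm (la μ : StrictPartition) (T : Finset ((ℕ × ℕ) × ℕ)) : Series :=
  MvPowerSeries.monomial (fillWeight T) (β ^ (T.card + μ.size - la.size))

/-- The generating function of fillings. -/
def fillSum (P : Finset (ℕ × ℕ)) (μ la : StrictPartition) : Series :=
  ∑ T ∈ fillings P la μ, fillTerm la μ T

theorem coeff_fillSum (P : Finset (ℕ × ℕ)) (la μ : StrictPartition) (d : ℕ →₀ ℕ) :
    MvPowerSeries.coeff d (fillSum P μ la) =
      ∑ F ∈ (fillings P la μ).filter (fun F => fillWeight F = d),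
        β ^ (F.card + μ.size - la.size) := by
  classical
  rw [fillSum, map_sum, Finset.sum_filter]
  refine Finset.sum_congr rfl fun F _ => ?_
  rw [fillTerm, MvPowerSeries.coeff_monomial]
  simp only [eq_comm]

namespace IsFilling

variable {P : Finset (ℕ × ℕ)} {la μ : StrictPartition} {T : Finset ((ℕ × ℕ) × ℕ)} {k i : ℕ}

theorem size_le (h : IsFilling P la μ T) : la.size ≤ T.card + μ.size := by
  classical
  have h1 : la.diagram ⊆ T.image Prod.fst ∪ μ.diagram := by
    intro p hp
    by_cases hμ : p ∈ μ.diagram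
    · exact Finset.mem_union_right _ hμ
    · obtain ⟨k, hk⟩ := h.cover p hp hμ
      exact Finset.mem_union_left _ (Finset.mem_image_of_mem Prod.fst hk)
  calc la.size ≤ (T.image Prod.fst ∪ μ.diagram).card := Finset.card_le_card h1
    _ ≤ (T.image Prod.fst).card + μ.diagram.card := Finset.card_union_le _ _
    _ ≤ T.card + μ.size := by
      have := Finset.card_image_le (s := T) (f := Prod.fst)
      simp only [size]
      omega

/-- If the pair `(k, i)` comes after all pairs in `P`, then a box on the diagonal `i` containing the
letter `k` is removable. -/
theorem hasCorner (h : IsFilling (insert (k, i) P) la μ T) (hP : ∀ s ∈ P, s.1 ≤ k)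
    (hodd : ¬ Even k → ∀ j, (k, j) ∈ P → j < i) (heven : Even k → ∀ j, (k, j) ∈ P → i < j)
    {p : ℕ × ℕ} (hp : (p, k) ∈ T) (hi : p.2 - p.1 = i) :
    la.HasCorner i ∧ la.part p.1 = i + 1 ∧ p.2 = p.1 + i := by
  obtain ⟨r, c⟩ := p
  have h1 := h.box _ hp
  simp only [mem_diagram] at h1
  simp only at hi ⊢
  have key : ∀ q : ℕ × ℕ, q ∈ la.diagram → (q = (r, c + 1) ∨ q = (r + 1, c)) → False := by
    intro q hq hqc
    by_cases hqμ : q ∈ μ.diagram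
    · have hpμ : (r, c) ∈ μ.diagram := by
        rw [mem_diagram] at hqμ ⊢
        rcases hqc with rfl | rfl
        · simp only at hqμ ⊢; omega
        · simp only at hqμ ⊢
          have := μ.add_part_anti (Nat.le_add_right r 1) (by omega)
          omega
      have hpr := h.rem _ hp hpμ
      rw [mem_removable_iff] at hpr
      simp only at hpr
      refine hpr.2.2.not_mem (r := r) hpr.2.1 ?_ hqμ
      rcases hqc with rfl | rfl
      · exact .inl ⟨rfl, by simp only; omega⟩
      · exact .inr ⟨by simp only; omega, by simp⟩
    · obtain ⟨b, hb⟩ := h.cover q hq hqμ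
      have hlet := Finset.mem_insert.1 (h.letter _ hb)
      simp only at hlet
      rcases hqc with rfl | rfl
      · simp only at hlet
        have hbP : (b, c + 1 - r) ∈ P := hlet.resolve_left fun e => by
          rw [Prod.mk.injEq] at e; omega
        have h2 := hP _ hbP
        simp only at h2
        have h3 := h.row _ hp _ hb rfl (by simp)
        simp only at h3
        obtain ⟨rfl, h4⟩ : k = b ∧ ¬ Even k := h3.resolve_left (by omega)
        have := hodd h4 _ hbP
        omega
      · simp only [mem_diagram] at hlet hq
        have hbP : (b, c - (r + 1)) ∈ P := hlet.resolve_left fun e => by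
          rw [Prod.mk.injEq] at e; omega
        have h2 := hP _ hbP
        simp only at h2
        have h3 := h.col _ hp _ hb rfl (by simp)
        simp only at h3
        obtain ⟨rfl, h4⟩ : k = b ∧ Even k := h3.resolve_left (by omega)
        have := heven h4 _ hbP
        omega
  have h2 : la.part r = i + 1 := by
    by_contra hne
    exact key (r, c + 1) ((mem_diagram _ _).2 ⟨by simp only; omega, by simp only; omega⟩) (.inl rfl)
  refine ⟨⟨⟨r, h2⟩, ?_⟩, h2, by omega⟩
  rintro j hj ⟨s, hs⟩
  have h3 : r < s := by
    by_contra! hc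
    have := la.part_anti hc
    omega
  have h4 := la.part_anti (show r + 1 ≤ s from h3)
  exact key (r + 1, c) ((mem_diagram _ _).2 ⟨by simp only; omega, by simp only; omega⟩) (.inr rfl)

theorem mono {P' : Finset (ℕ × ℕ)} (h : IsFilling P la μ T) (hP : P ⊆ P') :
    IsFilling P' la μ T :=
  { h with letter := fun s hs => hP (h.letter s hs) }

/-- The letter `k` may be added to the removable box on the diagonal `i`. -/
theorem insert_letter (h : IsFilling P la μ T) (hP : ∀ s ∈ P, s.1 ≤ k)
    (hodd : ¬ Even k → ∀ j, (k, j) ∈ P → j < i) (heven : Even k → ∀ j, (k, j) ∈ P → i < j)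
    {r : ℕ} (hc : la.HasCorner i) (hr : la.part r = i + 1) :
    IsFilling (insert (k, i) P) la μ (insert ((r, r + i), k) T) := by
  have hmem : (r, r + i) ∈ la.diagram := (mem_diagram _ _).2 ⟨by simp, by simp only; omega⟩
  refine ⟨h.sub, ?_, ?_, ?_, ?_, ?_, ?_⟩
  · intro p hp hμ
    obtain ⟨a, ha⟩ := h.cover p hp hμ
    exact ⟨a, Finset.mem_insert_of_mem ha⟩
  · intro s hs
    rcases Finset.mem_insert.1 hs with rfl | hs
    · exact hmem
    · exact h.box s hs
  · intro s hs hμ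
    rcases Finset.mem_insert.1 hs with rfl | hs
    · exact hc.mem_removable hr h.sub hμ
    · exact h.rem s hs hμ
  · intro s hs
    rcases Finset.mem_insert.1 hs with rfl | hs
    · simp
    · exact Finset.mem_insert_of_mem (h.letter s hs)
  · intro s hs t ht h1 h2
    rcases Finset.mem_insert.1 hs with rfl | hs <;> rcases Finset.mem_insert.1 ht with rfl | ht
    · omega
    · exact absurd (h.box t ht) (hc.not_mem hr (.inl ⟨h1.symm, h2⟩))
    · simp only at h1 h2 ⊢
      have h3 := h.letter s hs
      have h4 := hP _ h3
      have h6 := (mem_diagram _ _).1 (h.box s hs)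
      simp only at h4
      rcases h4.lt_or_eq with h5 | h5
      · exact .inl h5
      · refine .inr ⟨h5, fun he => ?_⟩
        rw [h5] at h3 he
        have := heven he _ h3
        omega
    · exact h.row s hs t ht h1 h2
  · intro s hs t ht h1 h2
    rcases Finset.mem_insert.1 hs with rfl | hs <;> rcases Finset.mem_insert.1 ht with rfl | ht
    · omega
    · exact absurd (h.box t ht) (hc.not_mem hr (.inr ⟨h1.symm, h2⟩))
    · simp only at h1 h2 ⊢
      have h3 := h.letter s hs
      have h4 := hP _ h3
      simp only at h4
      rcases h4.lt_or_eq with h5 | h5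
      · exact .inl h5
      · refine .inr ⟨h5, ?_⟩
        by_contra he
        rw [h5] at h3 he
        have := hodd he _ h3
        omega
    · exact h.col s hs t ht h1 h2

/-- The removable box on the diagonal `i` may be added to the shape, filled with the letter `k`. -/
theorem of_down (h : IsFilling P (la.down i) μ T) {r : ℕ} (hc : la.HasCorner i)
    (hr : la.part r = i + 1) (hP : ∀ s ∈ P, s.1 ≤ k)
    (hodd : ¬ Even k → ∀ j, (k, j) ∈ P → j < i) (heven : Even k → ∀ j, (k, j) ∈ P → i < j) :
    IsFilling (insert (k, i) P) la μ (insert ((r, r + i), k) T) := by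
  have hd := diagram_down hc hr
  have hmem : (r, r + i) ∈ la.diagram := (mem_diagram _ _).2 ⟨by simp, by simp only; omega⟩
  have hpμ : (r, r + i) ∉ μ.diagram := fun hp => by
    have := diagram_subset h.sub hp
    rw [hd] at this
    simp at this
  have hbox : ∀ s ∈ T, s.1 ∈ la.diagram := fun s hs => by
    have := h.box s hs
    rw [hd] at this
    exact Finset.mem_of_mem_erase this
  refine ⟨subset_trans h.sub (down_subset la i), ?_, ?_, ?_, ?_, ?_, ?_⟩
  · intro p hp hμ
    by_cases hpp : p = (r, r + i)
    · exact ⟨k, by rw [hpp]; exact Finset.mem_insert_self _ _⟩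
    · obtain ⟨a, ha⟩ := h.cover p (by rw [hd]; exact Finset.mem_erase.2 ⟨hpp, hp⟩) hμ
      exact ⟨a, Finset.mem_insert_of_mem ha⟩
  · intro s hs
    rcases Finset.mem_insert.1 hs with rfl | hs
    · exact hmem
    · exact hbox s hs
  · intro s hs hμ
    rcases Finset.mem_insert.1 hs with rfl | hs
    · exact absurd hμ hpμ
    · exact h.rem s hs hμ
  · intro s hs
    rcases Finset.mem_insert.1 hs with rfl | hs
    · simp
    · exact Finset.mem_insert_of_mem (h.letter s hs)
  · intro s hs t ht h1 h2
    rcases Finset.mem_insert.1 hs with rfl | hs <;> rcases Finset.mem_insert.1 ht with rfl | ht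
    · omega
    · exact absurd (hbox t ht) (hc.not_mem hr (.inl ⟨h1.symm, h2⟩))
    · simp only at h1 h2 ⊢
      have h3 := h.letter s hs
      have h4 := hP _ h3
      have h6 := (mem_diagram _ _).1 (hbox s hs)
      simp only at h4
      rcases h4.lt_or_eq with h5 | h5
      · exact .inl h5
      · refine .inr ⟨h5, fun he => ?_⟩
        rw [h5] at h3 he
        have := heven he _ h3
        omega
    · exact h.row s hs t ht h1 h2
  · intro s hs t ht h1 h2
    rcases Finset.mem_insert.1 hs with rfl | hs <;> rcases Finset.mem_insert.1 ht with rfl | ht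
    · omega
    · exact absurd (hbox t ht) (hc.not_mem hr (.inr ⟨h1.symm, h2⟩))
    · simp only at h1 h2 ⊢
      have h3 := h.letter s hs
      have h4 := hP _ h3
      simp only at h4
      rcases h4.lt_or_eq with h5 | h5
      · exact .inl h5
      · refine .inr ⟨h5, ?_⟩
        by_contra he
        rw [h5] at h3 he
        have := hodd he _ h3
        omega
    · exact h.col s hs t ht h1 h2

/-- When the letter `k` is removed from the removable box on the diagonal `i`, the box remains if it
contains other letters or belongs to `μ`, and is removed otherwise. -/
theorem erase_letter (h : IsFilling (insert (k, i) P) la μ T) (hP : ∀ s ∈ P, s.1 ≤ k)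
    (hodd : ¬ Even k → ∀ j, (k, j) ∈ P → j < i) (heven : Even k → ∀ j, (k, j) ∈ P → i < j)
    {r : ℕ} (hc : la.HasCorner i) (hr : la.part r = i + 1) :
    IsFilling P la μ (T.erase ((r, r + i), k)) ∨
      IsFilling P (la.down i) μ (T.erase ((r, r + i), k)) := by
  have hd := diagram_down hc hr
  have hlet : ∀ s ∈ T.erase ((r, r + i), k), (s.2, s.1.2 - s.1.1) ∈ P := by
    rintro ⟨p, a⟩ hs
    have hs' := Finset.mem_of_mem_erase hs
    refine (Finset.mem_insert.1 (h.letter _ hs')).resolve_left fun e => ?_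
    rw [Prod.mk.injEq] at e
    simp only at e
    obtain ⟨rfl, e2⟩ := e
    obtain ⟨-, h2, h3⟩ := h.hasCorner hP hodd heven hs' e2
    have h4 := la.eq_of_part_eq (h2.trans hr.symm) (by omega)
    refine (Finset.mem_erase.1 hs).1 ?_
    obtain ⟨p1, p2⟩ := p
    simp only at h4 h3
    rw [h3, h4]
  have hrem : ∀ s ∈ T.erase ((r, r + i), k), s.1 ∈ μ.diagram → s.1 ∈ μ.removable :=
    fun s hs => h.rem s (Finset.mem_of_mem_erase hs)
  have hrow := fun s (hs : s ∈ T.erase ((r, r + i), k)) t (ht : t ∈ T.erase ((r, r + i), k)) =>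
    h.row s (Finset.mem_of_mem_erase hs) t (Finset.mem_of_mem_erase ht)
  have hcol := fun s (hs : s ∈ T.erase ((r, r + i), k)) t (ht : t ∈ T.erase ((r, r + i), k)) =>
    h.col s (Finset.mem_of_mem_erase hs) t (Finset.mem_of_mem_erase ht)
  by_cases hcase : (r, r + i) ∈ μ.diagram ∨ ∃ a, ((r, r + i), a) ∈ T.erase ((r, r + i), k)
  · left
    refine ⟨h.sub, ?_, fun s hs => h.box s (Finset.mem_of_mem_erase hs), hrem, hlet, hrow, hcol⟩
    intro p hp hμ
    by_cases hpp : p = (r, r + i)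
    · subst hpp
      exact hcase.resolve_left hμ
    · obtain ⟨a, ha⟩ := h.cover p hp hμ
      exact ⟨a, Finset.mem_erase.2 ⟨fun e => hpp (Prod.mk.inj e).1, ha⟩⟩
  · right
    push Not at hcase
    refine ⟨?_, ?_, ?_, hrem, hlet, hrow, hcol⟩
    · rw [subset_iff_diagram, hd]
      exact fun p hp => Finset.mem_erase.2
        ⟨fun e => hcase.1 (e ▸ hp), diagram_subset h.sub hp⟩
    · intro p hp hμ
      rw [hd, Finset.mem_erase] at hp
      obtain ⟨a, ha⟩ := h.cover p hp.2 hμ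
      exact ⟨a, Finset.mem_erase.2 ⟨fun e => hp.1 (Prod.mk.inj e).1, ha⟩⟩
    · rintro ⟨p, a⟩ hs
      rw [hd, Finset.mem_erase]
      refine ⟨?_, h.box _ (Finset.mem_of_mem_erase hs)⟩
      rintro rfl
      exact hcase.2 a hs

end IsFilling

theorem fillWeight_insert {T : Finset ((ℕ × ℕ) × ℕ)} {s : (ℕ × ℕ) × ℕ} (hs : s ∉ T) :
    fillWeight (insert s T) = Finsupp.single (s.2 / 2) 1 + fillWeight T :=
  Finset.sum_insert hs

/-- Allowing one more pair (letter `k`, diagonal `i`), which comes after the others, amounts to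
applying the operator `1 + x u_i`: the letter `k` in the removable box of that diagonal either shares
the box with other letters (or the box is one of `μ`), or is alone there. -/
theorem fillSum_insert {P : Finset (ℕ × ℕ)} {k i : ℕ} (μ : StrictPartition) (hki : (k, i) ∉ P)
    (hP : ∀ s ∈ P, s.1 ≤ k) (hodd : ¬ Even k → ∀ j, (k, j) ∈ P → j < i)
    (heven : Even k → ∀ j, (k, j) ∈ P → i < j) :
    fillSum (insert (k, i) P) μ =
      fac (peel (MvPowerSeries.C β : Series) i) (MvPowerSeries.X (k / 2) : Series) (fillSum P μ) := by
  classical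
  funext la
  rw [fac_peel_apply]
  by_cases hc : la.HasCorner i
  · obtain ⟨r, hr⟩ := hc.1
    set s : (ℕ × ℕ) × ℕ := ((r, r + i), k) with hs
    have hnot : ∀ {la' T}, IsFilling P la' μ T → s ∉ T := fun h hsT => by
      have := h.letter s hsT
      simp only [hs, Nat.add_sub_cancel_left] at this
      exact hki this
    have hA : (fillings (insert (k, i) P) la μ).filter (fun T => s ∉ T) = fillings P la μ := by
      ext T
      rw [Finset.mem_filter, mem_fillings, mem_fillings]
      refine ⟨fun ⟨h, hsT⟩ => ?_, fun h => ⟨h.mono (Finset.subset_insert _ _), hnot h⟩⟩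
      refine { h with letter := fun t ht => ?_ }
      refine (Finset.mem_insert.1 (h.letter _ ht)).resolve_left fun e => hsT ?_
      obtain ⟨p, a⟩ := t
      rw [Prod.mk.injEq] at e
      simp only at e
      obtain ⟨rfl, e2⟩ := e
      obtain ⟨-, h2, h3⟩ := h.hasCorner hP hodd heven ht e2
      have h4 := la.eq_of_part_eq (h2.trans hr.symm) (by omega)
      obtain ⟨p1, p2⟩ := p
      simp only at h4 h3
      rw [hs, ← h4, ← h3]
      exact ht
    have hB : (fillings (insert (k, i) P) la μ).filter (fun T => s ∈ T) =
        (fillings P la μ ∪ fillings P (la.down i) μ).image (insert s) := by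
      ext T
      rw [Finset.mem_filter, mem_fillings, Finset.mem_image]
      constructor
      · rintro ⟨h, hsT⟩
        refine ⟨T.erase s, ?_, Finset.insert_erase hsT⟩
        rw [Finset.mem_union, mem_fillings, mem_fillings]
        exact h.erase_letter hP hodd heven hc hr
      · rintro ⟨T', hT', rfl⟩
        rw [Finset.mem_union, mem_fillings, mem_fillings] at hT'
        refine ⟨?_, Finset.mem_insert_self _ _⟩
        rcases hT' with h | h
        · exact h.insert_letter hP hodd heven hc hr
        · exact h.of_down hc hr hP hodd heven
    have hdisj : Disjoint (fillings P la μ) (fillings P (la.down i) μ) := by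
      rw [Finset.disjoint_left]
      intro T h1 h2
      rw [mem_fillings] at h1 h2
      have hmem : (r, r + i) ∈ la.diagram := (mem_diagram _ _).2 ⟨by simp, by simp only; omega⟩
      have hd := diagram_down hc hr
      have hpμ : (r, r + i) ∉ μ.diagram := fun hp => by
        have := diagram_subset h2.sub hp
        rw [hd] at this
        simp at this
      obtain ⟨a, ha⟩ := h1.cover _ hmem hpμ
      have := h2.box _ ha
      rw [hd] at this
      simp at this
    have hinj : Set.InjOn (insert s) (↑(fillings P la μ ∪ fillings P (la.down i) μ) : Set (Finset ((ℕ × ℕ) × ℕ))) := by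
      intro T1 h1 T2 h2 h12
      simp only [Finset.coe_union, Set.mem_union, Finset.mem_coe, mem_fillings] at h1 h2
      have n1 : s ∉ T1 := h1.elim hnot hnot
      have n2 : s ∉ T2 := h2.elim hnot hnot
      rw [← Finset.erase_insert n1, ← Finset.erase_insert n2, h12]
    have hsz := size_down hc
    have ht : ∀ T, s ∉ T → la.size ≤ T.card + μ.size → fillTerm la μ (insert s T) =
        MvPowerSeries.X (k / 2) * (MvPowerSeries.C β * fillTerm la μ T) := by
      intro T hT hsize
      rw [fillTerm, fillTerm, fillWeight_insert hT, Finset.card_insert_of_notMem hT,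
        MvPowerSeries.X, ← MvPowerSeries.monomial_zero_eq_C_apply,
        MvPowerSeries.monomial_mul_monomial, MvPowerSeries.monomial_mul_monomial, zero_add, one_mul,
        ← pow_succ']
      congr 2
      omega
    have ht' : ∀ T, s ∉ T → (la.down i).size ≤ T.card + μ.size → fillTerm la μ (insert s T) =
        MvPowerSeries.X (k / 2) * fillTerm (la.down i) μ T := by
      intro T hT hsize
      rw [fillTerm, fillTerm, fillWeight_insert hT, Finset.card_insert_of_notMem hT,
        MvPowerSeries.X, MvPowerSeries.monomial_mul_monomial, one_mul]
      congr 2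
      omega
    rw [peel_apply_of_hasCorner _ _ hc, fillSum, ← Finset.sum_filter_not_add_sum_filter _
      (fun T => s ∈ T), hA, hB, Finset.sum_image hinj, Finset.sum_union hdisj, fillSum, fillSum,
      mul_add, Finset.mul_sum, Finset.mul_sum, Finset.mul_sum]
    congr 1
    congr 1
    · refine Finset.sum_congr rfl fun T hT => ?_
      rw [mem_fillings] at hT
      exact ht T (hnot hT) hT.size_le
    · refine Finset.sum_congr rfl fun T hT => ?_
      rw [mem_fillings] at hT
      exact ht' T (hnot hT) hT.size_le
  · rw [peel_apply_of_not_hasCorner _ _ hc, mul_zero, add_zero, fillSum, fillSum]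
    congr 1
    ext T
    rw [mem_fillings, mem_fillings]
    refine ⟨fun h => ?_, fun h => h.mono (Finset.subset_insert _ _)⟩
    refine { h with letter := fun t ht => ?_ }
    refine (Finset.mem_insert.1 (h.letter _ ht)).resolve_left fun e => hc ?_
    obtain ⟨p, a⟩ := t
    rw [Prod.mk.injEq] at e
    simp only at e
    obtain ⟨rfl, e2⟩ := e
    exact (h.hasCorner hP hodd heven ht e2).1

theorem fillSum_empty (μ : StrictPartition) : fillSum ∅ μ =
    fun la => open Classical in (Pi.single μ 1 : StrictPartition → Series) la := by
  classical
  funext la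
  have hempty : ∀ T, IsFilling ∅ la μ T ↔ T = ∅ ∧ la = μ := by
    intro T
    constructor
    · intro h
      have hT : T = ∅ := Finset.eq_empty_of_forall_notMem fun s hs =>
        Finset.notMem_empty _ (h.letter s hs)
      refine ⟨hT, diagram_injective (Finset.Subset.antisymm (fun p hp => ?_)
        (diagram_subset h.sub))⟩
      by_contra hμ
      obtain ⟨k, hk⟩ := h.cover p hp hμ
      rw [hT] at hk
      exact Finset.notMem_empty _ hk
    · rintro ⟨rfl, rfl⟩
      exact ⟨subset_refl _, fun p hp hμ => absurd hp hμ, by simp, by simp, by simp, by simp, by simp⟩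
  rw [fillSum]
  by_cases h : la = μ
  · subst h
    have h1 : fillings ∅ la la = {∅} := by
      ext T
      rw [mem_fillings, hempty]
      simp
    rw [h1, Finset.sum_singleton]
    simp [fillTerm, fillWeight]
  · have h1 : fillings ∅ la μ = ∅ := by
      ext T
      rw [mem_fillings, hempty]
      simp [h]
    rw [h1]
    simp [h]

/-- The pairs (letter, diagonal) with letters `2 m` and `2 m + 1` and diagonals at most `N`; the pair
`(2 m, 0)`, a primed letter on the main diagonal, is included only if `q`. -/
def letterPairs (q : Bool) (m N : ℕ) : Finset (ℕ × ℕ) :=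
  (({2 * m, 2 * m + 1} : Finset ℕ) ×ˢ Finset.range (N + 1)).filter
    fun s => q = true ∨ s.1 ≠ 2 * m ∨ s.2 ≠ 0

/-- The transfer operator inserts the letters `2 m` (in decreasing order of the diagonals) and
`2 m + 1` (in increasing order). -/
theorem fillSum_union_letterPairs (q : Bool) (m N : ℕ) (μ : StrictPartition)
    {P : Finset (ℕ × ℕ)} (hP : ∀ s ∈ P, s.1 < 2 * m ∨ (s.1 = 2 * m ∧ N < s.2)) :
    fillSum (P ∪ letterPairs q m N) μ =
      transfer q (peel (MvPowerSeries.C β : Series)) (MvPowerSeries.X m : Series) N (fillSum P μ) := by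
  have he : Even (2 * m) := even_two_mul m
  have ho : ¬ Even (2 * m + 1) := by simp
  have d0 : 2 * m / 2 = m := by omega
  have d1 : (2 * m + 1) / 2 = m := by omega
  induction N generalizing P with
  | zero =>
    have hlast : ∀ {P' : Finset (ℕ × ℕ)}, (∀ s ∈ P', s.1 < 2 * m + 1) →
        fillSum (insert (2 * m + 1, 0) P') μ =
          fac (peel (MvPowerSeries.C β : Series) 0) (MvPowerSeries.X m : Series) (fillSum P' μ) := by
      intro P' hP'
      have := fillSum_insert (P := P') (k := 2 * m + 1) (i := 0) μ
        (fun h => by have := hP' _ h; simp at this) (fun s hs => (hP' s hs).le)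
        (fun _ j hj => by have := hP' _ hj; simp at this) (fun h => absurd h ho)
      rwa [d1] at this
    cases q with
    | false =>
      have h1 : P ∪ letterPairs false m 0 = insert (2 * m + 1, 0) P := by
        ext ⟨a, j⟩
        simp only [letterPairs, Finset.mem_union, Finset.mem_filter, Finset.mem_product,
          Finset.mem_insert, Finset.mem_singleton, Finset.mem_range, Prod.mk.injEq]
        constructor
        · rintro (h | h)
          · exact .inr h
          · left; simp at h; omega
        · rintro (h | h)
          · right; simp; omega
          · exact .inl h
      rw [h1, hlast fun s hs => by have := hP s hs; omega]
      rfl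
    | true =>
      have h1 : P ∪ letterPairs true m 0 = insert (2 * m + 1, 0) (insert (2 * m, 0) P) := by
        ext ⟨a, j⟩
        simp only [letterPairs, Finset.mem_union, Finset.mem_filter, Finset.mem_product,
          Finset.mem_insert, Finset.mem_singleton, Finset.mem_range, Prod.mk.injEq, true_or,
          and_true]
        constructor
        · rintro (h | h)
          · exact .inr (.inr h)
          · rw [← or_assoc]; left; omega
        · rintro (h | h | h)
          · right; omega
          · right; omega
          · exact .inl h
      have h2 := fillSum_insert (P := P) (k := 2 * m) (i := 0) μ
        (fun h => by have := hP _ h; simp at this) (fun s hs => by have := hP s hs; omega)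
        (fun h => absurd he h) (fun _ j hj => by have := hP _ hj; simp at this; omega)
      rw [d0] at h2
      rw [h1, hlast, h2]
      · rfl
      · intro s hs
        rcases Finset.mem_insert.1 hs with rfl | hs
        · simp
        · have := hP s hs; omega
  | succ N ih =>
    have h1 : P ∪ letterPairs q m (N + 1) =
        insert (2 * m + 1, N + 1) (insert (2 * m, N + 1) P ∪ letterPairs q m N) := by
      ext ⟨a, j⟩
      simp only [letterPairs, Finset.mem_union, Finset.mem_filter, Finset.mem_product,
        Finset.mem_insert, Finset.mem_singleton, Finset.mem_range, Prod.mk.injEq]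
      by_cases hq : q = true <;> by_cases hPm : (a, j) ∈ P <;>
        simp only [hq, hPm, true_or, or_true, and_true, false_or, or_false, Bool.false_eq_true] <;>
        omega
    have h2 := fillSum_insert (P := P) (k := 2 * m) (i := N + 1) μ
      (fun h => by have := hP _ h; simp at this) (fun s hs => by have := hP s hs; omega)
      (fun h => absurd he h) (fun _ j hj => by have := hP _ hj; simp at this; omega)
    rw [d0] at h2
    have h3 := ih (P := insert (2 * m, N + 1) P) (by
      intro s hs
      rcases Finset.mem_insert.1 hs with rfl | hs
      · simp
      · have := hP s hs; omega)
    have hmem : ∀ s ∈ insert (2 * m, N + 1) P ∪ letterPairs q m N,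
        s.1 ≤ 2 * m + 1 ∧ (s.1 = 2 * m + 1 → s.2 < N + 1) := by
      intro s hs
      simp only [letterPairs, Finset.mem_union, Finset.mem_filter, Finset.mem_product,
        Finset.mem_insert, Finset.mem_singleton, Finset.mem_range] at hs
      rcases hs with (rfl | hs) | ⟨⟨h4, h5⟩, -⟩
      · simp
      · have := hP s hs; omega
      · omega
    have h4 := fillSum_insert (P := insert (2 * m, N + 1) P ∪ letterPairs q m N) (k := 2 * m + 1)
      (i := N + 1) μ (fun h => by have := (hmem _ h).2 rfl; simp at this)
      (fun s hs => (hmem s hs).1) (fun _ j hj => (hmem _ hj).2 rfl) (fun h => absurd h ho)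
    rw [d1] at h4
    rw [h1, h4, h3, h2]
    rfl

/-- The pairs (letter, diagonal) with letters less than `2 n` and diagonals at most `N`; primed
letters on the main diagonal are included only if `q`. -/
def letterPairsBelow (q : Bool) (n N : ℕ) : Finset (ℕ × ℕ) :=
  (Finset.range (2 * n) ×ˢ Finset.range (N + 1)).filter
    fun s => q = true ∨ ¬ Even s.1 ∨ s.2 ≠ 0

/-- The generating function of fillings is a matrix coefficient of a product of transfer operators. -/
theorem fillSum_letterPairsBelow (q : Bool) (n N : ℕ) (la μ : StrictPartition) :
    fillSum (letterPairsBelow q n N) μ la =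
      matCoeff (MvPowerSeries.C β) q N MvPowerSeries.X n la μ := by
  rw [matCoeff]
  have key : fillSum (letterPairsBelow q n N) μ = evol (MvPowerSeries.C β) q N MvPowerSeries.X n
      (fillSum ∅ μ) := by
    induction n with
    | zero => simp [letterPairsBelow, evol]
    | succ n ih =>
      rw [evol, Module.End.mul_apply, ← ih, ← fillSum_union_letterPairs]
      · congr 1
        ext ⟨a, j⟩
        simp only [letterPairs, letterPairsBelow, Finset.mem_union, Finset.mem_filter,
          Finset.mem_product, Finset.mem_insert, Finset.mem_singleton, Finset.mem_range,
          Nat.even_iff]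
        by_cases hq : q = true <;> simp only [hq, true_or, and_true, false_or,
          Bool.false_eq_true] <;> omega
      · intro s hs
        simp only [letterPairsBelow, Finset.mem_filter, Finset.mem_product, Finset.mem_range] at hs
        omega
  rw [key, fillSum_empty]

/-! ### Tableaux as fillings -/

/-- Any set of removable boxes may be removed simultaneously. -/
theorem StrictPartition.exists_diagram_eq_sdiff {μ : StrictPartition} (O : Finset (ℕ × ℕ))
    (hO : ∀ p ∈ O, p ∈ μ.removable) :
    ∃ ν : StrictPartition, ν ⊆ μ ∧ ν.diagram = μ.diagram \ O := by
  induction O using Finset.induction_on generalizing μ with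
  | empty => exact ⟨μ, subset_refl μ, by simp⟩
  | insert p O hp ih =>
    have h1 := hO p (Finset.mem_insert_self _ _)
    rw [mem_removable_iff] at h1
    obtain ⟨r, c⟩ := p
    simp only at h1
    obtain ⟨h1, h2, h3⟩ := h1
    obtain ⟨ν, hν, hd⟩ := ih (μ := μ.down (c - r)) (by
      rintro ⟨s, d⟩ hs
      have h4 := hO _ (Finset.mem_insert_of_mem hs)
      rw [mem_removable_iff] at h4 ⊢
      simp only at h4 ⊢
      obtain ⟨h4, h5, h6⟩ := h4
      have hne : d - s ≠ c - r := by
        intro e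
        have e2 := μ.eq_of_part_eq (r := s) (s := r) (by omega) (by omega)
        subst e2
        have e3 : d = c := by omega
        exact hp (e3 ▸ hs)
      have n1 : c - r + 1 ≠ d - s := fun e => not_hasCorner_succ h3 (e ▸ h6)
      have n2 : d - s + 1 ≠ c - r := fun e => not_hasCorner_succ h6 (e ▸ h3)
      exact ⟨h4, by rw [down_part_of_ne (by omega)]; exact h5,
        (hasCorner_down_iff h3 (by omega)).2 h6⟩)
    refine ⟨ν, subset_trans hν (down_subset _ _), ?_⟩
    rw [hd, diagram_down h3 h2, show r + (c - r) = c by omega]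
    ext t
    simp only [Finset.mem_sdiff, Finset.mem_erase, Finset.mem_insert]
    tauto

namespace SetShYTQ

variable {D : Finset (ℕ × ℕ)}

theorem mem_of_mem_entry (T : SetShYTQ D) {p : ℕ × ℕ} {k : ℕ} (h : k ∈ T.entry p) : p ∈ D :=
  (T.nonempty_iff p).1 ⟨k, h⟩

/-- The set of pairs (box, letter) of a tableau. -/
def pairs (T : SetShYTQ D) : Finset ((ℕ × ℕ) × ℕ) :=
  D.biUnion fun p => (T.entry p).map ⟨Prod.mk p, Prod.mk_right_injective p⟩

theorem mem_pairs (T : SetShYTQ D) (s : (ℕ × ℕ) × ℕ) : s ∈ T.pairs ↔ s.2 ∈ T.entry s.1 := by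
  obtain ⟨p, k⟩ := s
  simp only [pairs, Finset.mem_biUnion, Finset.mem_map, Function.Embedding.coeFn_mk,
    Prod.mk.injEq]
  constructor
  · rintro ⟨p, -, k, hk, rfl, rfl⟩
    exact hk
  · intro h
    exact ⟨p, T.mem_of_mem_entry h, k, h, rfl, rfl⟩

theorem sum_pairs {M : Type*} [AddCommMonoid M] (T : SetShYTQ D) (f : (ℕ × ℕ) × ℕ → M) :
    ∑ s ∈ T.pairs, f s = ∑ p ∈ D, ∑ k ∈ T.entry p, f (p, k) := by
  rw [pairs, Finset.sum_biUnion]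
  · exact Finset.sum_congr rfl fun p _ => by rw [Finset.sum_map]; rfl
  · intro p _ p' _ hpp
    rw [Function.onFun, Finset.disjoint_left]
    rintro s h1 h2
    simp only [Finset.mem_map, Function.Embedding.coeFn_mk] at h1 h2
    obtain ⟨k, -, rfl⟩ := h1
    obtain ⟨k', -, h⟩ := h2
    exact hpp (Prod.mk.inj h).1.symm

theorem fillWeight_pairs (T : SetShYTQ D) : fillWeight T.pairs = T.weight := T.sum_pairs _

theorem card_pairs (T : SetShYTQ D) : T.pairs.card = T.total := by
  rw [Finset.card_eq_sum_ones, T.sum_pairs, total]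
  simp

theorem card_le_total (T : SetShYTQ D) : D.card ≤ T.total := by
  rw [Finset.card_eq_sum_ones, total]
  exact Finset.sum_le_sum fun p hp => Finset.card_pos.2 ((T.nonempty_iff p).2 hp)

/-- The condition on tableaux for `GQ` (if `q`) or `GP`. -/
def DiagonalOK (q : Bool) (T : SetShYTQ D) : Prop := q = true ∨ T.DiagonalUnprimed

open Classical in
/-- The finite set of tableaux with a given exponent vector. -/
def ofWeight (q : Bool) (D : Finset (ℕ × ℕ)) (d : ℕ →₀ ℕ) : Finset (SetShYTQ D) :=
  (finite_weight_eq d).toFinset.filter (DiagonalOK q)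

@[simp]
theorem mem_ofWeight {q : Bool} {d : ℕ →₀ ℕ} {T : SetShYTQ D} :
    T ∈ ofWeight q D d ↔ T.weight = d ∧ T.DiagonalOK q := by
  simp [ofWeight]

end SetShYTQ

open SetShYTQ

/-- `GQ_{λ/μ}` if `q`, else `GP_{λ/μ}`. -/
def Gskew (q : Bool) (la μ : StrictPartition) : Series :=
  if q then GQskew la μ else GPskew la μ

/-- `GQ_{λ//μ}` if `q`, else `GP_{λ//μ}`. -/
def Gsskew (q : Bool) (la μ : StrictPartition) : Series :=
  if q then GQsskew la μ else GPsskew la μ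

/-- `GQ_λ` if `q`, else `GP_λ`. -/
def Gfun (q : Bool) (la : StrictPartition) : Series := if q then GQ la else GP la

theorem coeff_tsum_series {ι : Type*} {f : ι → Series} (hf : Summable f) (d : ℕ →₀ ℕ) :
    MvPowerSeries.coeff d (∑' i, f i) = ∑' i, MvPowerSeries.coeff d (f i) :=
  ((MvPowerSeries.WithPiTopology.hasSum_iff_hasSum_coeff.1 hf.hasSum d).tsum_eq).symm

theorem coeff_Gskew {q : Bool} {la μ : StrictPartition} (h : μ ⊆ la) (d : ℕ →₀ ℕ) :
    MvPowerSeries.coeff d (Gskew q la μ) =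
      ∑ T ∈ ofWeight q (la.skewDiagram μ) d, β ^ (T.total - (la.skewDiagram μ).card) := by
  classical
  have hterm : ∀ T : SetShYTQ (la.skewDiagram μ), MvPowerSeries.coeff d T.term =
      if T.weight = d then β ^ (T.total - (la.skewDiagram μ).card) else 0 := by
    intro T
    rw [SetShYTQ.term, MvPowerSeries.coeff_monomial]
    simp only [eq_comm]
  have hsum := fun P => SetShYTQ.summable_term (D := la.skewDiagram μ) P
  have key : ∀ P : SetShYTQ (la.skewDiagram μ) → Prop,
      (∀ T, P T ↔ T.DiagonalOK q) →
      MvPowerSeries.coeff d (∑' T : {T : SetShYTQ (la.skewDiagram μ) // P T}, T.1.term) =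
      ∑ T ∈ ofWeight q (la.skewDiagram μ) d, β ^ (T.total - (la.skewDiagram μ).card) := by
    intro P hP
    rw [coeff_tsum_series (hsum P)]
    have h1 := tsum_subtype {T | P T} (fun T : SetShYTQ (la.skewDiagram μ) =>
      MvPowerSeries.coeff d T.term)
    refine h1.trans ?_
    rw [tsum_eq_sum (s := ofWeight q (la.skewDiagram μ) d)]
    · refine Finset.sum_congr rfl fun T hT => ?_
      rw [mem_ofWeight] at hT
      rw [Set.indicator_of_mem (show T ∈ {T | P T} from (hP T).2 hT.2), hterm, if_pos hT.1]
    · intro T hT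
      rw [mem_ofWeight] at hT
      by_cases hPT : P T
      · rw [Set.indicator_of_mem (show T ∈ {T | P T} from hPT), hterm,
          if_neg fun e => hT ⟨e, (hP T).1 hPT⟩]
      · exact Set.indicator_of_notMem hPT _
  cases q with
  | false =>
    rw [Gskew, if_neg (by simp), GPskew, if_pos h]
    exact key _ fun T => by simp [DiagonalOK]
  | true =>
    rw [Gskew, if_pos rfl, GQskew, if_pos h]
    rw [← key (fun _ => True) fun T => by simp [DiagonalOK]]
    congr 1
    exact ((Equiv.Set.univ _).tsum_eq (fun T : SetShYTQ (la.skewDiagram μ) => T.term)).symm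

/-- A tableau of shape `λ/ν`, where `ν` is `μ` without some removable boxes, is a filling for
`(λ, μ)`. -/
theorem pairs_isFilling {q : Bool} {la μ ν : StrictPartition} {n N : ℕ} (hN : la.part 0 ≤ N + 1)
    (hμ : μ ⊆ la) (hν : ν ∈ removals μ) {T : SetShYTQ (la.skewDiagram ν)} (hT : T.DiagonalOK q)
    (hn : ∀ i ∈ T.weight.support, i < n) :
    IsFilling (letterPairsBelow q n N) la μ T.pairs := by
  have hbox : ∀ s ∈ T.pairs, s.1 ∈ la.diagram ∧ s.1 ∉ ν.diagram := fun s hs => by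
    have := T.mem_of_mem_entry ((T.mem_pairs s).1 hs)
    simpa [skewDiagram] using this
  refine ⟨hμ, ?_, fun s hs => (hbox s hs).1, ?_, ?_, ?_, ?_⟩
  · intro p hp hpμ
    have h1 : p ∈ la.skewDiagram ν := by
      simp only [skewDiagram, Finset.mem_sdiff]
      exact ⟨hp, fun h => hpμ (diagram_subset hν.1 h)⟩
    obtain ⟨k, hk⟩ := (T.nonempty_iff p).2 h1
    exact ⟨k, (T.mem_pairs _).2 hk⟩
  · intro s hs hsμ
    refine hν.2 ?_
    simp only [skewDiagram, Finset.coe_sdiff, Set.mem_sdiff, Finset.mem_coe]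
    exact ⟨hsμ, (hbox s hs).2⟩
  · rintro ⟨⟨r, c⟩, k⟩ hs
    have h1 := (hbox _ hs).1
    rw [mem_diagram] at h1
    simp only at h1
    have h2 := la.part_anti (Nat.zero_le r)
    have h3 : k / 2 < n := by
      apply hn
      rw [← fillWeight_pairs, Finsupp.mem_support_iff, fillWeight, Finsupp.finsetSum_apply]
      have := Finset.single_le_sum (f := fun s : (ℕ × ℕ) × ℕ =>
        (Finsupp.single (s.2 / 2) 1 : ℕ →₀ ℕ) (k / 2)) (fun _ _ => Nat.zero_le _) hs
      simp only [Finsupp.single_eq_same] at this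
      omega
    simp only [letterPairsBelow, Finset.mem_filter, Finset.mem_product, Finset.mem_range]
    refine ⟨⟨by omega, by omega⟩, ?_⟩
    rcases hT with hT | hT
    · exact .inl hT
    · right
      by_cases hrc : r = c
      · left
        subst hrc
        exact hT r k ((T.mem_pairs _).1 hs)
      · right; omega
  · rintro ⟨⟨r, c⟩, k⟩ hs ⟨⟨r', c'⟩, k'⟩ hs' h1 h2
    simp only at h1 h2 ⊢
    subst h1
    rw [mem_pairs] at hs hs'
    rcases (T.row_le r c c' h2 k hs k' hs').lt_or_eq with h3 | h3
    · exact .inl h3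
    · simp only at hs hs'
      rw [← h3] at hs'
      exact .inr ⟨h3, T.row_primed r c c' h2.ne k hs hs'⟩
  · rintro ⟨⟨r, c⟩, k⟩ hs ⟨⟨r', c'⟩, k'⟩ hs' h1 h2
    simp only at h1 h2 ⊢
    subst h1
    rw [mem_pairs] at hs hs'
    rcases (T.col_le r r' c h2 k hs k' hs').lt_or_eq with h3 | h3
    · exact .inl h3
    · simp only at hs hs'
      rw [← h3] at hs'
      exact .inr ⟨h3, T.col_unprimed r r' c h2.ne k hs hs'⟩

/-- Every filling for `(λ, μ)` is such a tableau: `ν` consists of the boxes of `μ` left empty. -/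
theorem IsFilling.exists_pairs_eq {q : Bool} {la μ : StrictPartition} {n N : ℕ}
    {F : Finset ((ℕ × ℕ) × ℕ)} (h : IsFilling (letterPairsBelow q n N) la μ F) :
    ∃ ν ∈ removals μ, ∃ T : SetShYTQ (la.skewDiagram ν), T.DiagonalOK q ∧ T.pairs = F := by
  classical
  obtain ⟨ν, hν, hd⟩ := exists_diagram_eq_sdiff (μ := μ) (μ.diagram ∩ F.image Prod.fst) (by
    intro p hp
    simp only [Finset.mem_inter, Finset.mem_image] at hp
    obtain ⟨h1, s, hs, rfl⟩ := hp
    exact h.rem s hs h1)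
  have hνF : ∀ p ∈ μ.diagram, p ∉ ν.diagram ↔ ∃ k, (p, k) ∈ F := by
    intro p hp
    rw [hd]
    simp [hp]
  have hrem : ν ∈ removals μ := by
    refine ⟨hν, fun p hp => ?_⟩
    simp only [skewDiagram, Finset.coe_sdiff, Set.mem_sdiff, Finset.mem_coe] at hp
    obtain ⟨k, hk⟩ := (hνF p hp.1).1 hp.2
    exact h.rem _ hk hp.1
  have hmem : ∀ p k, k ∈ (F.filter fun s => s.1 = p).image Prod.snd ↔ (p, k) ∈ F := by
    intro p k
    simp only [Finset.mem_image, Finset.mem_filter]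
    constructor
    · rintro ⟨⟨p, k⟩, ⟨h1, rfl⟩, rfl⟩
      exact h1
    · intro h1
      exact ⟨_, ⟨h1, rfl⟩, rfl⟩
  let T : SetShYTQ (la.skewDiagram ν) :=
    { entry := fun p => (F.filter fun s => s.1 = p).image Prod.snd
      nonempty_iff := by
        intro p
        rw [skewDiagram, Finset.mem_sdiff]
        constructor
        · rintro ⟨k, hk⟩
          rw [hmem] at hk
          exact ⟨h.box _ hk, fun h1 => (hνF p (diagram_subset hν h1)).2 ⟨k, hk⟩ h1⟩
        · rintro ⟨h1, h2⟩
          obtain ⟨k, hk⟩ : ∃ k, (p, k) ∈ F := by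
            by_cases hμ : p ∈ μ.diagram
            · exact (hνF p hμ).1 h2
            · exact h.cover p h1 hμ
          exact ⟨k, (hmem _ _).2 hk⟩
      row_le := by
        intro i j j' hj a ha b hb
        rw [hmem] at ha hb
        have := h.row _ ha _ hb rfl hj
        simp only at this
        omega
      col_le := by
        intro i i' j hi a ha b hb
        rw [hmem] at ha hb
        have := h.col _ ha _ hb rfl hi
        simp only at this
        omega
      col_unprimed := by
        intro i i' j hi a ha hb
        rw [hmem] at ha hb
        rcases Nat.lt_or_gt_of_ne hi with hi | hi
        · exact ((h.col _ ha _ hb rfl hi).resolve_left (lt_irrefl a)).2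
        · exact ((h.col _ hb _ ha rfl hi).resolve_left (lt_irrefl a)).2
      row_primed := by
        intro i j j' hj a ha hb
        rw [hmem] at ha hb
        rcases Nat.lt_or_gt_of_ne hj with hj | hj
        · exact ((h.row _ ha _ hb rfl hj).resolve_left (lt_irrefl a)).2
        · exact ((h.row _ hb _ ha rfl hj).resolve_left (lt_irrefl a)).2 }
  refine ⟨ν, hrem, T, ?_, ?_⟩
  · by_cases hq : q = true
    · exact .inl hq
    · right
      intro i a ha
      have h1 := h.letter _ ((hmem _ _).1 ha)
      simp only [letterPairsBelow, Finset.mem_filter] at h1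
      simpa [hq] using h1.2
  · ext ⟨p, k⟩
    rw [mem_pairs]
    exact hmem p k

/-- `GQ_{λ//μ}` or `GP_{λ//μ}`, in finitely many variables, is a matrix coefficient of a product of
transfer operators. -/
theorem coeff_Gsskew {q : Bool} {la μ : StrictPartition} {n N : ℕ} {d : ℕ →₀ ℕ}
    (hN : la.part 0 ≤ N + 1) (hn : ∀ i ∈ d.support, i < n) :
    MvPowerSeries.coeff d (Gsskew q la μ) =
      MvPowerSeries.coeff d (matCoeff (MvPowerSeries.C β : Series) q N MvPowerSeries.X n la μ) := by
  classical
  rw [← fillSum_letterPairsBelow]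
  by_cases hμ : μ ⊆ la
  · have hfin : (removals μ).Finite := (finite_subset μ).subset fun ν hν => hν.1
    have h1 : Gsskew q la μ = ∑ ν ∈ hfin.toFinset,
        MvPowerSeries.C (β ^ (μ.skewDiagram ν).card) * Gskew q la ν := by
      rw [← finsum_mem_eq_finite_toFinset_sum]
      cases q
      · simp [Gsskew, GPsskew, hμ, Gskew]
      · simp [Gsskew, GQsskew, hμ, Gskew]
    have h2 : MvPowerSeries.coeff d (Gsskew q la μ) = ∑ ν ∈ hfin.toFinset,
        ∑ T ∈ ofWeight q (la.skewDiagram ν) d,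
          β ^ (μ.skewDiagram ν).card * β ^ (T.total - (la.skewDiagram ν).card) := by
      rw [h1, map_sum]
      refine Finset.sum_congr rfl fun ν hν => ?_
      have hν' : ν ∈ removals μ := by simpa using hν
      rw [MvPowerSeries.coeff_C_mul, coeff_Gskew (subset_trans hν'.1 hμ), Finset.mul_sum]
    rw [h2, coeff_fillSum, Finset.sum_sigma']
    refine Finset.sum_nbij (fun x => x.2.pairs) ?_ ?_ ?_ ?_
    · rintro ⟨ν, T⟩ hx
      simp only [Finset.mem_sigma, Set.Finite.mem_toFinset, mem_ofWeight] at hx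
      rw [Finset.mem_filter, mem_fillings, fillWeight_pairs]
      exact ⟨pairs_isFilling hN hμ hx.1 hx.2.2 (by rw [hx.2.1]; exact hn), hx.2.1⟩
    · rintro ⟨ν, T⟩ hx ⟨ν', T'⟩ hx' he
      simp only [Finset.coe_sigma, Set.mem_sigma_iff, Finset.mem_coe, Set.Finite.mem_toFinset]
        at hx hx' he
      have hD : la.skewDiagram ν = la.skewDiagram ν' := by
        ext p
        rw [← T.nonempty_iff, ← T'.nonempty_iff]
        have : ∀ k, k ∈ T.entry p ↔ k ∈ T'.entry p := fun k => by
          rw [← T.mem_pairs (p, k), ← T'.mem_pairs (p, k), he]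
        exact ⟨fun ⟨k, hk⟩ => ⟨k, (this k).1 hk⟩, fun ⟨k, hk⟩ => ⟨k, (this k).2 hk⟩⟩
      have hνν : ν = ν' := by
        apply diagram_injective
        have e1 := diagram_subset (subset_trans hx.1.1 hμ)
        have e2 := diagram_subset (subset_trans hx'.1.1 hμ)
        rw [← Finset.sdiff_sdiff_eq_self e1, ← Finset.sdiff_sdiff_eq_self e2]
        exact congrArg (la.diagram \ ·) hD
      subst hνν
      congr 1
      ext p k
      rw [← T.mem_pairs (p, k), ← T'.mem_pairs (p, k), he]
    · intro F hF
      simp only [Finset.coe_filter, mem_fillings, Set.mem_ofPred_eq] at hF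
      obtain ⟨ν, hν, T, hT, rfl⟩ := hF.1.exists_pairs_eq
      refine ⟨⟨ν, T⟩, ?_, rfl⟩
      simp only [Finset.coe_sigma, Set.mem_sigma_iff, Finset.mem_coe, Set.Finite.mem_toFinset,
        mem_ofWeight]
      exact ⟨hν, by rw [← fillWeight_pairs]; exact hF.2, hT⟩
    · rintro ⟨ν, T⟩ hx
      simp only [Finset.mem_sigma, Set.Finite.mem_toFinset] at hx
      simp only
      rw [← pow_add, card_pairs]
      congr 1
      have e1 := diagram_subset hx.1.1
      have e2 := diagram_subset (subset_trans hx.1.1 hμ)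
      have e3 := T.card_le_total
      have e4 := Finset.card_sdiff_add_card_eq_card e1
      have e5 := Finset.card_sdiff_add_card_eq_card e2
      simp only [skewDiagram, size] at *
      omega
  · have h1 : fillings (letterPairsBelow q n N) la μ = ∅ :=
      Finset.eq_empty_of_forall_notMem fun F hF => hμ (mem_fillings.1 hF).sub
    rw [fillSum, h1, Finset.sum_empty]
    cases q
    · simp [Gsskew, GPsskew, hμ]
    · simp [Gsskew, GQsskew, hμ]

theorem Gsskew_empty (q : Bool) (la : StrictPartition) : Gsskew q la emptyPartition = Gfun q la := by
  have h : removals emptyPartition = {emptyPartition} := by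
    ext ν
    simp only [removals, Set.mem_ofPred_eq, Set.mem_singleton_iff]
    constructor
    · exact fun h => eq_empty_of_subset h.1
    · rintro rfl
      exact ⟨subset_refl _, by simp [skewDiagram]⟩
  cases q
  · simp [Gsskew, GPsskew, empty_subset, h, Gfun, GP, skewDiagram]
  · simp [Gsskew, GQsskew, empty_subset, h, Gfun, GQ, skewDiagram]

/-! ### Setting variables to zero -/

section Restrict

variable {σ R : Type*} [CommRing R]

/-- The endomorphism of a power series ring which sets the variables outside `U` to zero. (There may
be infinitely many of them, so it is a composite of Mathlib's `killCompl` and `rename`.) -/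
def restrictTo (U : Set σ) : MvPowerSeries σ R →+* MvPowerSeries σ R :=
  (MvPowerSeries.rename (R := R) (Function.Embedding.subtype (· ∈ U))).toRingHom.comp
    (MvPowerSeries.killCompl (R := R) (Function.Embedding.subtype (· ∈ U))).toRingHom

theorem coeff_restrictTo_of_subset {U : Set σ} {d : σ →₀ ℕ} (h : ↑d.support ⊆ U)
    (f : MvPowerSeries σ R) :
    MvPowerSeries.coeff d (restrictTo U f) = MvPowerSeries.coeff d f := by
  have h1 : Finsupp.embDomain (Function.Embedding.subtype (· ∈ U))
      (d.comapDomain (Function.Embedding.subtype (· ∈ U))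
        (Function.Embedding.subtype (· ∈ U)).injective.injOn) = d :=
    Finsupp.embDomain_comapDomain (by simpa using h)
  rw [← h1]
  exact (MvPowerSeries.coeff_embDomain_rename _ _ _).trans (MvPowerSeries.coeff_killCompl _ _)

theorem coeff_restrictTo_of_not_subset {U : Set σ} {d : σ →₀ ℕ} (h : ¬ ↑d.support ⊆ U)
    (f : MvPowerSeries σ R) : MvPowerSeries.coeff d (restrictTo U f) = 0 := by
  refine MvPowerSeries.coeff_rename_eq_zero _ _ ?_
  rintro ⟨d', rfl⟩
  refine h fun s hs => ?_
  classical
  have := Finsupp.mapDomain_support hs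
  simp only [Finset.mem_image] at this
  obtain ⟨t, -, rfl⟩ := this
  exact t.2

theorem restrictTo_restrictTo (U V : Set σ) (f : MvPowerSeries σ R) :
    restrictTo U (restrictTo V f) = restrictTo (U ∩ V) f := by
  ext d
  by_cases hU : ↑d.support ⊆ U
  · rw [coeff_restrictTo_of_subset hU]
    by_cases hV : ↑d.support ⊆ V
    · rw [coeff_restrictTo_of_subset hV, coeff_restrictTo_of_subset (Set.subset_inter hU hV)]
    · rw [coeff_restrictTo_of_not_subset hV,
        coeff_restrictTo_of_not_subset fun h => hV (h.trans Set.inter_subset_right)]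
  · rw [coeff_restrictTo_of_not_subset hU,
      coeff_restrictTo_of_not_subset fun h => hU (h.trans Set.inter_subset_left)]

@[simp]
theorem restrictTo_C (U : Set σ) (c : R) :
    restrictTo U (MvPowerSeries.C c : MvPowerSeries σ R) = MvPowerSeries.C c := by
  ext d
  by_cases hU : ↑d.support ⊆ U
  · rw [coeff_restrictTo_of_subset hU]
  · rw [coeff_restrictTo_of_not_subset hU, MvPowerSeries.coeff_C_of_ne_zero]
    rintro rfl
    simp at hU

theorem restrictTo_X_of_mem {U : Set σ} {s : σ} (h : s ∈ U) :
    restrictTo U (MvPowerSeries.X s : MvPowerSeries σ R) = MvPowerSeries.X s := by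
  classical
  ext d
  by_cases hU : ↑d.support ⊆ U
  · rw [coeff_restrictTo_of_subset hU]
  · rw [coeff_restrictTo_of_not_subset hU, MvPowerSeries.coeff_X, if_neg]
    rintro rfl
    refine hU fun t ht => ?_
    have := Finsupp.support_single_subset ht
    simp only [Finset.mem_singleton] at this
    exact this ▸ h

theorem restrictTo_X_of_notMem {U : Set σ} {s : σ} (h : s ∉ U) :
    restrictTo U (MvPowerSeries.X s : MvPowerSeries σ R) = 0 := by
  classical
  ext d
  rw [MvPowerSeries.coeff_zero]
  by_cases hU : ↑d.support ⊆ U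
  · rw [coeff_restrictTo_of_subset hU, MvPowerSeries.coeff_X, if_neg]
    rintro rfl
    exact h (hU (by simp))
  · rw [coeff_restrictTo_of_not_subset hU]

theorem restrictTo_eq_of_subset {U V : Set σ} (hUV : U ⊆ V) {f : MvPowerSeries σ R}
    (h : restrictTo U f = f) : restrictTo V f = f := by
  rw [← h, restrictTo_restrictTo, Set.inter_eq_right.2 hUV]

theorem coeff_eq_zero_of_restrictTo_eq {U : Set σ} {f : MvPowerSeries σ R}
    (h : restrictTo U f = f) {d : σ →₀ ℕ} (hd : ¬ ↑d.support ⊆ U) :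
    MvPowerSeries.coeff d f = 0 := by
  rw [← h, coeff_restrictTo_of_not_subset hd]

theorem coeff_X_mul_of_eq_zero {s : σ} {d : σ →₀ ℕ} (h : d s = 0) (f : MvPowerSeries σ R) :
    MvPowerSeries.coeff d (MvPowerSeries.X s * f) = 0 := by
  rw [MvPowerSeries.X, MvPowerSeries.coeff_monomial_mul, if_neg]
  intro hle
  have := hle s
  simp [h] at this

theorem coeff_single_add_X_mul (s : σ) (d : σ →₀ ℕ) (f : MvPowerSeries σ R) :
    MvPowerSeries.coeff (Finsupp.single s 1 + d) (MvPowerSeries.X s * f) =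
      MvPowerSeries.coeff d f := by
  rw [MvPowerSeries.X, MvPowerSeries.coeff_add_monomial_mul, one_mul]

end Restrict

/-! ### The order on exponent vectors -/

/-- Exponent vectors are compared by degree, and those of the same degree are listed in decreasing
lexicographic order. -/
def prec (a d : ℕ →₀ ℕ) : Prop :=
  a.degree < d.degree ∨ (a.degree = d.degree ∧ ∃ i, (∀ j < i, a j = d j) ∧ d i < a i)

theorem prec.degree_le {a d : ℕ →₀ ℕ} (h : prec a d) : a.degree ≤ d.degree := by
  rcases h with h | h
  · exact h.le
  · exact h.1.le

theorem prec.trans {a d e : ℕ →₀ ℕ} (h : prec a d) (h' : prec d e) : prec a e := by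
  rcases h with h | ⟨h, i, hi, hi'⟩
  · exact .inl (h.trans_le h'.degree_le)
  rcases h' with h' | ⟨h', j, hj, hj'⟩
  · exact .inl (h ▸ h')
  refine .inr ⟨h.trans h', min i j, fun k hk => ?_, ?_⟩
  · rw [hi k (by omega), hj k (by omega)]
  · rcases lt_trichotomy i j with h1 | h1 | h1
    · rw [min_eq_left h1.le, ← hj i h1]; exact hi'
    · subst h1; rw [min_self]; exact hj'.trans hi'
    · rw [min_eq_right h1.le, hi j h1]; exact hj'

theorem prec.irrefl (a : ℕ →₀ ℕ) : ¬ prec a a := by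
  rintro (h | ⟨-, i, -, h⟩)
  · exact lt_irrefl _ h
  · exact lt_irrefl _ h

theorem exists_forall_mem_support_lt (d : ℕ →₀ ℕ) : ∃ n, ∀ i ∈ d.support, i < n :=
  ⟨d.support.sup id + 1, fun _ hi => Nat.lt_succ_of_le (Finset.le_sup (f := id) hi)⟩

theorem finite_support_degree_le (n D : ℕ) :
    {d : ℕ →₀ ℕ | (∀ i ∈ d.support, i < n) ∧ d.degree ≤ D}.Finite := by
  refine (Set.finite_Iic (∑ i ∈ Finset.range n, Finsupp.single i D : ℕ →₀ ℕ)).subset ?_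
  rintro d ⟨h1, h2⟩ i
  by_cases hi : i < n
  · rw [Finsupp.finsetSum_apply, Finset.sum_eq_single i]
    · simp only [Finsupp.single_eq_same]
      exact (Finsupp.le_degree i d).trans h2
    · intro j _ hj
      simp [hj]
    · simp [hi]
  · have : d i = 0 := by
      by_contra h
      exact hi (h1 i (by simpa using h))
    omega

/-- A weakly decreasing exponent vector with distinct nonzero entries comes from a strict
partition. -/
theorem exists_expo_eq {d : ℕ →₀ ℕ} (h : ∀ i, d (i + 1) ≤ d i)
    (h' : ∀ i, d i ≠ 0 → d i ≠ d (i + 1)) : ∃ la : StrictPartition, la.expo = d := by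
  refine ⟨⟨d, fun i hi => ?_, fun i hi => ?_⟩, ?_⟩
  · have h1 := h i
    have h2 := h' i hi
    omega
  · have h1 := h i
    omega
  · ext i
    rfl

/-! ### Symmetric functions with the cancellation property -/

/-- The variables with index less than `n`. -/
def firstVars (n : ℕ) : Set ℕ := {j | j < n}

/-- The variables with index less than `n`, except `i` and `i + 1`. -/
def firstVarsExcept (n i : ℕ) : Set ℕ := {j | j < n ∧ j ≠ i ∧ j ≠ i + 1}

/-- The interchange of two adjacent variables. -/
def swapVars (i : ℕ) : Series →+* Series :=
  (MvPowerSeries.rename (R := Polynomial ℤ) (Equiv.swap i (i + 1)).toEmbedding).toRingHom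

theorem coeff_swapVars (i : ℕ) (f : Series) (d : ℕ →₀ ℕ) :
    MvPowerSeries.coeff (d.embDomain (Equiv.swap i (i + 1)).toEmbedding) (swapVars i f) =
      MvPowerSeries.coeff d f :=
  MvPowerSeries.coeff_embDomain_rename _ _ _

theorem swapVars_X (i j : ℕ) :
    swapVars i (MvPowerSeries.X j) = MvPowerSeries.X (Equiv.swap i (i + 1) j) :=
  MvPowerSeries.rename_X _ _

theorem swapVars_C (i : ℕ) (c : Polynomial ℤ) :
    swapVars i (MvPowerSeries.C c) = MvPowerSeries.C c :=
  MvPowerSeries.rename_C _ _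

theorem dvd_sub_map_mul {A : Type*} [CommRing A] (φ : A →+* A) {w f g : A} (hf : w ∣ f - φ f)
    (hg : w ∣ g - φ g) : w ∣ f * g - φ (f * g) := by
  have : f * g - φ (f * g) = (f - φ f) * g + φ f * (g - φ g) := by rw [map_mul]; ring
  rw [this]
  exact dvd_add (hf.mul_right g) (hg.mul_left _)

/-- The power series which, for every `n`, become symmetric in `x_0, …, x_{n-1}` and independent of
`t` at `x_i = t`, `x_{i+1} = ⊖ t`, when the variables from `x_n` on are set to zero. The second
condition is expressed by divisibility by `x_i ⊕ x_{i+1}`. -/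
def cancellationRing : Subring Series where
  carrier := {f | ∀ n i, i + 1 < n →
    swapVars i (restrictTo (firstVars n) f) = restrictTo (firstVars n) f ∧
    fgl (MvPowerSeries.C β) (MvPowerSeries.X i) (MvPowerSeries.X (i + 1)) ∣
      restrictTo (firstVars n) f - restrictTo (firstVarsExcept n i) (restrictTo (firstVars n) f)}
  mul_mem' {f g} hf hg n i hi := by
    obtain ⟨h1, h2⟩ := hf n i hi
    obtain ⟨h3, h4⟩ := hg n i hi
    rw [map_mul]
    exact ⟨by rw [map_mul, h1, h3], dvd_sub_map_mul _ h2 h4⟩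
  one_mem' n i _ := by simp
  add_mem' {f g} hf hg n i hi := by
    obtain ⟨h1, h2⟩ := hf n i hi
    obtain ⟨h3, h4⟩ := hg n i hi
    rw [map_add]
    refine ⟨by rw [map_add, h1, h3], ?_⟩
    rw [map_add, add_sub_add_comm]
    exact dvd_add h2 h4
  zero_mem' n i _ := by simp
  neg_mem' {f} hf n i hi := by
    obtain ⟨h1, h2⟩ := hf n i hi
    rw [map_neg]
    refine ⟨by rw [map_neg, h1], ?_⟩
    rw [map_neg, ← neg_sub', dvd_neg]
    exact h2

theorem C_mem_cancellationRing (c : Polynomial ℤ) :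
    (MvPowerSeries.C c : Series) ∈ cancellationRing := fun n i _ => by
  rw [restrictTo_C, restrictTo_C, swapVars_C, sub_self]
  exact ⟨rfl, dvd_zero _⟩

/-- If `F = (x ⊕ y) G` up to a constant, in terms of the coefficients, and the only possibly nonzero
coefficient of `F` in degrees from `1` to `2 k` is that of `x^k y^k`, then that one vanishes too. -/
theorem eq_zero_of_fgl_dvd {R : Type*} [CommRing R] {b : R} {F G : ℕ → ℕ → R} {k : ℕ} (hk : k ≠ 0)
    (h11 : ∀ p q, F (p + 1) (q + 1) = G p (q + 1) + G (p + 1) q + b * G p q)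
    (h10 : ∀ p, F (p + 1) 0 = G p 0) (h01 : ∀ q, F 0 (q + 1) = G 0 q)
    (hF : ∀ p q, 0 < p + q → p + q ≤ 2 * k → (p, q) ≠ (k, k) → F p q = 0) : F k k = 0 := by
  have hlow : ∀ p q, p + q + 1 < 2 * k → G p q = 0 := by
    intro p
    induction p with
    | zero =>
      intro q hq
      rw [← h01]
      exact hF 0 (q + 1) (by omega) (by omega) (by rw [ne_eq, Prod.mk.injEq]; omega)
    | succ p ih =>
      intro q hq
      have h1 := h11 p q
      rw [hF (p + 1) (q + 1) (by omega) (by omega) (by rw [ne_eq, Prod.mk.injEq]; omega),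
        ih (q + 1) (by omega), ih q (by omega)] at h1
      simpa using h1.symm
  have hleft : ∀ p q, p + q + 1 = 2 * k → p < k → G p q = 0 := by
    intro p
    induction p with
    | zero =>
      intro q hq hp
      rw [← h01]
      exact hF 0 (q + 1) (by omega) (by omega) (by rw [ne_eq, Prod.mk.injEq]; omega)
    | succ p ih =>
      intro q hq hp
      have h1 := h11 p q
      rw [hF (p + 1) (q + 1) (by omega) (by omega) (by rw [ne_eq, Prod.mk.injEq]; omega),
        ih (q + 1) (by omega) (by omega), hlow p q (by omega)] at h1
      simpa using h1.symm
  have hright : ∀ q p, p + q + 1 = 2 * k → q < k → G p q = 0 := by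
    intro q
    induction q with
    | zero =>
      intro p hp hq
      rw [← h10]
      exact hF (p + 1) 0 (by omega) (by omega) (by rw [ne_eq, Prod.mk.injEq]; omega)
    | succ q ih =>
      intro p hp hq
      have h1 := h11 p q
      rw [hF (p + 1) (q + 1) (by omega) (by omega) (by rw [ne_eq, Prod.mk.injEq]; omega),
        ih (p + 1) (by omega) (by omega), hlow p q (by omega)] at h1
      simpa using h1.symm
  obtain ⟨m, rfl⟩ : ∃ m, k = m + 1 := ⟨k - 1, by omega⟩
  rw [h11, hleft m (m + 1) (by omega) (by omega), hright m (m + 1) (by omega) (by omega),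
    hlow m m (by omega)]
  simp

/-- The exponent vector `d` with the entries at `i` and `i + 1` replaced by `p` and `q`. -/
def setTwo (d : ℕ →₀ ℕ) (i p q : ℕ) : ℕ →₀ ℕ := (d.update i p).update (i + 1) q

theorem setTwo_apply (d : ℕ →₀ ℕ) (i p q j : ℕ) :
    setTwo d i p q j = if j = i + 1 then q else if j = i then p else d j := by
  classical
  simp [setTwo, Finsupp.update_apply]

theorem setTwo_succ_left (d : ℕ →₀ ℕ) (i p q : ℕ) :
    setTwo d i (p + 1) q = Finsupp.single i 1 + setTwo d i p q := by
  ext j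
  simp only [Finsupp.add_apply, setTwo_apply, Finsupp.single_apply]
  split_ifs <;> omega

theorem setTwo_succ_right (d : ℕ →₀ ℕ) (i p q : ℕ) :
    setTwo d i p (q + 1) = Finsupp.single (i + 1) 1 + setTwo d i p q := by
  ext j
  simp only [Finsupp.add_apply, setTwo_apply, Finsupp.single_apply]
  split_ifs <;> omega

theorem degree_setTwo (d : ℕ →₀ ℕ) (i p q : ℕ) :
    (setTwo d i p q).degree = (setTwo d i 0 0).degree + p + q := by
  induction p with
  | zero =>
    induction q with
    | zero => rfl
    | succ q ih =>
      rw [setTwo_succ_right, map_add, ih, Finsupp.degree_single]; omega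
  | succ p ih => rw [setTwo_succ_left, map_add, ih, Finsupp.degree_single]; omega

theorem embDomain_swap_setTwo (d : ℕ →₀ ℕ) (i p q : ℕ) :
    (setTwo d i p q).embDomain (Equiv.swap i (i + 1)).toEmbedding = setTwo d i q p := by
  ext j
  have h := Finsupp.embDomain_apply_self (Equiv.swap i (i + 1)).toEmbedding (setTwo d i p q)
    (Equiv.swap i (i + 1) j)
  simp only [Equiv.toEmbedding_apply, Equiv.swap_apply_self] at h
  rw [h, setTwo_apply, setTwo_apply, Equiv.swap_apply_def]
  split_ifs <;> first | rfl | omega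

/-- The leading monomial of a nonzero element of `cancellationRing` comes from a strict
partition: if the coefficients at all strict partitions in an initial segment vanish, then all
coefficients in the initial segment vanish. -/
theorem coeff_eq_zero_of_forall_expo {f : Series} (hf : f ∈ cancellationRing)
    {P : (ℕ →₀ ℕ) → Prop} (hP : ∀ a d, prec a d → P d → P a)
    (h0 : ∀ la : StrictPartition, P la.expo → MvPowerSeries.coeff la.expo f = 0) {d : ℕ →₀ ℕ}
    (hd : P d) : MvPowerSeries.coeff d f = 0 := by
  obtain ⟨n, hn⟩ := exists_forall_mem_support_lt d
  have : IsStrictOrder (ℕ →₀ ℕ) prec :=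
    { irrefl := prec.irrefl, trans := fun _ _ _ => prec.trans }
  have hwf := (finite_support_degree_le n d.degree).wellFoundedOn (r := prec)
  have hmem : d ∈ {d' : ℕ →₀ ℕ | (∀ i ∈ d'.support, i < n) ∧ d'.degree ≤ d.degree} :=
    ⟨hn, le_rfl⟩
  clear hn
  revert hd
  refine hwf.induction (P := fun a => P a → MvPowerSeries.coeff a f = 0) hmem ?_
  rintro a ⟨ha1, ha2⟩ ih hPa
  have hzero : ∀ a', (∀ i ∈ a'.support, i < n) → prec a' a → MvPowerSeries.coeff a' f = 0 :=
    fun a' h1 h2 => ih a' ⟨h1, h2.degree_le.trans ha2⟩ h2 (hP _ _ h2 hPa)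
  have hrestr : ∀ a' : ℕ →₀ ℕ, (∀ i ∈ a'.support, i < n) →
      MvPowerSeries.coeff a' (restrictTo (firstVars n) f) = MvPowerSeries.coeff a' f :=
    fun a' h => coeff_restrictTo_of_subset (fun i hi => h i hi) f
  have hself : ∀ i, setTwo a i (a i) (a (i + 1)) = a := by
    intro i
    ext j
    rw [setTwo_apply]
    split_ifs with h1 h2
    · rw [h1]
    · rw [h2]
    · rfl
  have hset : ∀ i p q, i + 1 < n → ∀ j ∈ (setTwo a i p q).support, j < n := by
    intro i p q hi j hj
    rw [Finsupp.mem_support_iff, setTwo_apply] at hj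
    split_ifs at hj with h1 h2
    · omega
    · omega
    · exact ha1 j (by simpa using hj)
  have hsym : ∀ i p q, i + 1 < n → MvPowerSeries.coeff (setTwo a i q p) f =
      MvPowerSeries.coeff (setTwo a i p q) f := by
    intro i p q hi
    have h1 := (hf n i hi).1
    rw [← hrestr _ (hset i p q hi), ← hrestr _ (hset i q p hi), ← embDomain_swap_setTwo a i p q,
      ← coeff_swapVars i _ (setTwo a i p q), h1]
  -- If `a` has an ascent, then by symmetry the coefficient equals one which precedes it.
  by_cases hcase1 : ∃ i, a i < a (i + 1)
  · obtain ⟨i, hi⟩ := hcase1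
    have hin : i + 1 < n := ha1 _ (by simp; omega)
    rw [← hself i, ← hsym i _ _ hin]
    refine hzero _ (hset i _ _ hin) (.inr ⟨?_, i, fun j hj => ?_, ?_⟩)
    · conv_rhs => rw [← hself i]
      rw [degree_setTwo, degree_setTwo a i (a i)]
      omega
    · rw [setTwo_apply, if_neg (by omega), if_neg (by omega)]
    · rw [setTwo_apply, if_neg (by omega), if_pos rfl]
      exact hi
  -- If `a` has two equal nonzero entries, then cancellation applies, as the coefficients at the
  -- exponents with other entries there vanish, by induction and symmetry.
  by_cases hcase2 : ∃ i, a i ≠ 0 ∧ a i = a (i + 1)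
  · obtain ⟨i, hi0, hi⟩ := hcase2
    have hin : i + 1 < n := ha1 _ (by simp; omega)
    obtain ⟨g, hg⟩ := (hf n i hin).2
    set h := restrictTo (firstVarsExcept n i) (restrictTo (firstVars n) f) with hh
    have hfg : restrictTo (firstVars n) f = h +
        (MvPowerSeries.X i * g + MvPowerSeries.X (i + 1) * g +
          MvPowerSeries.C β * (MvPowerSeries.X i * (MvPowerSeries.X (i + 1) * g))) := by
      rw [← sub_eq_iff_eq_add', hg, fgl]; ring
    have hhz : ∀ p q, 0 < p + q → MvPowerSeries.coeff (setTwo a i p q) h = 0 := by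
      intro p q hpq
      refine coeff_restrictTo_of_not_subset (fun hsub => ?_) _
      by_cases hp : p = 0
      · have := (hsub (show i + 1 ∈ ↑(setTwo a i p q).support by
          simp [setTwo_apply]; omega)).2.2
        exact this rfl
      · have := (hsub (show i ∈ ↑(setTwo a i p q).support by
          simp [setTwo_apply]; omega)).2.1
        exact this rfl
    have hF : ∀ p q, 0 < p + q → MvPowerSeries.coeff (setTwo a i p q) f =
        MvPowerSeries.coeff (setTwo a i p q) (MvPowerSeries.X i * g) +
        MvPowerSeries.coeff (setTwo a i p q) (MvPowerSeries.X (i + 1) * g) +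
        β * MvPowerSeries.coeff (setTwo a i p q)
          (MvPowerSeries.X i * (MvPowerSeries.X (i + 1) * g)) := by
      intro p q hpq
      rw [← hrestr _ (hset i p q hin), hfg, map_add, map_add, map_add, hhz p q hpq, zero_add,
        MvPowerSeries.coeff_C_mul]
    have e1 : ∀ p q (g : Series), MvPowerSeries.coeff (setTwo a i (p + 1) q)
        (MvPowerSeries.X i * g) = MvPowerSeries.coeff (setTwo a i p q) g := fun p q g => by
      rw [setTwo_succ_left, coeff_single_add_X_mul]
    have e2 : ∀ p q (g : Series), MvPowerSeries.coeff (setTwo a i p (q + 1))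
        (MvPowerSeries.X (i + 1) * g) = MvPowerSeries.coeff (setTwo a i p q) g := fun p q g => by
      rw [setTwo_succ_right, coeff_single_add_X_mul]
    have e3 : ∀ q (g : Series), MvPowerSeries.coeff (setTwo a i 0 q)
        (MvPowerSeries.X i * g) = 0 := fun q g =>
      coeff_X_mul_of_eq_zero (by simp [setTwo_apply]) g
    have e4 : ∀ p (g : Series), MvPowerSeries.coeff (setTwo a i p 0)
        (MvPowerSeries.X (i + 1) * g) = 0 := fun p g =>
      coeff_X_mul_of_eq_zero (by simp [setTwo_apply]) g
    have key := eq_zero_of_fgl_dvd (b := β) (k := a i)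
      (F := fun p q => MvPowerSeries.coeff (setTwo a i p q) f)
      (G := fun p q => MvPowerSeries.coeff (setTwo a i p q) g) hi0
      (fun p q => by rw [hF _ _ (by omega), e1, e2, e1, e2])
      (fun p => by rw [hF _ _ (by omega), e1, e4, e1, e4]; ring)
      (fun q => by rw [hF _ _ (by omega), e3, e2, e3]; ring)
      (by
        intro p q h1 h2 h3
        have hdeg := degree_setTwo a i p q
        have hdeg' := degree_setTwo a i (a i) (a (i + 1))
        rw [hself i] at hdeg'
        have hgt : ∀ p q, p + q = 2 * a i → a i < p →
            MvPowerSeries.coeff (setTwo a i p q) f = 0 := by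
          intro p q h4 h5
          refine hzero _ (hset i p q hin) (.inr ⟨?_, i, fun j hj => ?_, ?_⟩)
          · rw [degree_setTwo, hdeg']; omega
          · rw [setTwo_apply, if_neg (by omega), if_neg (by omega)]
          · rw [setTwo_apply, if_neg (by omega), if_pos rfl]
            exact h5
        rcases h2.lt_or_eq with h4 | h4
        · exact hzero _ (hset i p q hin) (.inl (by omega))
        · rcases lt_trichotomy p (a i) with h5 | h5 | h5
          · rw [hsym i q p hin]
            exact hgt q p (by omega) (by omega)
          · exact absurd (Prod.ext h5 (show q = a i by omega)) h3
          · exact hgt p q h4 h5)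
    have h5 := hself i
    rw [← hi] at h5
    rw [← h5]
    exact key
  · push Not at hcase1 hcase2
    obtain ⟨la, rfl⟩ := exists_expo_eq hcase1 hcase2
    exact h0 la hPa

/-! ### Power series divisible by `x ⊕ x` in each variable -/

/-- The product of the elements `x_i ⊕ x_i` for `i ∈ S`. -/
def doubleProd (S : Finset ℕ) : Series :=
  ∏ i ∈ S, fgl (MvPowerSeries.C β) (MvPowerSeries.X i) (MvPowerSeries.X i)

theorem restrictTo_doubleProd {U : Set ℕ} {S : Finset ℕ} (h : ↑S ⊆ U) :
    restrictTo U (doubleProd S) = doubleProd S := by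
  rw [doubleProd, map_prod]
  refine Finset.prod_congr rfl fun i hi => ?_
  simp only [fgl, map_add, map_mul, restrictTo_C, restrictTo_X_of_mem (h hi)]

/-- The products of `∏_{i ∈ S} (x_i ⊕ x_i)` with power series in the variables `x_i`, `i ∈ S`. -/
def doubleTerms : Submonoid Series where
  carrier := {f | ∃ (S : Finset ℕ) (g : Series), restrictTo (S : Set ℕ) g = g ∧
    f = doubleProd S * g}
  one_mem' := ⟨∅, 1, map_one _, by simp [doubleProd]⟩
  mul_mem' := by
    rintro f f' ⟨S, g, hg, rfl⟩ ⟨S', g', hg', rfl⟩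
    refine ⟨S ∪ S', doubleProd (S ∩ S') * (g * g'), ?_, ?_⟩
    · rw [map_mul, map_mul, restrictTo_eq_of_subset (by simp) hg,
        restrictTo_eq_of_subset (by simp) hg', restrictTo_doubleProd]
      simp only [Finset.coe_inter, Finset.coe_union]
      exact Set.inter_subset_left.trans Set.subset_union_left
    · have h := Finset.prod_union_inter (s₁ := S) (s₂ := S')
        (f := fun i => fgl (MvPowerSeries.C β : Series) (MvPowerSeries.X i) (MvPowerSeries.X i))
      change doubleProd S * g * (doubleProd S' * g') =
        doubleProd (S ∪ S') * (doubleProd (S ∩ S') * (g * g'))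
      rw [← mul_assoc (doubleProd (S ∪ S'))]
      change doubleProd (S ∪ S') * doubleProd (S ∩ S') = doubleProd S * doubleProd S' at h
      rw [h]
      ring

/-- The power series which, for every `n`, become a sum of elements of `doubleTerms` when the
variables from `x_n` on are set to zero. -/
def doubleRing : Subring Series where
  carrier := {f | ∀ n, restrictTo (firstVars n) f ∈ Subring.closure (doubleTerms : Set Series)}
  mul_mem' hf hg n := by rw [map_mul]; exact mul_mem (hf n) (hg n)
  one_mem' n := by rw [map_one]; exact one_mem _
  add_mem' hf hg n := by rw [map_add]; exact add_mem (hf n) (hg n)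
  zero_mem' n := by rw [map_zero]; exact zero_mem _
  neg_mem' hf n := by rw [map_neg]; exact neg_mem (hf n)

theorem C_mem_doubleTerms (c : Polynomial ℤ) : (MvPowerSeries.C c : Series) ∈ doubleTerms :=
  ⟨∅, MvPowerSeries.C c, restrictTo_C _ _, by simp [doubleProd]⟩

theorem C_mem_doubleRing (c : Polynomial ℤ) : (MvPowerSeries.C c : Series) ∈ doubleRing :=
  fun n => by
    rw [restrictTo_C]
    exact Subring.subset_closure (C_mem_doubleTerms c)

/-- The coefficients of an element of `doubleRing` at the exponent vectors with support `S` are those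
of a multiple of `∏_{i ∈ S} (x_i ⊕ x_i)`. -/
theorem exists_coeff_eq_of_mem_closure {f : Series}
    (hf : f ∈ Subring.closure (doubleTerms : Set Series)) (S : Finset ℕ) :
    ∃ g : Series, ∀ d : ℕ →₀ ℕ, d.support = S →
      MvPowerSeries.coeff d f = MvPowerSeries.coeff d (doubleProd S * g) := by
  rw [Subring.mem_closure_iff, Submonoid.closure_eq] at hf
  induction hf using AddSubgroup.closure_induction with
  | mem f hf =>
    obtain ⟨S', g, hg, rfl⟩ := hf
    by_cases hS : S' = S
    · exact ⟨g, fun d _ => by rw [hS]⟩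
    · refine ⟨0, fun d hd => ?_⟩
      rw [mul_zero, MvPowerSeries.coeff_zero]
      by_cases h1 : S ⊆ S'
      · obtain ⟨i, hi, hiS⟩ : ∃ i ∈ S', i ∉ S := by
          by_contra! hc
          exact hS (Finset.Subset.antisymm hc h1)
        have hdi : d i = 0 := by rw [← hd] at hiS; simpa using hiS
        have : doubleProd S' * g = MvPowerSeries.X i *
            ((2 + MvPowerSeries.C β * MvPowerSeries.X i) * doubleProd (S'.erase i) * g) := by
          rw [doubleProd, ← Finset.mul_prod_erase _ _ hi, fgl, doubleProd]
          ring
        rw [this, coeff_X_mul_of_eq_zero hdi]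
      · refine coeff_eq_zero_of_restrictTo_eq (U := (S' : Set ℕ)) ?_ fun h2 => h1 ?_
        · rw [map_mul, hg, restrictTo_doubleProd subset_rfl]
        · rw [hd] at h2
          exact_mod_cast h2
  | zero => exact ⟨0, fun d _ => by simp⟩
  | add f f' _ _ ih ih' =>
    obtain ⟨g, hg⟩ := ih
    obtain ⟨g', hg'⟩ := ih'
    exact ⟨g + g', fun d hd => by rw [map_add, hg d hd, hg' d hd, ← map_add, mul_add]⟩
  | neg f _ ih =>
    obtain ⟨g, hg⟩ := ih
    exact ⟨-g, fun d hd => by rw [map_neg, hg d hd, ← map_neg, mul_neg]⟩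

/-- Multiplication by `2 + β x_i` doubles the terms of lowest degree. -/
theorem coeff_two_add_mul_eq {i D : ℕ} {S : Finset ℕ} {g : Series}
    (h : ∀ d : ℕ →₀ ℕ, d.support ⊆ S → d.degree < D → MvPowerSeries.coeff d
      ((2 + MvPowerSeries.C β * MvPowerSeries.X i) * g) = 0) :
    (∀ d : ℕ →₀ ℕ, d.support ⊆ S → d.degree < D → MvPowerSeries.coeff d g = 0) ∧
    (∀ d : ℕ →₀ ℕ, d.support ⊆ S → d.degree = D → MvPowerSeries.coeff d
      ((2 + MvPowerSeries.C β * MvPowerSeries.X i) * g) = 2 * MvPowerSeries.coeff d g) := by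
  have key : ∀ E, (∀ d : ℕ →₀ ℕ, d.support ⊆ S → d.degree < E → MvPowerSeries.coeff d g = 0) →
      ∀ d : ℕ →₀ ℕ, d.support ⊆ S → d.degree = E → MvPowerSeries.coeff d
      ((2 + MvPowerSeries.C β * MvPowerSeries.X i) * g) = 2 * MvPowerSeries.coeff d g := by
    intro E hE d hd hdE
    have h2 : (2 : Series) * g = g + g := by ring
    rw [add_mul, map_add, h2, map_add, mul_assoc, MvPowerSeries.coeff_C_mul, ← two_mul]
    by_cases h0 : d i = 0
    · rw [coeff_X_mul_of_eq_zero h0, mul_zero, add_zero]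
    · obtain ⟨d', rfl⟩ : ∃ d', d = Finsupp.single i 1 + d' :=
        ⟨d - Finsupp.single i 1, by
          ext j
          simp only [Finsupp.add_apply, Finsupp.tsub_apply, Finsupp.single_apply]
          split_ifs with hj
          · subst hj; omega
          · omega⟩
      rw [coeff_single_add_X_mul, hE d', mul_zero, add_zero]
      · intro j hj
        refine hd ?_
        simp only [Finsupp.mem_support_iff, Finsupp.add_apply] at hj ⊢
        omega
      · rw [map_add, Finsupp.degree_single] at hdE
        omega
  have hlow : ∀ E ≤ D, ∀ d : ℕ →₀ ℕ, d.support ⊆ S → d.degree < E →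
      MvPowerSeries.coeff d g = 0 := by
    intro E
    induction E with
    | zero => intro _ d _ hd; omega
    | succ E ih =>
      intro hED d hd hdE
      have h1 := key d.degree (fun d' hd' hdd' => ih (by omega) d' hd' (by omega)) d hd rfl
      rw [h d hd (by omega)] at h1
      simpa using h1.symm
  exact ⟨hlow D le_rfl, key D (hlow D le_rfl)⟩

theorem two_pow_dvd_coeff_prod_mul {D : ℕ} {S : Finset ℕ} (S' : Finset ℕ) {g : Series}
    (h : ∀ d : ℕ →₀ ℕ, d.support ⊆ S → d.degree < D → MvPowerSeries.coeff d
      ((∏ i ∈ S', (2 + MvPowerSeries.C β * MvPowerSeries.X i)) * g) = 0)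
    {d : ℕ →₀ ℕ} (hd : d.support ⊆ S) (hD : d.degree = D) : 2 ^ S'.card ∣ MvPowerSeries.coeff d
      ((∏ i ∈ S', (2 + MvPowerSeries.C β * MvPowerSeries.X i)) * g) := by
  induction S' using Finset.induction_on with
  | empty => simp
  | insert i S' hi ih =>
    rw [Finset.prod_insert hi, mul_assoc] at h ⊢
    obtain ⟨h1, h2⟩ := coeff_two_add_mul_eq h
    rw [h2 d hd hD, Finset.card_insert_of_notMem hi, pow_succ']
    exact mul_dvd_mul_left 2 (ih h1)

theorem monomial_sum_single (S : Finset ℕ) :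
    (MvPowerSeries.monomial (∑ i ∈ S, Finsupp.single i 1) 1 : Series) =
      ∏ i ∈ S, MvPowerSeries.X i := by
  induction S using Finset.induction_on with
  | empty => simp
  | insert i S hi ih =>
    rw [Finset.sum_insert hi, Finset.prod_insert hi, ← ih, MvPowerSeries.X,
      MvPowerSeries.monomial_mul_monomial, one_mul]

/-- The leading coefficient of an element of `doubleRing` is divisible by `2^l`, where `l` is the
number of variables in the leading monomial. -/
theorem two_pow_dvd_coeff {f : Series} (hf : f ∈ doubleRing) {d : ℕ →₀ ℕ}
    (h : ∀ a : ℕ →₀ ℕ, a.degree < d.degree → MvPowerSeries.coeff a f = 0) :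
    2 ^ d.support.card ∣ MvPowerSeries.coeff d f := by
  set S := d.support with hS
  obtain ⟨n, hn⟩ := exists_forall_mem_support_lt d
  obtain ⟨g, hg⟩ := exists_coeff_eq_of_mem_closure (hf n) S
  have hg' : ∀ a : ℕ →₀ ℕ, a.support = S →
      MvPowerSeries.coeff a f = MvPowerSeries.coeff a (doubleProd S * g) := by
    intro a ha
    rw [← hg a ha, coeff_restrictTo_of_subset]
    rw [ha]
    exact fun i hi => hn i hi
  set e : ℕ →₀ ℕ := ∑ i ∈ S, Finsupp.single i 1 with he
  have heS : ∀ i, e i = if i ∈ S then 1 else 0 := by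
    intro i
    rw [he, Finsupp.finsetSum_apply]
    simp [Finsupp.single_apply]
  have hprod : doubleProd S * g = MvPowerSeries.monomial e 1 *
      ((∏ i ∈ S, (2 + MvPowerSeries.C β * MvPowerSeries.X i)) * g) := by
    have h1 := monomial_sum_single S
    rw [h1, ← mul_assoc, ← Finset.prod_mul_distrib, doubleProd]
    congr 1
    refine Finset.prod_congr rfl fun i _ => ?_
    rw [fgl]; ring
  have hsupp : ∀ a : ℕ →₀ ℕ, a.support ⊆ S → (e + a).support = S := by
    intro a ha
    ext i
    simp only [Finsupp.mem_support_iff, Finsupp.add_apply, heS]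
    by_cases hi : i ∈ S
    · simp [hi]
    · have : a i = 0 := by
        by_contra h0
        exact hi (ha (by simpa using h0))
      simp [hi, this]
  have hco : ∀ a : ℕ →₀ ℕ, a.support ⊆ S → MvPowerSeries.coeff (e + a) f =
      MvPowerSeries.coeff a ((∏ i ∈ S, (2 + MvPowerSeries.C β * MvPowerSeries.X i)) * g) := by
    intro a ha
    rw [hg' _ (hsupp a ha), hprod, MvPowerSeries.coeff_add_monomial_mul, one_mul]
  obtain ⟨d', hd'⟩ : ∃ d', d = e + d' := by
    refine ⟨d - e, ?_⟩
    ext i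
    simp only [Finsupp.add_apply, Finsupp.tsub_apply, heS]
    by_cases hi : i ∈ S
    · have : d i ≠ 0 := by simpa [hS] using hi
      simp [hi]; omega
    · simp [hi]
  have hd'S : d'.support ⊆ S := by
    intro i hi
    rw [hS, hd']
    simp only [Finsupp.mem_support_iff, Finsupp.add_apply] at hi ⊢
    omega
  rw [hd', hco d' hd'S]
  refine two_pow_dvd_coeff_prod_mul S (D := d'.degree) (fun a ha hdeg => ?_) hd'S rfl
  rw [← hco a ha]
  apply h
  rw [hd', map_add, map_add]
  omega

/-! ### Leading terms -/

theorem coeff_Gsskew_eq_sum {q : Bool} {la μ : StrictPartition} {n N : ℕ} {d : ℕ →₀ ℕ}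
    (hN : la.part 0 ≤ N + 1) (hn : ∀ i ∈ d.support, i < n) :
    MvPowerSeries.coeff d (Gsskew q la μ) =
      ∑ F ∈ (fillings (letterPairsBelow q n N) la μ).filter (fun F => fillWeight F = d),
        β ^ (F.card + μ.size - la.size) := by
  rw [coeff_Gsskew hN hn, ← fillSum_letterPairsBelow, coeff_fillSum]

theorem degree_fillWeight (F : Finset ((ℕ × ℕ) × ℕ)) : (fillWeight F).degree = F.card := by
  rw [fillWeight, map_sum, Finset.card_eq_sum_ones]
  exact Finset.sum_congr rfl fun s _ => Finsupp.degree_single _ _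

theorem exists_filling_of_coeff_ne_zero {q : Bool} {la μ : StrictPartition} {d : ℕ →₀ ℕ}
    (h : MvPowerSeries.coeff d (Gsskew q la μ) ≠ 0) :
    ∃ P F, IsFilling P la μ F ∧ fillWeight F = d := by
  obtain ⟨n, hn⟩ := exists_forall_mem_support_lt d
  rw [coeff_Gsskew_eq_sum (N := la.part 0) (by omega) hn] at h
  obtain ⟨F, hF, -⟩ := Finset.exists_ne_zero_of_sum_ne_zero h
  rw [Finset.mem_filter, mem_fillings] at hF
  exact ⟨_, F, hF⟩

theorem size_le_of_coeff_Gsskew_ne_zero {q : Bool} {la μ : StrictPartition} {d : ℕ →₀ ℕ}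
    (h : MvPowerSeries.coeff d (Gsskew q la μ) ≠ 0) : la.size ≤ d.degree + μ.size := by
  obtain ⟨P, F, hF, rfl⟩ := exists_filling_of_coeff_ne_zero h
  rw [degree_fillWeight]
  exact hF.size_le

theorem subset_of_coeff_Gsskew_ne_zero {q : Bool} {la μ : StrictPartition} {d : ℕ →₀ ℕ}
    (h : MvPowerSeries.coeff d (Gsskew q la μ) ≠ 0) : μ ⊆ la := by
  obtain ⟨P, F, hF, rfl⟩ := exists_filling_of_coeff_ne_zero h
  exact hF.sub

theorem size_le_of_coeff_Gfun_ne_zero {q : Bool} {la : StrictPartition} {d : ℕ →₀ ℕ}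
    (h : MvPowerSeries.coeff d (Gfun q la) ≠ 0) : la.size ≤ d.degree := by
  rw [← Gsskew_empty] at h
  simpa using size_le_of_coeff_Gsskew_ne_zero h

/-- The power series all of whose terms `β^j x^a` satisfy `|a| - j = m`. -/
def homogeneous (m : ℕ) : AddSubgroup Series where
  carrier := {f | ∀ a j, (MvPowerSeries.coeff a f).coeff j ≠ 0 → j + m = a.degree}
  add_mem' {f g} hf hg a j h := by
    rw [map_add, Polynomial.coeff_add] at h
    by_cases h0 : (MvPowerSeries.coeff a f).coeff j = 0
    · exact hg a j fun h1 => h (by rw [h0, h1, add_zero])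
    · exact hf a j h0
  zero_mem' a j h := by simp at h
  neg_mem' {f} hf a j h := by
    rw [map_neg, Polynomial.coeff_neg, neg_ne_zero] at h
    exact hf a j h

theorem mul_mem_homogeneous {m m' : ℕ} {f g : Series} (hf : f ∈ homogeneous m)
    (hg : g ∈ homogeneous m') : f * g ∈ homogeneous (m + m') := by
  classical
  intro a j h
  rw [MvPowerSeries.coeff_mul, Polynomial.finsetSum_coeff] at h
  obtain ⟨⟨a1, a2⟩, ha, h⟩ := Finset.exists_ne_zero_of_sum_ne_zero h
  rw [Polynomial.coeff_mul] at h
  obtain ⟨⟨j1, j2⟩, hj, h⟩ := Finset.exists_ne_zero_of_sum_ne_zero h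
  rw [Finset.HasAntidiagonal.mem_antidiagonal] at ha hj
  simp only at ha hj h
  have h1 := hf a1 j1 (left_ne_zero_of_mul h)
  have h2 := hg a2 j2 (right_ne_zero_of_mul h)
  rw [← ha, map_add]
  omega

theorem Gfun_mem_homogeneous (q : Bool) (la : StrictPartition) : Gfun q la ∈ homogeneous la.size := by
  intro a j h
  obtain ⟨n, hn⟩ := exists_forall_mem_support_lt a
  rw [← Gsskew_empty, coeff_Gsskew_eq_sum (N := la.part 0) (by omega) hn,
    Polynomial.finsetSum_coeff] at h
  obtain ⟨F, hF, hne⟩ := Finset.exists_ne_zero_of_sum_ne_zero h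
  rw [Finset.mem_filter, mem_fillings] at hF
  obtain ⟨hF, rfl⟩ := hF
  rw [β, Polynomial.coeff_X_pow] at hne
  have h1 : j = F.card + emptyPartition.size - la.size := by
    by_contra hj
    exact hne (if_neg hj)
  have h2 := hF.size_le
  rw [degree_fillWeight]
  rw [size_empty] at h1 h2
  omega

namespace IsFilling

variable {P : Finset (ℕ × ℕ)} {la : StrictPartition} {F : Finset ((ℕ × ℕ) × ℕ)}

theorem two_mul_row_le (h : IsFilling P la emptyPartition F) {s : (ℕ × ℕ) × ℕ} (hs : s ∈ F) :
    2 * s.1.1 ≤ s.2 := by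
  obtain ⟨⟨r, c⟩, k⟩ := s
  simp only
  induction r generalizing c k with
  | zero => omega
  | succ r ih =>
    have h1 := h.box _ hs
    rw [mem_diagram] at h1
    simp only at h1
    have h2 := la.add_part_anti (Nat.le_add_right r 1) (by omega)
    obtain ⟨a, ha⟩ := h.cover (r, c) ((mem_diagram _ _).2 ⟨by simp only; omega, by simp only; omega⟩)
      (by simp)
    obtain ⟨a', ha'⟩ := h.cover (r, c - 1)
      ((mem_diagram _ _).2 ⟨by simp only; omega, by simp only; omega⟩) (by simp)
    have h3 := ih _ _ ha'
    have h4 := h.row _ ha' _ ha rfl (by simp only; omega)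
    have h5 := h.col _ ha _ hs rfl (by simp)
    simp only [Nat.even_iff] at h4 h5
    omega

theorem image_fst_eq (h : IsFilling P la emptyPartition F) : F.image Prod.fst = la.diagram := by
  ext p
  rw [Finset.mem_image]
  constructor
  · rintro ⟨s, hs, rfl⟩
    exact h.box s hs
  · intro hp
    obtain ⟨k, hk⟩ := h.cover p hp (by simp)
    exact ⟨_, hk, rfl⟩

theorem injOn_fst (h : IsFilling P la emptyPartition F) (hc : F.card = la.size) :
    Set.InjOn Prod.fst (F : Set ((ℕ × ℕ) × ℕ)) := by
  rw [← Finset.card_image_iff, h.image_fst_eq, hc, size]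

theorem card_filter_row (h : IsFilling P la emptyPartition F) (hc : F.card = la.size) (m : ℕ) :
    (F.filter fun s => s.1.1 < m).card = ∑ r ∈ Finset.range m, la.part r := by
  rw [← card_diagram_rows, ← h.image_fst_eq, Finset.filter_image, Finset.card_image_of_injOn]
  · congr 1
    ext s
    simp
  · exact (h.injOn_fst hc).mono fun s hs => (Finset.mem_filter.1 hs).1

theorem card_filter_letter (F : Finset ((ℕ × ℕ) × ℕ)) (m : ℕ) :
    (F.filter fun s => s.2 / 2 < m).card = ∑ i ∈ Finset.range m, fillWeight F i := by
  simp only [fillWeight, Finsupp.finsetSum_apply]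
  rw [Finset.sum_comm, Finset.card_filter]
  refine Finset.sum_congr rfl fun s _ => ?_
  simp [Finsupp.single_apply]

theorem filter_letter_subset (h : IsFilling P la emptyPartition F) (m : ℕ) :
    (F.filter fun s => s.2 / 2 < m) ⊆ F.filter fun s => s.1.1 < m := by
  intro s hs
  rw [Finset.mem_filter] at hs ⊢
  have := h.two_mul_row_le hs.1
  exact ⟨hs.1, by omega⟩

/-- The letters of a tableau in its first rows dominate: this is the triangularity of `GP` and
`GQ`. -/
theorem fillWeight_eq_or_prec (h : IsFilling P la emptyPartition F) :
    fillWeight F = la.expo ∨ prec la.expo (fillWeight F) := by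
  by_cases hne : fillWeight F = la.expo
  · exact .inl hne
  right
  have hsz := h.size_le
  rw [size_empty, add_zero] at hsz
  rcases hsz.lt_or_eq with h1 | h1
  · exact .inl (by rw [degree_expo, degree_fillWeight]; exact h1)
  refine .inr ⟨by rw [degree_expo, degree_fillWeight, h1], ?_⟩
  obtain ⟨i, hi, hmin⟩ : ∃ i, fillWeight F i ≠ la.part i ∧ ∀ j < i, fillWeight F j = la.part j := by
    classical
    have hex : ∃ i, fillWeight F i ≠ la.part i := by
      by_contra! hc
      exact hne (Finsupp.ext hc)
    exact ⟨Nat.find hex, Nat.find_spec hex, fun j hj => by simpa using Nat.find_min hex hj⟩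
  refine ⟨i, fun j hj => (hmin j hj).symm, ?_⟩
  have h2 := Finset.card_le_card (h.filter_letter_subset (i + 1))
  have hs : ∑ j ∈ Finset.range i, fillWeight F j = ∑ j ∈ Finset.range i, la.part j :=
    Finset.sum_congr rfl fun j hj => hmin j (Finset.mem_range.1 hj)
  rw [card_filter_letter, h.card_filter_row h1.symm, Finset.sum_range_succ, Finset.sum_range_succ,
    hs] at h2
  rw [expo_apply]
  omega

/-- In a tableau whose exponent vector is its shape, the row `r` contains only the letters `2 r`
and `2 r + 1`. -/
theorem letter_div_two (h : IsFilling P la emptyPartition F) (hw : fillWeight F = la.expo)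
    {s : (ℕ × ℕ) × ℕ} (hs : s ∈ F) : s.2 / 2 = s.1.1 := by
  have hc : F.card = la.size := by rw [← degree_fillWeight, hw, degree_expo]
  have h1 : (F.filter fun s => s.2 / 2 < s.1.1 + 1) = F := by
    rw [Finset.filter_true_of_mem]
    intro t ht
    have h2 : (F.filter fun s => s.2 / 2 < t.1.1 + 1) = F.filter fun s => s.1.1 < t.1.1 + 1 := by
      refine Finset.eq_of_subset_of_card_le (h.filter_letter_subset _) ?_
      rw [card_filter_letter, h.card_filter_row hc, hw]
      rfl
    have h3 : t ∈ F.filter fun s => s.1.1 < t.1.1 + 1 := by simp [ht]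
    rw [← h2, Finset.mem_filter] at h3
    exact h3.2
  rw [← h1, Finset.mem_filter] at hs
  have := h.two_mul_row_le hs.1
  omega

theorem odd_of_row_lt (h : IsFilling P la emptyPartition F) (hw : fillWeight F = la.expo)
    {s : (ℕ × ℕ) × ℕ} (hs : s ∈ F) (hlt : s.1.1 < s.1.2) : s.2 = 2 * s.1.1 + 1 := by
  have h1 := h.letter_div_two hw hs
  have h2 := h.box _ hs
  rw [mem_diagram] at h2
  obtain ⟨a, ha⟩ := h.cover (s.1.1, s.1.1) ((mem_diagram _ _).2 ⟨le_rfl, by simp only; omega⟩)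
    (by simp)
  have h3 := h.letter_div_two hw ha
  have h4 := h.row _ ha _ hs rfl hlt
  simp only [Nat.even_iff] at h3 h4
  omega

end IsFilling

theorem eq_or_prec_of_coeff_Gfun_ne_zero {q : Bool} {la : StrictPartition} {d : ℕ →₀ ℕ}
    (h : MvPowerSeries.coeff d (Gfun q la) ≠ 0) : d = la.expo ∨ prec la.expo d := by
  rw [← Gsskew_empty] at h
  obtain ⟨P, F, hF, rfl⟩ := exists_filling_of_coeff_ne_zero h
  exact hF.fillWeight_eq_or_prec

/-- The filling of `la` by the letters `2 r + 1` in row `r`, except for the letters `2 r` in the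
diagonal boxes with `r ∈ U`. -/
def leadFilling (la : StrictPartition) (U : Finset ℕ) : Finset ((ℕ × ℕ) × ℕ) :=
  la.diagram.image fun p => (p, if p.1 = p.2 ∧ p.1 ∈ U then 2 * p.1 else 2 * p.1 + 1)

theorem mem_leadFilling {la : StrictPartition} {U : Finset ℕ} {s : (ℕ × ℕ) × ℕ} :
    s ∈ leadFilling la U ↔ s.1 ∈ la.diagram ∧
      s.2 = if s.1.1 = s.1.2 ∧ s.1.1 ∈ U then 2 * s.1.1 else 2 * s.1.1 + 1 := by
  rw [leadFilling, Finset.mem_image]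
  constructor
  · rintro ⟨p, hp, rfl⟩
    exact ⟨hp, rfl⟩
  · rintro ⟨h1, h2⟩
    exact ⟨s.1, h1, Prod.ext rfl h2.symm⟩

theorem isFilling_leadFilling {q : Bool} {la : StrictPartition} {U : Finset ℕ} {n N : ℕ}
    (hN : la.part 0 ≤ N + 1) (hn : ∀ i ∈ la.expo.support, i < n) (hU : q = true ∨ U = ∅) :
    IsFilling (letterPairsBelow q n N) la emptyPartition (leadFilling la U) where
  sub := empty_subset la
  cover p hp _ := ⟨if p.1 = p.2 ∧ p.1 ∈ U then 2 * p.1 else 2 * p.1 + 1,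
    mem_leadFilling.2 ⟨hp, rfl⟩⟩
  box s hs := (mem_leadFilling.1 hs).1
  rem s _ h := by simp at h
  letter s hs := by
    obtain ⟨h1, h2⟩ := mem_leadFilling.1 hs
    rw [mem_diagram] at h1
    have h3 : s.1.1 < n := hn _ (by simp; omega)
    have h4 := la.part_anti (Nat.zero_le s.1.1)
    simp only [letterPairsBelow, Finset.mem_filter, Finset.mem_product, Finset.mem_range]
    refine ⟨⟨by split_ifs at h2 <;> omega, by omega⟩, ?_⟩
    rcases hU with hU | hU
    · exact .inl hU
    · right; left
      rw [hU] at h2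
      simp only [Finset.notMem_empty, and_false, if_false] at h2
      rw [h2, Nat.even_iff]
      omega
  row s hs t ht h1 h2 := by
    obtain ⟨h3, h4⟩ := mem_leadFilling.1 hs
    obtain ⟨h5, h6⟩ := mem_leadFilling.1 ht
    rw [mem_diagram] at h3
    rw [if_neg (by omega)] at h6
    simp only [Nat.even_iff]
    split_ifs at h4 <;> omega
  col s hs t ht h1 h2 := by
    obtain ⟨h3, h4⟩ := mem_leadFilling.1 hs
    obtain ⟨h5, h6⟩ := mem_leadFilling.1 ht
    left
    split_ifs at h4 h6 <;> omega

theorem fillWeight_leadFilling (la : StrictPartition) (U : Finset ℕ) :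
    fillWeight (leadFilling la U) = la.expo := by
  ext i
  rw [fillWeight, leadFilling, Finset.sum_image (fun p _ p' _ h => (Prod.mk.inj h).1),
    Finsupp.finsetSum_apply]
  have h := la.card_diagram_rows {i}
  rw [Finset.sum_singleton, Finset.card_filter] at h
  rw [expo_apply, ← h]
  refine Finset.sum_congr rfl fun p _ => ?_
  have : (if p.1 = p.2 ∧ p.1 ∈ U then 2 * p.1 else 2 * p.1 + 1) / 2 = p.1 := by
    split_ifs <;> omega
  rw [this, Finsupp.single_apply]
  simp

/-- The leading coefficient of `GQ_λ` (if `q`) or `GP_λ`. -/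
def leadCoeff (q : Bool) (la : StrictPartition) : Polynomial ℤ :=
  if q then 2 ^ la.expo.support.card else 1

theorem coeff_expo_Gfun (q : Bool) (la : StrictPartition) :
    MvPowerSeries.coeff la.expo (Gfun q la) = leadCoeff q la := by
  classical
  obtain ⟨n, hn⟩ := exists_forall_mem_support_lt la.expo
  rw [← Gsskew_empty, coeff_Gsskew_eq_sum (N := la.part 0) (by omega) hn]
  have hcard : ∀ F ∈ (fillings (letterPairsBelow q n (la.part 0)) la emptyPartition).filter
      (fun F => fillWeight F = la.expo), β ^ (F.card + emptyPartition.size - la.size) = 1 := by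
    intro F hF
    rw [Finset.mem_filter] at hF
    rw [← degree_fillWeight, hF.2, degree_expo, size_empty, add_zero, Nat.sub_self, pow_zero]
  rw [Finset.sum_congr rfl hcard, Finset.sum_const, nsmul_eq_mul, mul_one]
  have himage : (fillings (letterPairsBelow q n (la.part 0)) la emptyPartition).filter
      (fun F => fillWeight F = la.expo) =
      (if q then la.expo.support else ∅).powerset.image (leadFilling la) := by
    ext F
    rw [Finset.mem_filter, mem_fillings, Finset.mem_image]
    constructor
    · rintro ⟨h, hw⟩
      have hc : F.card = la.size := by rw [← degree_fillWeight, hw, degree_expo]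
      have hdiag : ∀ r k, ((r, r), k) ∈ F → q = false → k = 2 * r + 1 := by
        intro r k hk hq
        have h1 := h.letter _ hk
        have h2 := h.letter_div_two hw hk
        simp only [letterPairsBelow, Finset.mem_filter, hq, Nat.even_iff] at h1 h2
        simp at h1
        omega
      refine ⟨la.expo.support.filter fun r => ((r, r), 2 * r) ∈ F, ?_, ?_⟩
      · rw [Finset.mem_powerset]
        intro r hr
        rw [Finset.mem_filter] at hr
        cases q with
        | true => exact hr.1
        | false =>
          have := hdiag r _ hr.2 rfl
          omega
      · refine Finset.eq_of_subset_of_card_le ?_ ?_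
        · intro s hs
          obtain ⟨h1, h2⟩ := mem_leadFilling.1 hs
          obtain ⟨k, hk⟩ := h.cover s.1 h1 (by simp)
          have h3 := h.letter_div_two hw hk
          simp only at h3
          have hks : k = s.2 := by
            rw [h2]
            by_cases hd : s.1.1 = s.1.2
            · have hsd : s.1 = (s.1.1, s.1.1) := Prod.ext rfl hd.symm
              have hsup : s.1.1 ∈ la.expo.support := by
                rw [mem_diagram] at h1
                simp; omega
              split_ifs with h4
              · have h5 := (Finset.mem_filter.1 h4.2).2
                have := h.injOn_fst hc hk h5 hsd
                exact (Prod.mk.inj this).2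
              · have h5 : k ≠ 2 * s.1.1 := by
                  intro e
                  refine h4 ⟨hd, Finset.mem_filter.2 ⟨hsup, ?_⟩⟩
                  rw [← hsd, ← e]
                  exact hk
                omega
            · rw [if_neg fun h4 => hd h4.1]
              have h1' := h1
              rw [mem_diagram] at h1'
              exact h.odd_of_row_lt hw hk (by simp only; omega)
          rw [hks] at hk
          exact hk
        · rw [hc, leadFilling, Finset.card_image_of_injective _
            (fun p p' hpp => (Prod.mk.inj hpp).1), size]
    · rintro ⟨U, hU, rfl⟩
      refine ⟨isFilling_leadFilling (by omega) hn ?_, fillWeight_leadFilling la U⟩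
      cases q
      · right; simpa using hU
      · exact .inl rfl
  rw [himage, Finset.card_image_of_injOn, Finset.card_powerset, leadCoeff]
  · cases q <;> simp
  · intro U hU V hV hUV
    have key : ∀ U V : Finset ℕ, U ⊆ la.expo.support → leadFilling la U = leadFilling la V →
        U ⊆ V := by
      intro U V hU hUV r hr
      have hmem : (r, r) ∈ la.diagram := by
        have := hU hr
        rw [Finsupp.mem_support_iff, expo_apply] at this
        rw [mem_diagram]
        simp only
        omega
      have h1 : ((r, r), 2 * r) ∈ leadFilling la U :=
        mem_leadFilling.2 ⟨hmem, by simp [hr]⟩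
      rw [hUV] at h1
      have h2 := (mem_leadFilling.1 h1).2
      simp only [true_and] at h2
      by_contra hc
      rw [if_neg hc] at h2
      omega
    have hsub : ∀ U ∈ (↑(if q = true then la.expo.support else ∅).powerset : Set (Finset ℕ)),
        U ⊆ la.expo.support := by
      intro U hU
      rw [Finset.mem_coe, Finset.mem_powerset] at hU
      cases q
      · exact hU.trans (by simp)
      · exact hU
    exact Finset.Subset.antisymm (key U V (hsub U hU) hUV) (key V U (hsub V hV) hUV.symm)

theorem leadCoeff_ne_zero (q : Bool) (la : StrictPartition) : leadCoeff q la ≠ 0 := by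
  cases q <;> simp [leadCoeff]

/-! ### Cancellation property and divisibility of `GP` and `GQ` -/

theorem StrictPartition.matCoeff_congr {A : Type*} [CommRing A] {b : A} {q : Bool} {N n : ℕ}
    {x y : ℕ → A} (h : ∀ i < n, x i = y i) (la μ : StrictPartition) :
    matCoeff b q N x n la μ = matCoeff b q N y n la μ := by
  rw [matCoeff, matCoeff, evol_congr h]

theorem restrictTo_matCoeff_of_subset {U : Set ℕ} {q : Bool} {N n : ℕ} (h : ∀ i < n, i ∈ U)
    (la μ : StrictPartition) :
    restrictTo U (matCoeff (MvPowerSeries.C β : Series) q N MvPowerSeries.X n la μ) =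
      matCoeff (MvPowerSeries.C β : Series) q N MvPowerSeries.X n la μ := by
  rw [matCoeff_map, restrictTo_C]
  exact matCoeff_congr (fun i hi => restrictTo_X_of_mem (h i hi)) la μ

/-- In the variables `x_i` with `i < n`, `G_λ` is a matrix coefficient of a product of transfer
operators. -/
theorem restrictTo_Gfun (q : Bool) (n : ℕ) (la : StrictPartition) :
    restrictTo (firstVars n) (Gfun q la) = matCoeff (MvPowerSeries.C β : Series) q (la.part 0)
      MvPowerSeries.X n la emptyPartition := by
  ext1 d
  by_cases hd : ↑d.support ⊆ firstVars n
  · rw [coeff_restrictTo_of_subset hd, ← Gsskew_empty,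
      coeff_Gsskew (N := la.part 0) (by omega) (n := n) fun i hi => hd hi]
  · rw [coeff_restrictTo_of_not_subset hd, coeff_eq_zero_of_restrictTo_eq _ hd]
    exact restrictTo_matCoeff_of_subset (fun i hi => hi) la _

theorem constantCoeff_one_add_C_mul_X (i : ℕ) :
    MvPowerSeries.constantCoeff (1 + MvPowerSeries.C β * MvPowerSeries.X i : Series) =
      ((1 : (Polynomial ℤ)ˣ) : Polynomial ℤ) := by
  simp

theorem Gfun_mem_cancellationRing (q : Bool) (la : StrictPartition) :
    Gfun q la ∈ cancellationRing := by
  intro n i hi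
  rw [restrictTo_Gfun]
  constructor
  -- Symmetry, with `p = x_i ⊖ x_{i+1}`.
  · rw [matCoeff_map, swapVars_C]
    simp only [swapVars_X, matCoeff]
    have hu := MvPowerSeries.mul_invOfUnit (1 + MvPowerSeries.C β * MvPowerSeries.X (i + 1) : Series)
      1 (constantCoeff_one_add_C_mul_X _)
    rw [evol_swap (MvPowerSeries.X : ℕ → Series) hi (p := (MvPowerSeries.X i -
      MvPowerSeries.X (i + 1)) *
        MvPowerSeries.invOfUnit (1 + MvPowerSeries.C β * MvPowerSeries.X (i + 1)) 1)]
    rw [fgl]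
    linear_combination (MvPowerSeries.X (i + 1) - MvPowerSeries.X i : Series) * hu
  · obtain ⟨M, hM⟩ := exists_evol_eq (b := (MvPowerSeries.C β : Series)) (q := q) (N := la.part 0)
      (MvPowerSeries.X : ℕ → Series) hi
    have hr : ∀ j < n, restrictTo (firstVarsExcept n i) (MvPowerSeries.X j : Series) =
        if j = i ∨ j = i + 1 then 0 else MvPowerSeries.X j := by
      intro j hj
      split_ifs with h
      · refine restrictTo_X_of_notMem fun h' => ?_
        rcases h with h | h
        · exact h'.2.1 h
        · exact h'.2.2 h
      · exact restrictTo_X_of_mem ⟨hj, fun h' => h (.inl h'), fun h' => h (.inr h')⟩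
    rw [matCoeff_map, restrictTo_C, matCoeff_congr hr, matCoeff, hM, matCoeff]
    exact ⟨_, add_sub_cancel_left _ _⟩

/-- The products of `∏_{i ∈ S} (x_i ⊕ x_i)` with power series in the variables `x_i`,
`i ∈ S ∪ V`, for sets `S` of numbers less than `n`. -/
def doubleTermsBelow (n : ℕ) (V : Set ℕ) : Set Series :=
  {f | ∃ (S : Finset ℕ) (g : Series), (∀ i ∈ S, i < n) ∧ restrictTo (↑S ∪ V) g = g ∧
    f = doubleProd S * g}

theorem mul_mem_closure_of_forall {A : Type*} [CommRing A] {s t : Set A} {c : A}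
    (h : ∀ f ∈ s, c * f ∈ t) {f : A} (hf : f ∈ AddSubgroup.closure s) :
    c * f ∈ AddSubgroup.closure t := by
  induction hf using AddSubgroup.closure_induction with
  | mem f hf => exact AddSubgroup.subset_closure (h f hf)
  | zero => rw [mul_zero]; exact zero_mem _
  | add f g _ _ hf hg => rw [mul_add]; exact add_mem hf hg
  | neg f _ hf => rw [mul_neg]; exact neg_mem hf

theorem matCoeff_mem_closure_doubleTermsBelow (N n : ℕ) (μ la : StrictPartition) :
    matCoeff (MvPowerSeries.C β : Series) true N MvPowerSeries.X n la μ ∈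
      AddSubgroup.closure (doubleTermsBelow n ∅) := by
  induction n generalizing la with
  | zero =>
    classical
    refine AddSubgroup.subset_closure ⟨∅, (Pi.single μ 1 : StrictPartition → Series) la, by simp,
      ?_, by simp [doubleProd, matCoeff, evol]⟩
    rw [Pi.single_apply]
    split_ifs <;> simp
  | succ n ih =>
    rw [matCoeff, evol, transfer_true_eq (isIdCoxeter_peel _)]
    change _ + fgl (MvPowerSeries.C β : Series) (MvPowerSeries.X n) (MvPowerSeries.X n) *
      (transferQuot (peel (MvPowerSeries.C β : Series)) (MvPowerSeries.X n : Series) N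
        (fun κ => matCoeff (MvPowerSeries.C β : Series) true N MvPowerSeries.X n κ μ) la) ∈ _
    refine add_mem ?_ ?_
    · refine AddSubgroup.closure_mono ?_ (ih la)
      rintro _ ⟨S, g, hS, hg, rfl⟩
      exact ⟨S, g, fun i hi => (hS i hi).trans (Nat.lt_succ_self n), hg, rfl⟩
    · have hmem := transferQuot_mem (b := (MvPowerSeries.C β : Series))
        (B := AddSubgroup.closure (doubleTermsBelow n {n})) (x := (MvPowerSeries.X n : Series))
        (fun f hf => mul_mem_closure_of_forall (s := doubleTermsBelow n {n}) ?_ hf)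
        (fun f hf => mul_mem_closure_of_forall (s := doubleTermsBelow n {n}) ?_ hf) N
        (F := fun κ => matCoeff (MvPowerSeries.C β : Series) true N MvPowerSeries.X n κ μ)
        (fun κ => ?_) la
      · refine mul_mem_closure_of_forall ?_ hmem
        rintro _ ⟨S, g, hS, hg, rfl⟩
        have hn : n ∉ S := fun h => lt_irrefl n (hS n h)
        refine ⟨insert n S, g, ?_, ?_, ?_⟩
        · intro i hi
          rcases Finset.mem_insert.1 hi with rfl | hi
          · exact Nat.lt_succ_self i
          · exact (hS i hi).trans (Nat.lt_succ_self n)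
        · rw [Finset.coe_insert, Set.union_empty, ← Set.union_singleton]
          exact hg
        · rw [doubleProd, doubleProd, Finset.prod_insert hn, mul_assoc]
      · rintro _ ⟨S, g, hS, hg, rfl⟩
        exact ⟨S, MvPowerSeries.C β * g, hS, by rw [map_mul, restrictTo_C, hg],
          mul_left_comm _ _ _⟩
      · rintro _ ⟨S, g, hS, hg, rfl⟩
        exact ⟨S, MvPowerSeries.X n * g, hS,
          by rw [map_mul, restrictTo_X_of_mem (by simp), hg], mul_left_comm _ _ _⟩
      · refine AddSubgroup.closure_mono ?_ (ih κ)
        rintro _ ⟨S, g, hS, hg, rfl⟩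
        exact ⟨S, g, hS, restrictTo_eq_of_subset (Set.union_subset_union_right _ (by simp)) hg, rfl⟩

theorem Gfun_true_mem_doubleRing (la : StrictPartition) : Gfun true la ∈ doubleRing := by
  intro n
  rw [restrictTo_Gfun, Subring.mem_closure_iff, Submonoid.closure_eq]
  refine AddSubgroup.closure_mono ?_ (matCoeff_mem_closure_doubleTermsBelow _ n _ la)
  rintro _ ⟨S, g, _, hg, rfl⟩
  exact ⟨S, g, by simpa using hg, rfl⟩

/-- The subring of `ℤ[β][[x_1, x_2, …]]` in which expansions into the `GQ_λ` (if `q`) or `GP_λ`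
exist. -/
def Gring (q : Bool) : Subring Series :=
  if q then cancellationRing ⊓ doubleRing else cancellationRing

theorem Gring_le_cancellationRing (q : Bool) : Gring q ≤ cancellationRing := by
  cases q
  · exact le_rfl
  · exact inf_le_left

theorem Gfun_mem_Gring (q : Bool) (la : StrictPartition) : Gfun q la ∈ Gring q := by
  cases q
  · exact Gfun_mem_cancellationRing _ la
  · exact ⟨Gfun_mem_cancellationRing _ la, Gfun_true_mem_doubleRing la⟩

theorem C_mem_Gring (q : Bool) (c : Polynomial ℤ) : (MvPowerSeries.C c : Series) ∈ Gring q := by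
  cases q
  · exact C_mem_cancellationRing c
  · exact ⟨C_mem_cancellationRing c, C_mem_doubleRing c⟩

theorem leadCoeff_dvd {q : Bool} {f : Series} (hf : f ∈ Gring q) {la : StrictPartition}
    (h : ∀ a, prec a la.expo → MvPowerSeries.coeff a f = 0) :
    leadCoeff q la ∣ MvPowerSeries.coeff la.expo f := by
  cases q
  · exact one_dvd _
  · exact two_pow_dvd_coeff hf.2 fun a ha => h a (.inl ha)

/-! ### Expansions into the functions `GP` or `GQ` -/

/-- The partitions of size at most `|λ|` whose exponent vector precedes that of `λ`. -/
def below (la : StrictPartition) : Finset StrictPartition := by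
  classical exact (sizeLE la.size).filter fun μ => prec μ.expo la.expo

theorem mem_below {la μ : StrictPartition} : μ ∈ below la ↔ prec μ.expo la.expo := by
  classical
  rw [below, Finset.mem_filter, mem_sizeLE]
  refine ⟨fun h => h.2, fun h => ⟨?_, h⟩⟩
  have := h.degree_le
  rwa [degree_expo, degree_expo] at this

theorem wellFounded_prec_expo :
    WellFounded fun μ la : StrictPartition => prec μ.expo la.expo := by
  refine Subrelation.wf (r := InvImage (· < ·) fun la => (below la).card) ?_
    (InvImage.wf _ wellFounded_lt)
  intro μ la h
  refine Finset.card_lt_card ⟨fun κ hκ => ?_, fun hsub => ?_⟩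
  · exact mem_below.2 ((mem_below.1 hκ).trans h)
  · exact prec.irrefl _ (mem_below.1 (hsub (mem_below.2 h)))

theorem coeff_Gfun_eq_zero {q : Bool} {la : StrictPartition} {a : ℕ →₀ ℕ} (h1 : a ≠ la.expo)
    (h2 : ¬ prec la.expo a) : MvPowerSeries.coeff a (Gfun q la) = 0 := by
  by_contra h
  rcases eq_or_prec_of_coeff_Gfun_ne_zero h with h | h
  · exact h1 h
  · exact h2 h

/-- Elimination of leading terms: `K` is an additive group of power series with the cancellation
property such that the leading coefficient of an element of `K`, at `λ`, is an element of `A λ` times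
that of `G_λ`. -/
theorem exists_expansion {q : Bool} {K : AddSubgroup Series} {A : StrictPartition → Set (Polynomial ℤ)}
    (hK : ∀ f ∈ K, f ∈ cancellationRing)
    (lead : ∀ f ∈ K, ∀ la : StrictPartition, (∀ a, prec a la.expo → MvPowerSeries.coeff a f = 0) →
      ∃ c ∈ A la, MvPowerSeries.coeff la.expo f = c * leadCoeff q la)
    (hA : ∀ la, ∀ c ∈ A la, MvPowerSeries.C c * Gfun q la ∈ K) {f : Series} (hf : f ∈ K) :
    ∃ c : StrictPartition → Polynomial ℤ, (∀ la, c la ∈ A la) ∧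
      ∀ a, MvPowerSeries.coeff a f =
        ∑ la ∈ sizeLE a.degree, c la * MvPowerSeries.coeff a (Gfun q la) := by
  classical
  -- The coefficients are determined recursively by those at the preceding partitions.
  let P : (la : StrictPartition) → ((μ : StrictPartition) → prec μ.expo la.expo → Polynomial ℤ) →
      Polynomial ℤ → Prop := fun la c x => x ∈ A la ∧ MvPowerSeries.coeff la.expo f =
    ∑ μ ∈ (below la).attach, c μ.1 (mem_below.1 μ.2) *
      MvPowerSeries.coeff la.expo (Gfun q μ.1) + x * leadCoeff q la
  let c : StrictPartition → Polynomial ℤ :=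
    wellFounded_prec_expo.fix fun la c => Classical.epsilon (P la c)
  have hc : ∀ la, c la = Classical.epsilon (P la fun μ _ => c μ) := fun la =>
    wellFounded_prec_expo.fix_eq _ la
  have hex : ∀ la, (∃ x, P la (fun μ _ => c μ) x) → P la (fun μ _ => c μ) (c la) := by
    intro la h
    rw [hc la]
    exact Classical.epsilon_spec h
  have key : ∀ la, P la (fun μ _ => c μ) (c la) := by
    intro la
    refine wellFounded_prec_expo.induction (C := fun la => P la (fun μ _ => c μ) (c la)) la ?_
    intro la ih
    apply hex
    set g := f - ∑ μ ∈ below la, MvPowerSeries.C (c μ) * Gfun q μ with hg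
    have hcoeff : ∀ a, MvPowerSeries.coeff a g = MvPowerSeries.coeff a f -
        ∑ μ ∈ below la, c μ * MvPowerSeries.coeff a (Gfun q μ) := by
      intro a
      rw [hg, map_sub, map_sum]
      simp only [MvPowerSeries.coeff_C_mul]
    have hgK : g ∈ K := K.sub_mem hf (K.sum_mem fun μ hμ => hA μ _ (ih μ (mem_below.1 hμ)).1)
    have hzero : ∀ μ : StrictPartition, prec μ.expo la.expo → MvPowerSeries.coeff μ.expo g = 0 := by
      intro μ hμ
      have h1 := (ih μ hμ).2
      rw [Finset.sum_attach (below μ) fun κ => c κ * MvPowerSeries.coeff μ.expo (Gfun q κ)] at h1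
      rw [hcoeff, h1, ← coeff_expo_Gfun]
      have hsub : insert μ (below μ) ⊆ below la := by
        intro κ hκ
        rcases Finset.mem_insert.1 hκ with rfl | hκ
        · exact mem_below.2 hμ
        · exact mem_below.2 ((mem_below.1 hκ).trans hμ)
      rw [← Finset.sum_subset hsub, Finset.sum_insert, add_comm, sub_self]
      · exact fun h => prec.irrefl _ (mem_below.1 h)
      · intro κ _ hκ
        rw [Finset.mem_insert, not_or, mem_below] at hκ
        by_cases h : μ.expo = κ.expo
        · exact absurd (expo_injective h).symm hκ.1
        · rw [coeff_Gfun_eq_zero h hκ.2, mul_zero]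
    obtain ⟨x, hx, hx'⟩ := lead g hgK la fun a ha =>
      coeff_eq_zero_of_forall_expo (hK g hgK) (P := fun a => prec a la.expo)
        (fun a d h h' => h.trans h') hzero ha
    refine ⟨x, hx, ?_⟩
    rw [Finset.sum_attach (below la) fun κ => c κ * MvPowerSeries.coeff la.expo (Gfun q κ), ← hx',
      hcoeff]
    ring
  refine ⟨c, fun la => (key la).1, fun a => ?_⟩
  set g := f - ∑ μ ∈ sizeLE a.degree, MvPowerSeries.C (c μ) * Gfun q μ with hg
  have hcoeff : ∀ a', MvPowerSeries.coeff a' g = MvPowerSeries.coeff a' f -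
      ∑ μ ∈ sizeLE a.degree, c μ * MvPowerSeries.coeff a' (Gfun q μ) := by
    intro a'
    rw [hg, map_sub, map_sum]
    simp only [MvPowerSeries.coeff_C_mul]
  have hgK : g ∈ K := K.sub_mem hf (K.sum_mem fun μ hμ => hA μ _ (key μ).1)
  have h0 := coeff_eq_zero_of_forall_expo (hK g hgK) (P := fun a' => a'.degree ≤ a.degree)
    (fun a d h h' => h.degree_le.trans h') (fun μ hμ => ?_) (d := a) le_rfl
  · rw [hcoeff, sub_eq_zero] at h0
    exact h0
  · have h1 := (key μ).2
    rw [Finset.sum_attach (below μ) fun κ => c κ * MvPowerSeries.coeff μ.expo (Gfun q κ)] at h1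
    rw [hcoeff, h1, ← coeff_expo_Gfun]
    rw [degree_expo] at hμ
    have hsub : insert μ (below μ) ⊆ sizeLE a.degree := by
      intro κ hκ
      rw [mem_sizeLE]
      rcases Finset.mem_insert.1 hκ with rfl | hκ
      · exact hμ
      · have := (mem_below.1 hκ).degree_le
        rw [degree_expo, degree_expo] at this
        exact this.trans hμ
    rw [← Finset.sum_subset hsub, Finset.sum_insert, add_comm, sub_self]
    · exact fun h => prec.irrefl _ (mem_below.1 h)
    · intro κ _ hκ
      rw [Finset.mem_insert, not_or, mem_below] at hκ
      by_cases h : μ.expo = κ.expo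
      · exact absurd (expo_injective h).symm hκ.1
      · rw [coeff_Gfun_eq_zero h hκ.2, mul_zero]

/-- Linear independence of the functions `GQ_λ` (if `q`) or `GP_λ`, for infinite combinations. -/
theorem eq_zero_of_forall_sum_mul_eq_zero {q : Bool} {c : StrictPartition → Polynomial ℤ}
    (h : ∀ a : ℕ →₀ ℕ, ∑ la ∈ sizeLE a.degree, MvPowerSeries.coeff a (Gfun q la) * c la = 0)
    (la : StrictPartition) : c la = 0 := by
  refine wellFounded_prec_expo.induction (C := fun la => c la = 0) la fun la ih => ?_
  have h1 := h la.expo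
  rw [Finset.sum_eq_single la] at h1
  · rw [coeff_expo_Gfun] at h1
    exact (mul_eq_zero.1 h1).resolve_left (leadCoeff_ne_zero q la)
  · intro μ _ hμ
    by_cases hp : prec μ.expo la.expo
    · rw [ih μ hp, mul_zero]
    · rw [coeff_Gfun_eq_zero (fun h => hμ (expo_injective h).symm) hp, zero_mul]
  · intro h
    exact absurd (mem_sizeLE.2 (degree_expo la).ge) h

theorem eq_zero_of_forall_sum_smul_eq_zero {q : Bool} {E : StrictPartition → Series}
    (h : ∀ a : ℕ →₀ ℕ, ∑ la ∈ sizeLE a.degree, MvPowerSeries.coeff a (Gfun q la) • E la = 0)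
    (la : StrictPartition) : E la = 0 := by
  ext1 b
  refine eq_zero_of_forall_sum_mul_eq_zero (q := q)
    (c := fun la => MvPowerSeries.coeff b (E la)) (fun a => ?_) la
  have h1 := congrArg (MvPowerSeries.coeff b) (h a)
  rw [map_sum, map_zero] at h1
  simpa only [map_smul, smul_eq_mul] using h1

/-! ### Coefficients of power series in two alphabets -/

theorem sum_antidiagonal_sumElim {M : Type*} [AddCommMonoid M] (a b : ℕ →₀ ℕ)
    (f : (ℕ ⊕ ℕ →₀ ℕ) → (ℕ ⊕ ℕ →₀ ℕ) → M) :
    ∑ e ∈ Finset.HasAntidiagonal.antidiagonal (a.sumElim b), f e.1 e.2 =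
      ∑ p ∈ Finset.HasAntidiagonal.antidiagonal a, ∑ r ∈ Finset.HasAntidiagonal.antidiagonal b,
        f (p.1.sumElim r.1) (p.2.sumElim r.2) := by
  classical
  rw [← Finsupp.image_sumElim_product_antidiagonal, Finset.sum_image, Finset.sum_product]
  rintro ⟨⟨x, y⟩, ⟨z, w⟩⟩ _ ⟨⟨x', y'⟩, ⟨z', w'⟩⟩ _ h
  simp only [Prod.mk.injEq] at h ⊢
  obtain ⟨h1, h2⟩ := h
  refine ⟨⟨?_, ?_⟩, ?_, ?_⟩
  · ext i; exact DFunLike.congr_fun h1 (Sum.inl i)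
  · ext i; exact DFunLike.congr_fun h2 (Sum.inl i)
  · ext i; exact DFunLike.congr_fun h1 (Sum.inr i)
  · ext i; exact DFunLike.congr_fun h2 (Sum.inr i)

/-- The coefficient of `y^b`, a power series in `x`. -/
def ycoeff (b : ℕ →₀ ℕ) : Series₂ →+ Series where
  toFun F := fun a => MvPowerSeries.coeff (a.sumElim b) F
  map_zero' := rfl
  map_add' _ _ := rfl

/-- The coefficient of `x^a`, a power series in `y`. -/
def xcoeff (a : ℕ →₀ ℕ) : Series₂ →+ Series where
  toFun F := fun b => MvPowerSeries.coeff (a.sumElim b) F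
  map_zero' := rfl
  map_add' _ _ := rfl

theorem coeff_ycoeff (a b : ℕ →₀ ℕ) (F : Series₂) :
    MvPowerSeries.coeff a (ycoeff b F) = MvPowerSeries.coeff (a.sumElim b) F := rfl

theorem coeff_xcoeff (a b : ℕ →₀ ℕ) (F : Series₂) :
    MvPowerSeries.coeff b (xcoeff a F) = MvPowerSeries.coeff (a.sumElim b) F := rfl

theorem ycoeff_mul (b : ℕ →₀ ℕ) (F G : Series₂) :
    ycoeff b (F * G) = ∑ r ∈ Finset.HasAntidiagonal.antidiagonal b, ycoeff r.1 F * ycoeff r.2 G := by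
  classical
  ext1 a
  rw [coeff_ycoeff, MvPowerSeries.coeff_mul, map_sum]
  simp only [MvPowerSeries.coeff_mul, coeff_ycoeff]
  rw [Finset.sum_comm]
  exact sum_antidiagonal_sumElim a b fun e e' => MvPowerSeries.coeff e F * MvPowerSeries.coeff e' G

theorem xcoeff_mul (a : ℕ →₀ ℕ) (F G : Series₂) :
    xcoeff a (F * G) = ∑ p ∈ Finset.HasAntidiagonal.antidiagonal a, xcoeff p.1 F * xcoeff p.2 G := by
  classical
  ext1 b
  rw [coeff_xcoeff, MvPowerSeries.coeff_mul, map_sum]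
  simp only [MvPowerSeries.coeff_mul, coeff_xcoeff]
  exact sum_antidiagonal_sumElim a b fun e e' => MvPowerSeries.coeff e F * MvPowerSeries.coeff e' G

theorem coeff_sumElim_inX (a b : ℕ →₀ ℕ) (f : Series) :
    MvPowerSeries.coeff (a.sumElim b) (inX f) = if b = 0 then MvPowerSeries.coeff a f else 0 := by
  split_ifs with h
  · rw [h, ← Finsupp.embDomain_inl, inX, MvPowerSeries.coeff_embDomain_rename]
  · refine MvPowerSeries.coeff_rename_eq_zero _ _ ?_
    rintro ⟨a', ha'⟩
    refine h (Finsupp.ext fun i => ?_)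
    have h1 := DFunLike.congr_fun ha' (Sum.inr i)
    rw [← Finsupp.embDomain_eq_mapDomain, Finsupp.embDomain_inl] at h1
    exact h1.symm

theorem coeff_sumElim_inY (a b : ℕ →₀ ℕ) (f : Series) :
    MvPowerSeries.coeff (a.sumElim b) (inY f) = if a = 0 then MvPowerSeries.coeff b f else 0 := by
  split_ifs with h
  · rw [h, ← Finsupp.embDomain_inr, inY, MvPowerSeries.coeff_embDomain_rename]
  · refine MvPowerSeries.coeff_rename_eq_zero _ _ ?_
    rintro ⟨a', ha'⟩
    refine h (Finsupp.ext fun i => ?_)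
    have h1 := DFunLike.congr_fun ha' (Sum.inl i)
    rw [← Finsupp.embDomain_eq_mapDomain, Finsupp.embDomain_inr] at h1
    exact h1.symm

theorem ycoeff_inX_mul (b : ℕ →₀ ℕ) (f : Series) (F : Series₂) :
    ycoeff b (inX f * F) = f * ycoeff b F := by
  classical
  rw [ycoeff_mul, Finset.sum_eq_single (0, b)]
  · congr 1
    ext1 a
    rw [coeff_ycoeff, coeff_sumElim_inX, if_pos rfl]
  · rintro ⟨r, s⟩ hr hne
    have h0 : r ≠ 0 := by
      rintro rfl
      rw [Finset.HasAntidiagonal.mem_antidiagonal, zero_add] at hr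
      exact hne (by rw [← hr])
    rw [show ycoeff r (inX f) = 0 from ?_, zero_mul]
    ext1 a
    rw [coeff_ycoeff, coeff_sumElim_inX, if_neg h0, map_zero]
  · intro h
    exact absurd (Finset.HasAntidiagonal.mem_antidiagonal.2 (zero_add b)) h

theorem xcoeff_inX_mul_inY (a : ℕ →₀ ℕ) (f g : Series) :
    xcoeff a (inX f * inY g) = MvPowerSeries.coeff a f • g := by
  classical
  rw [xcoeff_mul, Finset.sum_eq_single (a, 0)]
  · have h1 : xcoeff a (inX f) = MvPowerSeries.C (MvPowerSeries.coeff a f) := by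
      ext1 b
      rw [coeff_xcoeff, coeff_sumElim_inX, MvPowerSeries.coeff_C]
    have h2 : xcoeff 0 (inY g) = g := by
      ext1 b
      rw [coeff_xcoeff, coeff_sumElim_inY, if_pos rfl]
    rw [h1, h2, MvPowerSeries.smul_eq_C_mul]
  · rintro ⟨r, s⟩ hr hne
    have h0 : s ≠ 0 := by
      rintro rfl
      rw [Finset.HasAntidiagonal.mem_antidiagonal, add_zero] at hr
      exact hne (by rw [← hr])
    rw [show xcoeff s (inY g) = 0 from ?_, mul_zero]
    ext1 b
    rw [coeff_xcoeff, coeff_sumElim_inY, if_neg h0, map_zero]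
  · intro h
    exact absurd (Finset.HasAntidiagonal.mem_antidiagonal.2 (add_zero a)) h

theorem ycoeff_one (b : ℕ →₀ ℕ) : ycoeff b 1 = if b = 0 then 1 else 0 := by
  have h : (1 : Series₂) = inX 1 := (map_one (MvPowerSeries.rename _)).symm
  ext1 a
  rw [coeff_ycoeff, h, coeff_sumElim_inX]
  split_ifs <;> simp

/-! ### The Cauchy kernel -/

/-- The inverse of `1 + β x_i`. -/
def xinv (i : ℕ) : Series₂ := MvPowerSeries.invOfUnit (1 + MvPowerSeries.C β * xvar i) 1

/-- The inverse of `1 - x_i y_j`. -/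
def xyinv (i j : ℕ) : Series₂ := MvPowerSeries.invOfUnit (1 - xvar i * yvar j) 1

theorem mul_xinv (i : ℕ) : (1 + MvPowerSeries.C β * xvar i) * xinv i = 1 :=
  MvPowerSeries.mul_invOfUnit _ _ (by simp [xvar])

theorem mul_xyinv (i j : ℕ) : (1 - xvar i * yvar j) * xyinv i j = 1 :=
  MvPowerSeries.mul_invOfUnit _ _ (by simp [xvar, yvar])

theorem cauchyFactor_eq (i j : ℕ) :
    cauchyFactor (i, j) = (1 + xvar i * xinv i * yvar j) * xyinv i j := by
  rw [cauchyFactor, xbar, xyinv, xinv]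
  ring

/-- The quotient of `c - 1` by `x_i ⊕ x_i`, where `c` is a factor of the Cauchy kernel. -/
def cauchyQuot (i j : ℕ) : Series₂ := yvar j * xinv i * xyinv i j

theorem cauchyFactor_eq_one_add (i j : ℕ) :
    cauchyFactor (i, j) =
      1 + fgl (MvPowerSeries.C β) (xvar i) (xvar i) * cauchyQuot i j := by
  rw [cauchyFactor_eq, fgl, cauchyQuot]
  linear_combination (-xvar i * yvar j * xyinv i j) * mul_xinv i + mul_xyinv i j

/-- The product of two factors is `1` modulo `x_i ⊕ x_k`. -/
theorem cauchyFactor_mul_cauchyFactor (i k j : ℕ) :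
    cauchyFactor (i, j) * cauchyFactor (k, j) =
      1 + fgl (MvPowerSeries.C β) (xvar i) (xvar k) *
        (yvar j * (2 + MvPowerSeries.C β * (xvar i + xvar k) -
          MvPowerSeries.C β * xvar i * xvar k * yvar j) * (xinv i * xyinv i j) *
            (xinv k * xyinv k j)) := by
  have h : ∀ i, cauchyFactor (i, j) =
      (1 + MvPowerSeries.C β * xvar i + xvar i * yvar j) * (xinv i * xyinv i j) := by
    intro i
    rw [cauchyFactor_eq]
    linear_combination (-xyinv i j) * mul_xinv i
  have h' : ∀ i, ((1 + MvPowerSeries.C β * xvar i) * (1 - xvar i * yvar j)) *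
      (xinv i * xyinv i j) = 1 := by
    intro i
    linear_combination (1 - xvar i * yvar j) * xyinv i j * mul_xinv i + mul_xyinv i j
  rw [h, h, fgl]
  linear_combination (((1 + MvPowerSeries.C β * xvar k) * (1 - xvar k * yvar j)) *
      (xinv k * xyinv k j)) * h' i + h' k

theorem map_xinv {φ : Series₂ →+* Series₂} {i i' : ℕ} (hC : φ (MvPowerSeries.C β) = MvPowerSeries.C β)
    (hx : φ (xvar i) = xvar i') : φ (xinv i) = xinv i' := by
  have h := congrArg φ (mul_xinv i)
  rw [map_mul, map_add, map_mul, map_one, hC, hx] at h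
  linear_combination xinv i' * h - φ (xinv i) * mul_xinv i'

theorem map_xyinv {φ : Series₂ →+* Series₂} {i i' j j' : ℕ} (hx : φ (xvar i) = xvar i')
    (hy : φ (yvar j) = yvar j') : φ (xyinv i j) = xyinv i' j' := by
  have h := congrArg φ (mul_xyinv i j)
  rw [map_mul, map_sub, map_mul, map_one, hx, hy] at h
  linear_combination xyinv i' j' * h - φ (xyinv i j) * mul_xyinv i' j'

theorem map_cauchyFactor {φ : Series₂ →+* Series₂} {i i' j j' : ℕ}
    (hC : φ (MvPowerSeries.C β) = MvPowerSeries.C β) (hx : φ (xvar i) = xvar i')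
    (hy : φ (yvar j) = yvar j') : φ (cauchyFactor (i, j)) = cauchyFactor (i', j') := by
  rw [cauchyFactor_eq, cauchyFactor_eq, map_mul, map_add, map_mul, map_mul, map_one,
    map_xinv hC hx, map_xyinv hx hy, hx, hy]

theorem map_cauchyFactor_eq_one {φ : Series₂ →+* Series₂} {i j : ℕ}
    (h : φ (xvar i) = 0 ∨ φ (yvar j) = 0) : φ (cauchyFactor (i, j)) = 1 := by
  rw [cauchyFactor_eq_one_add, cauchyQuot, fgl]
  simp only [map_add, map_mul, map_one]
  rcases h with h | h <;> rw [h] <;> ring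

/-- The Cauchy kernel for the first `n` of the variables `x` and the first `m` of the
variables `y`. -/
def cauchyProd (n m : ℕ) : Series₂ := ∏ i ∈ Finset.range n, ∏ j ∈ Finset.range m, cauchyFactor (i, j)

/-- The variables `x_i` with `i ∈ U` and all variables `y_j`. -/
def xvarsIn (U : Set ℕ) : Set (ℕ ⊕ ℕ) := {s | ∀ i, s = Sum.inl i → i ∈ U}

theorem support_sumElim_subset_xvarsIn {U : Set ℕ} {a b : ℕ →₀ ℕ} :
    ↑(a.sumElim b).support ⊆ xvarsIn U ↔ ↑a.support ⊆ U := by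
  constructor
  · intro h i hi
    have hi' : Sum.inl i ∈ (a.sumElim b).support := by
      rw [Finsupp.mem_support_iff, Finsupp.sumElim_inl]
      simpa using hi
    exact h hi' i rfl
  · rintro h s hs i rfl
    refine h ?_
    rw [Finset.mem_coe, Finsupp.mem_support_iff, Finsupp.sumElim_inl] at hs
    simpa using hs

theorem ycoeff_restrictTo (U : Set ℕ) (b : ℕ →₀ ℕ) (F : Series₂) :
    ycoeff b (restrictTo (xvarsIn U) F) = restrictTo U (ycoeff b F) := by
  ext1 a
  by_cases h : ↑a.support ⊆ U
  · rw [coeff_restrictTo_of_subset h, coeff_ycoeff,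
      coeff_restrictTo_of_subset (support_sumElim_subset_xvarsIn.2 h), coeff_ycoeff]
  · rw [coeff_restrictTo_of_not_subset h, coeff_ycoeff,
      coeff_restrictTo_of_not_subset fun h' => h (support_sumElim_subset_xvarsIn.1 h')]

theorem restrictTo_xvarsIn_yvar (U : Set ℕ) (j : ℕ) :
    restrictTo (xvarsIn U) (yvar j) = yvar j :=
  restrictTo_X_of_mem fun i h => by simp at h

theorem restrictTo_xvarsIn_xvar {U : Set ℕ} {i : ℕ} (h : i ∈ U) :
    restrictTo (xvarsIn U) (xvar i) = xvar i :=
  restrictTo_X_of_mem fun i' h' => by rw [← Sum.inl_injective h']; exact h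

theorem restrictTo_xvarsIn_cauchyFactor {U : Set ℕ} {i : ℕ} (h : i ∈ U) (j : ℕ) :
    restrictTo (xvarsIn U) (cauchyFactor (i, j)) = cauchyFactor (i, j) :=
  map_cauchyFactor (restrictTo_C _ _) (restrictTo_xvarsIn_xvar h) (restrictTo_xvarsIn_yvar U j)

theorem restrictTo_xvarsIn_cauchyProd (n m : ℕ) :
    restrictTo (xvarsIn (firstVars n)) (cauchyProd n m) = cauchyProd n m := by
  rw [cauchyProd, map_prod]
  refine Finset.prod_congr rfl fun i hi => ?_
  rw [map_prod]
  exact Finset.prod_congr rfl fun j _ =>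
    restrictTo_xvarsIn_cauchyFactor (show i ∈ firstVars n from Finset.mem_range.1 hi) j

/-- A coefficient of `Δ` only depends on finitely many factors. -/
theorem coeff_Δ {n m : ℕ} {a b : ℕ →₀ ℕ} (ha : ∀ i ∈ a.support, i < n)
    (hb : ∀ j ∈ b.support, j < m) :
    MvPowerSeries.coeff (a.sumElim b) Δ = MvPowerSeries.coeff (a.sumElim b) (cauchyProd n m) := by
  classical
  have hΔ : HasProd cauchyFactor Δ := multipliable_cauchyFactor.hasProd
  have h1 := ((MvPowerSeries.WithPiTopology.continuous_coeff (Polynomial ℤ)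
    (a.sumElim b)).tendsto Δ).comp hΔ
  rw [nhds_discrete, Filter.tendsto_pure] at h1
  set s₀ := Finset.range n ×ˢ Finset.range m
  have h2 : ∀ᶠ s : Finset (ℕ × ℕ) in Filter.atTop, s₀ ⊆ s := Filter.eventually_ge_atTop s₀
  obtain ⟨s, hs, hs₀⟩ := (h1.and h2).exists
  simp only [Function.comp_apply] at hs
  let V : Set (ℕ ⊕ ℕ) := {t | (∀ i, t = Sum.inl i → i < n) ∧ ∀ j, t = Sum.inr j → j < m}
  have hV : ↑(a.sumElim b).support ⊆ V := by
    intro t ht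
    rw [Finset.mem_coe, Finsupp.mem_support_iff] at ht
    refine ⟨?_, ?_⟩
    · rintro i rfl
      exact ha i (by simpa using ht)
    · rintro j rfl
      exact hb j (by simpa using ht)
  have h3 : restrictTo V (∏ p ∈ s, cauchyFactor p) = cauchyProd n m := by
    rw [map_prod, cauchyProd, ← Finset.prod_product', ← Finset.prod_subset hs₀]
    · refine Finset.prod_congr rfl ?_
      rintro ⟨i, j⟩ hp
      simp only [Finset.mem_product, Finset.mem_range] at hp
      refine map_cauchyFactor (restrictTo_C _ _) (restrictTo_X_of_mem ⟨?_, ?_⟩)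
        (restrictTo_X_of_mem ⟨?_, ?_⟩)
      · intro i' h; rw [← Sum.inl_injective h]; exact hp.1
      · intro i' h; simp at h
      · intro i' h; simp at h
      · intro i' h; rw [← Sum.inr_injective h]; exact hp.2
    · rintro ⟨i, j⟩ _ hp
      simp only [s₀, Finset.mem_product, Finset.mem_range, not_and_or] at hp
      refine map_cauchyFactor_eq_one ?_
      rcases hp with hp | hp
      · exact .inl (restrictTo_X_of_notMem fun h => hp (h.1 i rfl))
      · exact .inr (restrictTo_X_of_notMem fun h => hp (h.2 j rfl))
  rw [← hs, ← h3, coeff_restrictTo_of_subset hV]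

theorem restrictTo_ycoeff_Δ (n : ℕ) {m : ℕ} {b : ℕ →₀ ℕ} (hb : ∀ j ∈ b.support, j < m) :
    restrictTo (firstVars n) (ycoeff b Δ) = ycoeff b (cauchyProd n m) := by
  ext1 a
  by_cases h : ↑a.support ⊆ firstVars n
  · rw [coeff_restrictTo_of_subset h, coeff_ycoeff, coeff_ycoeff, coeff_Δ (fun i hi => h hi) hb]
  · rw [coeff_restrictTo_of_not_subset h, ← restrictTo_xvarsIn_cauchyProd, ycoeff_restrictTo,
      coeff_restrictTo_of_not_subset h]

theorem ycoeff_fgl_mul (b : ℕ →₀ ℕ) (i k : ℕ) (F : Series₂) :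
    ycoeff b (fgl (MvPowerSeries.C β) (xvar i) (xvar k) * F) =
      fgl (MvPowerSeries.C β) (MvPowerSeries.X i) (MvPowerSeries.X k) * ycoeff b F := by
  rw [← ycoeff_inX_mul]
  congr 2
  have hC : inX (MvPowerSeries.C β) = MvPowerSeries.C β := MvPowerSeries.rename_C _ _
  have hX : ∀ i, inX (MvPowerSeries.X i) = xvar i := fun i => MvPowerSeries.rename_X _ _
  have h : inX (fgl (MvPowerSeries.C β) (MvPowerSeries.X i) (MvPowerSeries.X k)) =
      fgl (inX (MvPowerSeries.C β)) (inX (MvPowerSeries.X i)) (inX (MvPowerSeries.X k)) := by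
    simp only [inX, fgl, map_add, map_mul]
  rw [h, hC, hX, hX]

/-- The substitution `x_i ↦ x_{e i}`. -/
def mapX (e : ℕ ↪ ℕ) : Series₂ →+* Series₂ :=
  (MvPowerSeries.rename (R := Polynomial ℤ) (e.sumMap (Function.Embedding.refl ℕ))).toRingHom

theorem ycoeff_mapX (e : ℕ ↪ ℕ) (b : ℕ →₀ ℕ) (F : Series₂) :
    ycoeff b (mapX e F) = MvPowerSeries.rename e (ycoeff b F) := by
  have hmerge : ∀ d : ℕ ⊕ ℕ →₀ ℕ, ∀ a, a.sumElim b = d.embDomain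
      (e.sumMap (Function.Embedding.refl ℕ)) →
        ∃ a' : ℕ →₀ ℕ, d = a'.sumElim b ∧ a = a'.embDomain e := by
    intro d a h
    refine ⟨d.comapDomain Sum.inl Sum.inl_injective.injOn, ?_, ?_⟩
    · ext s
      rcases s with s | s
      · simp
      · have h1 := DFunLike.congr_fun h (Sum.inr s)
        have h2 := Finsupp.embDomain_apply_self (e.sumMap (Function.Embedding.refl ℕ)) d (Sum.inr s)
        exact (h1.trans h2).symm
    · ext i
      have h1 := DFunLike.congr_fun h (Sum.inl i)
      rw [Finsupp.sumElim_inl] at h1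
      rw [h1]
      by_cases hi : i ∈ Set.range e
      · obtain ⟨k, rfl⟩ := hi
        rw [Finsupp.embDomain_apply_self, Finsupp.comapDomain_apply]
        exact Finsupp.embDomain_apply_self (e.sumMap (Function.Embedding.refl ℕ)) d (Sum.inl k)
      · rw [Finsupp.embDomain_of_notMem_range _ _ _ hi, Finsupp.embDomain_of_notMem_range]
        rintro ⟨k | k, hk⟩
        · exact hi ⟨k, Sum.inl_injective hk⟩
        · exact absurd hk (by simp)
  ext1 a
  by_cases ha : ∃ a' : ℕ →₀ ℕ, a = a'.embDomain e
  · obtain ⟨a', rfl⟩ := ha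
    have h1 : (a'.embDomain e).sumElim b = (a'.sumElim b).embDomain
        (e.sumMap (Function.Embedding.refl ℕ)) := by
      ext s
      by_cases hs : s ∈ Set.range (e.sumMap (Function.Embedding.refl ℕ))
      · obtain ⟨s, rfl⟩ := hs
        rw [Finsupp.embDomain_apply_self]
        rcases s with s | s
        · exact Finsupp.embDomain_apply_self e a' s
        · rfl
      · rw [Finsupp.embDomain_of_notMem_range _ _ _ hs]
        rcases s with s | s
        · refine Finsupp.embDomain_of_notMem_range e a' s ?_
          rintro ⟨k, rfl⟩
          exact hs ⟨Sum.inl k, rfl⟩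
        · exact absurd ⟨Sum.inr s, rfl⟩ hs
    rw [MvPowerSeries.coeff_embDomain_rename, coeff_ycoeff, coeff_ycoeff, h1]
    exact MvPowerSeries.coeff_embDomain_rename _ _ _
  · rw [MvPowerSeries.coeff_rename_eq_zero, coeff_ycoeff]
    · refine MvPowerSeries.coeff_rename_eq_zero _ _ ?_
      rintro ⟨d, hd⟩
      rw [← Finsupp.embDomain_eq_mapDomain] at hd
      obtain ⟨a', -, h⟩ := hmerge d a hd.symm
      exact ha ⟨a', h⟩
    · rintro ⟨d, hd⟩
      exact ha ⟨d, by rw [← hd, Finsupp.embDomain_eq_mapDomain]⟩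

theorem mapX_cauchyFactor (e : ℕ ↪ ℕ) (i j : ℕ) :
    mapX e (cauchyFactor (i, j)) = cauchyFactor (e i, j) := by
  refine map_cauchyFactor (φ := mapX e) ?_ ?_ ?_
  · exact MvPowerSeries.rename_C _ _
  · exact MvPowerSeries.rename_X _ _
  · exact MvPowerSeries.rename_X _ _

theorem mapX_swap_cauchyProd {n i : ℕ} (hi : i + 1 < n) (m : ℕ) :
    mapX (Equiv.swap i (i + 1)).toEmbedding (cauchyProd n m) = cauchyProd n m := by
  rw [cauchyProd, map_prod]
  refine Finset.prod_equiv (Equiv.swap i (i + 1)) (fun k => ?_) fun k _ => ?_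
  · rw [Finset.mem_range, Finset.mem_range, Equiv.swap_apply_def]
    split_ifs <;> omega
  · rw [map_prod]
    exact Finset.prod_congr rfl fun j _ => mapX_cauchyFactor _ k j

theorem dvd_ycoeff_mul_sub {U : Set ℕ} {w : Series} {F G : Series₂}
    (hF : ∀ b, w ∣ ycoeff b F - restrictTo U (ycoeff b F))
    (hG : ∀ b, w ∣ ycoeff b G - restrictTo U (ycoeff b G)) (b : ℕ →₀ ℕ) :
    w ∣ ycoeff b (F * G) - restrictTo U (ycoeff b (F * G)) := by
  rw [ycoeff_mul, map_sum, ← Finset.sum_sub_distrib]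
  refine Finset.dvd_sum fun r _ => ?_
  have h1 := hF r.1
  have h2 := hG r.2
  generalize ycoeff r.1 F = f at h1 ⊢
  generalize ycoeff r.2 G = g at h2 ⊢
  exact dvd_sub_map_mul _ h1 h2

theorem ycoeff_Δ_mem_cancellationRing (b : ℕ →₀ ℕ) : ycoeff b Δ ∈ cancellationRing := by
  intro n i hi
  obtain ⟨m, hm⟩ := exists_forall_mem_support_lt b
  rw [restrictTo_ycoeff_Δ n hm]
  refine ⟨?_, ?_⟩
  · conv_rhs => rw [← mapX_swap_cauchyProd hi m, ycoeff_mapX]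
    rfl
  set U := firstVarsExcept n i
  set w : Series := fgl (MvPowerSeries.C β) (MvPowerSeries.X i) (MvPowerSeries.X (i + 1)) with hw
  have hmul : ∀ F G : Series₂, (∀ b, w ∣ ycoeff b F - restrictTo U (ycoeff b F)) →
      (∀ b, w ∣ ycoeff b G - restrictTo U (ycoeff b G)) →
      ∀ b, w ∣ ycoeff b (F * G) - restrictTo U (ycoeff b (F * G)) :=
    fun F G hF hG => dvd_ycoeff_mul_sub hF hG
  have hone : ∀ b, w ∣ ycoeff b 1 - restrictTo U (ycoeff b 1) := by
    intro b
    rw [ycoeff_one]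
    split_ifs <;> simp
  have hwU : restrictTo U w = 0 := by
    have h1 : restrictTo U (MvPowerSeries.X i : Series) = 0 :=
      restrictTo_X_of_notMem fun h => h.2.1 rfl
    have h2 : restrictTo U (MvPowerSeries.X (i + 1) : Series) = 0 :=
      restrictTo_X_of_notMem fun h => h.2.2 rfl
    rw [hw, fgl]
    simp only [map_add, map_mul, h1, h2]
    ring
  suffices h : ∀ b, w ∣ ycoeff b (cauchyProd n m) - restrictTo U (ycoeff b (cauchyProd n m)) from
    h b
  rw [cauchyProd, Finset.prod_comm]
  refine Finset.prod_induction _ (fun F => ∀ b, w ∣ ycoeff b F - restrictTo U (ycoeff b F)) hmul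
    hone fun j _ => ?_
  have hi1 : i ∈ Finset.range n := Finset.mem_range.2 (by omega)
  have hi2 : i + 1 ∈ (Finset.range n).erase i := by simp; omega
  rw [← Finset.mul_prod_erase _ _ hi1, ← Finset.mul_prod_erase _ _ hi2, ← mul_assoc]
  refine hmul _ _ (fun b => ?_) (Finset.prod_induction _
    (fun F => ∀ b, w ∣ ycoeff b F - restrictTo U (ycoeff b F)) hmul hone fun k hk b => ?_)
  · rw [cauchyFactor_mul_cauchyFactor, map_add, ycoeff_fgl_mul, ← hw, map_add (restrictTo U), map_mul (restrictTo U), hwU, zero_mul,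
      add_zero, add_sub_right_comm]
    exact dvd_add (hone b) (dvd_mul_right _ _)
  · rw [← ycoeff_restrictTo, restrictTo_xvarsIn_cauchyFactor, sub_self]
    · exact dvd_zero _
    · simp only [Finset.mem_erase, Finset.mem_range] at hk
      exact ⟨hk.2.2, hk.2.1, hk.1⟩

theorem ycoeff_Δ_mem_doubleRing (b : ℕ →₀ ℕ) : ycoeff b Δ ∈ doubleRing := by
  intro n
  obtain ⟨m, hm⟩ := exists_forall_mem_support_lt b
  rw [restrictTo_ycoeff_Δ n hm]
  set K := Subring.closure (doubleTerms : Set Series)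
  have hmul : ∀ F G : Series₂, (∀ b, ycoeff b F ∈ K) → (∀ b, ycoeff b G ∈ K) →
      ∀ b, ycoeff b (F * G) ∈ K := by
    intro F G hF hG b
    rw [ycoeff_mul]
    exact sum_mem fun r _ => mul_mem (hF _) (hG _)
  have hone : ∀ b, ycoeff b 1 ∈ K := by
    intro b
    rw [ycoeff_one]
    split_ifs
    · exact one_mem _
    · exact zero_mem _
  suffices h : ∀ b, ycoeff b (cauchyProd n m) ∈ K from h b
  refine Finset.prod_induction _ (fun F => ∀ b, ycoeff b F ∈ K) hmul hone fun i _ =>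
    Finset.prod_induction _ (fun F => ∀ b, ycoeff b F ∈ K) hmul hone fun j _ b => ?_
  rw [cauchyFactor_eq_one_add, map_add, ycoeff_fgl_mul]
  refine add_mem (hone b) (Subring.subset_closure ⟨{i}, ycoeff b (cauchyQuot i j), ?_, ?_⟩)
  · have hx := restrictTo_xvarsIn_xvar (U := (({i} : Finset ℕ) : Set ℕ)) (i := i) (by simp)
    rw [← ycoeff_restrictTo, cauchyQuot, map_mul (restrictTo _), map_mul (restrictTo _),
      restrictTo_xvarsIn_yvar,
      map_xinv (restrictTo_C _ _) hx, map_xyinv hx (restrictTo_xvarsIn_yvar _ _)]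
  · rw [doubleProd, Finset.prod_singleton]

theorem ycoeff_Δ_mem_Gring (q : Bool) (b : ℕ →₀ ℕ) : ycoeff b Δ ∈ Gring q := by
  cases q
  · exact ycoeff_Δ_mem_cancellationRing b
  · exact ⟨ycoeff_Δ_mem_cancellationRing b, ycoeff_Δ_mem_doubleRing b⟩

/-! ### Splitting the alphabet: the coproduct -/

/-- The exponent vector of `x_0^{z_0} ⋯ x_{n-1}^{z_{n-1}} x_n^{a_0} x_{n+1}^{a_1} ⋯`, if the support
of `z` is contained in `{0, …, n-1}`. -/
def splice (n : ℕ) (z a : ℕ →₀ ℕ) : ℕ →₀ ℕ := z + a.embDomain (addLeftEmbedding n)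

theorem splice_apply_of_lt {n i : ℕ} (h : i < n) (z a : ℕ →₀ ℕ) : splice n z a i = z i := by
  rw [splice, Finsupp.add_apply, Finsupp.embDomain_of_notMem_range, add_zero]
  rintro ⟨k, hk⟩
  simp only [addLeftEmbedding_apply] at hk
  omega

theorem splice_apply_add {n : ℕ} {z : ℕ →₀ ℕ} (hz : ∀ i ∈ z.support, i < n) (a : ℕ →₀ ℕ) (i : ℕ) :
    splice n z a (n + i) = a i := by
  have h1 : z (n + i) = 0 := by
    by_contra h
    have := hz _ (Finsupp.mem_support_iff.2 h)
    omega
  have h2 := Finsupp.embDomain_apply_self (addLeftEmbedding n) a i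
  rw [addLeftEmbedding_apply] at h2
  rw [splice, Finsupp.add_apply, h1, h2, zero_add]

theorem degree_splice (n : ℕ) (z a : ℕ →₀ ℕ) : (splice n z a).degree = z.degree + a.degree := by
  rw [splice, map_add, Finsupp.embDomain_eq_mapDomain, Finsupp.degree_mapDomain]

theorem splice_add (n : ℕ) (z z' a a' : ℕ →₀ ℕ) :
    splice n z a + splice n z' a' = splice n (z + z') (a + a') := by
  rw [splice, splice, splice, Finsupp.embDomain_add]
  exact add_add_add_comm _ _ _ _

theorem splice_filter_comapDomain (n : ℕ) (u : ℕ →₀ ℕ) :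
    splice n (u.filter (· < n))
      (u.comapDomain (addLeftEmbedding n) (addLeftEmbedding n).injective.injOn) = u := by
  classical
  ext i
  by_cases hi : i < n
  · rw [splice_apply_of_lt hi, Finsupp.filter_apply_pos (· < n) _ hi]
  · obtain ⟨k, rfl⟩ : ∃ k, i = n + k := ⟨i - n, by omega⟩
    rw [splice_apply_add, Finsupp.comapDomain_apply, addLeftEmbedding_apply]
    intro i hi
    rw [Finsupp.support_filter, Finset.mem_filter] at hi
    exact hi.2

theorem splice_inj {n : ℕ} {z z' a a' : ℕ →₀ ℕ} (hz : ∀ i ∈ z.support, i < n)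
    (hz' : ∀ i ∈ z'.support, i < n) (h : splice n z a = splice n z' a') : z = z' ∧ a = a' := by
  constructor
  · ext i
    by_cases hi : i < n
    · rw [← splice_apply_of_lt hi z a, h, splice_apply_of_lt hi]
    · rw [Finsupp.notMem_support_iff.1 fun h => hi (hz i h),
        Finsupp.notMem_support_iff.1 fun h => hi (hz' i h)]
  · ext i
    rw [← splice_apply_add hz a i, h, splice_apply_add hz']

theorem forall_mem_support_lt_of_antidiagonal {n : ℕ} {z : ℕ →₀ ℕ} (hz : ∀ i ∈ z.support, i < n)
    {p : (ℕ →₀ ℕ) × (ℕ →₀ ℕ)} (hp : p ∈ Finset.HasAntidiagonal.antidiagonal z) :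
    (∀ i ∈ p.1.support, i < n) ∧ ∀ i ∈ p.2.support, i < n := by
  rw [Finset.HasAntidiagonal.mem_antidiagonal] at hp
  subst hp
  constructor <;> intro i hi <;> refine hz i ?_ <;>
    simp only [Finsupp.mem_support_iff, Finsupp.add_apply] at hi ⊢ <;> omega

theorem sum_antidiagonal_splice {M : Type*} [AddCommMonoid M] {n : ℕ} {z : ℕ →₀ ℕ}
    (hz : ∀ i ∈ z.support, i < n) (a : ℕ →₀ ℕ) (f : (ℕ →₀ ℕ) → (ℕ →₀ ℕ) → M) :
    ∑ e ∈ Finset.HasAntidiagonal.antidiagonal (splice n z a), f e.1 e.2 =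
      ∑ p ∈ Finset.HasAntidiagonal.antidiagonal z, ∑ r ∈ Finset.HasAntidiagonal.antidiagonal a,
        f (splice n p.1 r.1) (splice n p.2 r.2) := by
  classical
  rw [← Finset.sum_product']
  symm
  refine Finset.sum_nbij (fun p => (splice n p.1.1 p.2.1, splice n p.1.2 p.2.2)) ?_ ?_ ?_
    fun _ _ => rfl
  · rintro ⟨p, r⟩ h
    rw [Finset.mem_product, Finset.HasAntidiagonal.mem_antidiagonal,
      Finset.HasAntidiagonal.mem_antidiagonal] at h
    rw [Finset.HasAntidiagonal.mem_antidiagonal, splice_add, h.1, h.2]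
  · rintro ⟨p, r⟩ h ⟨p', r'⟩ h' he
    rw [Finset.mem_coe, Finset.mem_product] at h h'
    obtain ⟨h1, h2⟩ := forall_mem_support_lt_of_antidiagonal hz h.1
    obtain ⟨h3, h4⟩ := forall_mem_support_lt_of_antidiagonal hz h'.1
    obtain ⟨e1, e2⟩ := Prod.mk.inj he
    obtain ⟨e3, e4⟩ := splice_inj h1 h3 e1
    obtain ⟨e5, e6⟩ := splice_inj h2 h4 e2
    exact Prod.ext (Prod.ext e3 e5) (Prod.ext e4 e6)
  · rintro ⟨u, v⟩ h
    rw [Finset.mem_coe, Finset.HasAntidiagonal.mem_antidiagonal] at h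
    refine ⟨((u.filter (· < n), v.filter (· < n)),
      (u.comapDomain (addLeftEmbedding n) (addLeftEmbedding n).injective.injOn,
       v.comapDomain (addLeftEmbedding n) (addLeftEmbedding n).injective.injOn)), ?_, ?_⟩
    · rw [← splice_filter_comapDomain n u, ← splice_filter_comapDomain n v, splice_add] at h
      have hlt : ∀ i ∈ (u.filter (· < n) + v.filter (· < n)).support, i < n := by
        intro i hi
        by_contra hc
        rw [Finsupp.mem_support_iff, Finsupp.add_apply, Finsupp.filter_apply_neg (· < n) _ hc,
          Finsupp.filter_apply_neg (· < n) _ hc] at hi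
        exact hi rfl
      obtain ⟨h1, h2⟩ := splice_inj hlt hz h
      rw [Finset.mem_coe, Finset.mem_product, Finset.HasAntidiagonal.mem_antidiagonal,
        Finset.HasAntidiagonal.mem_antidiagonal]
      exact ⟨h1, h2⟩
    · simp only [splice_filter_comapDomain]

theorem coeff_splice_mul {n : ℕ} {z : ℕ →₀ ℕ} (hz : ∀ i ∈ z.support, i < n) (a : ℕ →₀ ℕ)
    {f : Series} (hf : restrictTo (firstVars n) f = f) (g : Series) :
    MvPowerSeries.coeff (splice n z a) (f * MvPowerSeries.rename (addLeftEmbedding n) g) =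
      MvPowerSeries.coeff z f * MvPowerSeries.coeff a g := by
  classical
  have hsplice : ∀ z, splice n z 0 = z := by
    intro z
    rw [splice, Finsupp.embDomain_zero, add_zero]
  have h1 : ∀ p r : ℕ →₀ ℕ, (∀ i ∈ p.support, i < n) → r ≠ 0 →
      MvPowerSeries.coeff (splice n p r) f = 0 := by
    intro p r hp hr
    refine coeff_eq_zero_of_restrictTo_eq hf fun hsub => hr (Finsupp.ext fun i => ?_)
    by_contra hne
    rw [← splice_apply_add hp r i] at hne
    have : n + i < n := hsub (Finsupp.mem_support_iff.2 hne)
    omega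
  have h2 : ∀ p r : ℕ →₀ ℕ, (∀ i ∈ p.support, i < n) → p ≠ 0 →
      MvPowerSeries.coeff (splice n p r) (MvPowerSeries.rename (addLeftEmbedding n) g) = 0 := by
    intro p r hp hp0
    refine MvPowerSeries.coeff_rename_eq_zero _ _ ?_
    rintro ⟨d, hd⟩
    refine hp0 (Finsupp.ext fun i => ?_)
    by_cases hi : i < n
    · rw [← splice_apply_of_lt hi p r, ← hd, ← Finsupp.embDomain_eq_mapDomain,
        Finsupp.embDomain_of_notMem_range]
      · rfl
      · rintro ⟨k, hk⟩
        simp only [addLeftEmbedding_apply] at hk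
        omega
    · exact Finsupp.notMem_support_iff.1 fun h => hi (hp i h)
  have h3 : MvPowerSeries.coeff (splice n 0 a) (MvPowerSeries.rename (addLeftEmbedding n) g) =
      MvPowerSeries.coeff a g := by
    rw [splice, zero_add, MvPowerSeries.coeff_embDomain_rename]
  rw [MvPowerSeries.coeff_mul, sum_antidiagonal_splice hz a fun e e' => MvPowerSeries.coeff e f *
    MvPowerSeries.coeff e' (MvPowerSeries.rename (addLeftEmbedding n) g)]
  rw [Finset.sum_eq_single (z, 0), Finset.sum_eq_single (0, a), hsplice, h3]
  · rintro ⟨r, s⟩ hr hne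
    have hr0 : r ≠ 0 := by
      rintro rfl
      rw [Finset.HasAntidiagonal.mem_antidiagonal, zero_add] at hr
      exact hne (by rw [← hr])
    rw [h1 _ _ hz hr0, zero_mul]
  · intro h
    exact absurd (Finset.HasAntidiagonal.mem_antidiagonal.2 (zero_add a)) h
  · rintro ⟨p, s⟩ hp hne
    have hs0 : s ≠ 0 := by
      rintro rfl
      rw [Finset.HasAntidiagonal.mem_antidiagonal, add_zero] at hp
      exact hne (by rw [← hp])
    refine Finset.sum_eq_zero fun r _ => ?_
    rw [h2 _ _ (forall_mem_support_lt_of_antidiagonal hz hp).2 hs0, mul_zero]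
  · intro h
    exact absurd (Finset.HasAntidiagonal.mem_antidiagonal.2 (add_zero z)) h

theorem support_splice_lt {n m : ℕ} {z a : ℕ →₀ ℕ} (hz : ∀ i ∈ z.support, i < n)
    (ha : ∀ i ∈ a.support, i < m) : ∀ i ∈ (splice n z a).support, i < n + m := by
  intro i hi
  by_cases h : i < n
  · omega
  · obtain ⟨k, rfl⟩ : ∃ k, i = n + k := ⟨i - n, by omega⟩
    rw [Finsupp.mem_support_iff, splice_apply_add hz] at hi
    have := ha k (Finsupp.mem_support_iff.2 hi)
    omega

/-- The expansion of `G_λ` in two sets of variables. -/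
theorem coeff_splice_Gfun {q : Bool} {n : ℕ} {z : ℕ →₀ ℕ} (hz : ∀ i ∈ z.support, i < n)
    (a : ℕ →₀ ℕ) (la : StrictPartition) :
    MvPowerSeries.coeff (splice n z a) (Gfun q la) = ∑ κ ∈ la.lower,
      MvPowerSeries.coeff z (Gfun q κ) * MvPowerSeries.coeff a (Gsskew q la κ) := by
  obtain ⟨m, hm⟩ := exists_forall_mem_support_lt a
  rw [← Gsskew_empty, coeff_Gsskew (N := la.part 0) (by omega) (support_splice_lt hz hm),
    matCoeff_add, map_sum]
  refine Finset.sum_congr rfl fun κ hκ => ?_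
  have hsub := mem_lower.1 hκ
  have h1 : matCoeff (MvPowerSeries.C β : Series) q (la.part 0)
      (fun i => (MvPowerSeries.X (n + i) : Series)) m la κ =
      MvPowerSeries.rename (addLeftEmbedding n)
        (matCoeff (MvPowerSeries.C β : Series) q (la.part 0) MvPowerSeries.X m la κ) := by
    have h2 := matCoeff_map (MvPowerSeries.rename (R := Polynomial ℤ)
      (addLeftEmbedding n)).toRingHom (b := (MvPowerSeries.C β : Series)) (q := q)
      (N := la.part 0) (n := m) (MvPowerSeries.X : ℕ → Series) la κ
    refine Eq.trans ?_ h2.symm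
    have h3 : (MvPowerSeries.rename (R := Polynomial ℤ) (addLeftEmbedding n)).toRingHom
        (MvPowerSeries.C β) = MvPowerSeries.C β := MvPowerSeries.rename_C _ _
    rw [h3]
    congr 1
    funext i
    have h4 := MvPowerSeries.rename_X (R := Polynomial ℤ) (⇑(addLeftEmbedding n)) i
    rw [addLeftEmbedding_apply] at h4
    exact h4.symm
  rw [h1, coeff_splice_mul hz a (restrictTo_matCoeff_of_subset (fun i hi => hi) κ _),
    ← coeff_Gsskew (N := la.part 0) (by omega) hm,
    ← coeff_Gsskew (N := la.part 0) (by have := hsub 0; omega) hz, Gsskew_empty]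

theorem cauchyProd_add (n k m : ℕ) :
    cauchyProd (n + k) m = cauchyProd n m * mapX (addLeftEmbedding n) (cauchyProd k m) := by
  have h : mapX (addLeftEmbedding n) (cauchyProd k m) =
      ∏ i ∈ Finset.range k, ∏ j ∈ Finset.range m, cauchyFactor (n + i, j) := by
    rw [cauchyProd, map_prod]
    refine Finset.prod_congr rfl fun i _ => ?_
    rw [map_prod]
    refine Finset.prod_congr rfl fun j _ => ?_
    rw [mapX_cauchyFactor, addLeftEmbedding_apply]
  rw [h, cauchyProd, Finset.prod_range_add, cauchyProd]

theorem xcoeff_splice_Δ {n : ℕ} {z : ℕ →₀ ℕ} (hz : ∀ i ∈ z.support, i < n) (a : ℕ →₀ ℕ) :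
    xcoeff (splice n z a) Δ = xcoeff z Δ * xcoeff a Δ := by
  classical
  ext1 b
  obtain ⟨k, hk⟩ := exists_forall_mem_support_lt a
  obtain ⟨m, hm⟩ := exists_forall_mem_support_lt b
  rw [coeff_xcoeff, coeff_Δ (support_splice_lt hz hk) hm, ← coeff_ycoeff, cauchyProd_add,
    ycoeff_mul, map_sum, MvPowerSeries.coeff_mul]
  refine Finset.sum_congr rfl fun r hr => ?_
  obtain ⟨h1, h2⟩ := forall_mem_support_lt_of_antidiagonal hm hr
  rw [ycoeff_mapX, coeff_splice_mul hz, coeff_ycoeff, coeff_ycoeff, coeff_xcoeff, coeff_xcoeff,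
    coeff_Δ hz h1, coeff_Δ hk h2]
  rw [← ycoeff_restrictTo, restrictTo_xvarsIn_cauchyProd]

/-! ### Dual families and structure constants -/

theorem hasSum_iff_of_forall_notMem {ι R : Type*} [AddCommMonoid R] [TopologicalSpace R] [T2Space R]
    {f : ι → R} {s : Finset ι} (hs : ∀ i ∉ s, f i = 0) {t : R} : HasSum f t ↔ t = ∑ i ∈ s, f i := by
  have h : HasSum f (∑ i ∈ s, f i) := hasSum_sum_of_ne_finset_zero hs
  exact ⟨fun h' => h'.unique h, fun h' => h' ▸ h⟩

theorem hasSum_series_iff {F : StrictPartition → Series} {T : Series}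
    {s : (ℕ →₀ ℕ) → Finset StrictPartition}
    (hs : ∀ a, ∀ la ∉ s a, MvPowerSeries.coeff a (F la) = 0) :
    HasSum F T ↔ ∀ a, MvPowerSeries.coeff a T = ∑ la ∈ s a, MvPowerSeries.coeff a (F la) := by
  rw [MvPowerSeries.WithPiTopology.hasSum_iff_hasSum_coeff]
  exact forall_congr' fun a => hasSum_iff_of_forall_notMem (hs a)

theorem hasSum_series₂_iff {F : StrictPartition → Series₂} {T : Series₂}
    {s : (ℕ →₀ ℕ) → Finset StrictPartition} (hs : ∀ a, ∀ la ∉ s a, xcoeff a (F la) = 0) :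
    HasSum F T ↔ ∀ a, xcoeff a T = ∑ la ∈ s a, xcoeff a (F la) := by
  have hs' : ∀ a b, ∀ la ∉ s a, MvPowerSeries.coeff (a.sumElim b) (F la) = 0 := by
    intro a b la hla
    rw [← coeff_xcoeff, hs a la hla, map_zero]
  rw [MvPowerSeries.WithPiTopology.hasSum_iff_hasSum_coeff]
  constructor
  · intro h a
    ext1 b
    rw [coeff_xcoeff, map_sum]
    exact (hasSum_iff_of_forall_notMem (hs' a b)).1 (h (a.sumElim b))
  · intro h e
    have he := Finsupp.comapDomain_sumElim_comapDomain e
    rw [← he, hasSum_iff_of_forall_notMem (hs' _ _), ← coeff_xcoeff, h, map_sum]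
    rfl

theorem coeff_Gfun_eq_zero_of_notMem {q : Bool} {a : ℕ →₀ ℕ} {la : StrictPartition}
    (h : la ∉ sizeLE a.degree) : MvPowerSeries.coeff a (Gfun q la) = 0 := by
  by_contra hne
  exact h (mem_sizeLE.2 (size_le_of_coeff_Gfun_ne_zero hne))

theorem isDualFamily_iff {q : Bool} {g : StrictPartition → Series} :
    IsDualFamily (Gfun q) g ↔ ∀ a : ℕ →₀ ℕ,
      xcoeff a Δ = ∑ la ∈ sizeLE a.degree, MvPowerSeries.coeff a (Gfun q la) • g la := by
  rw [IsDualFamily, hasSum_series₂_iff (s := fun a => sizeLE a.degree)]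
  · simp only [xcoeff_inX_mul_inY]
  · intro a la h
    rw [xcoeff_inX_mul_inY, coeff_Gfun_eq_zero_of_notMem h, zero_smul]

theorem exists_isDualFamily (q : Bool) : ∃ g, IsDualFamily (Gfun q) g := by
  have h : ∀ b, ∃ c : StrictPartition → Polynomial ℤ, ∀ a, MvPowerSeries.coeff a (ycoeff b Δ) =
      ∑ la ∈ sizeLE a.degree, c la * MvPowerSeries.coeff a (Gfun q la) := by
    intro b
    obtain ⟨c, -, hc⟩ := exists_expansion (q := q) (K := (Gring q).toAddSubgroup)
      (A := fun _ => Set.univ) (fun f hf => Gring_le_cancellationRing q hf)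
      (fun f hf la h => by
        obtain ⟨c, hc⟩ := leadCoeff_dvd (q := q) hf h
        exact ⟨c, trivial, hc.trans (mul_comm _ _)⟩)
      (fun la c _ => (Gring q).mul_mem (C_mem_Gring q c) (Gfun_mem_Gring q la))
      (ycoeff_Δ_mem_Gring q b)
    exact ⟨c, hc⟩
  choose c hc using h
  let g : StrictPartition → Series := fun la b => c b la
  refine ⟨g, isDualFamily_iff.2 fun a => ?_⟩
  ext1 b
  rw [coeff_xcoeff, ← coeff_ycoeff, hc, map_sum]
  refine Finset.sum_congr rfl fun la _ => ?_
  have h1 : MvPowerSeries.coeff b (g la) = c b la := rfl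
  rw [map_smul, smul_eq_mul, h1, mul_comm]

theorem existsUnique_isDualFamily (q : Bool) : ∃! g, IsDualFamily (Gfun q) g := by
  obtain ⟨g, hg⟩ := exists_isDualFamily q
  refine ⟨g, hg, fun g' hg' => ?_⟩
  rw [isDualFamily_iff] at hg hg'
  funext la
  rw [← sub_eq_zero]
  refine eq_zero_of_forall_sum_smul_eq_zero (q := q) (E := fun la => g' la - g la) (fun a => ?_) la
  simp only [smul_sub]
  rw [Finset.sum_sub_distrib, ← hg, ← hg', sub_self]

theorem isDualFamily_dualFamily (q : Bool) : IsDualFamily (Gfun q) (dualFamily (Gfun q)) :=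
  Classical.epsilon_spec (exists_isDualFamily q)

theorem xcoeff_Δ_eq (q : Bool) {a : ℕ →₀ ℕ} {M : ℕ} (hM : a.degree ≤ M) :
    xcoeff a Δ =
      ∑ la ∈ sizeLE M, MvPowerSeries.coeff a (Gfun q la) • dualFamily (Gfun q) la := by
  rw [isDualFamily_iff.1 (isDualFamily_dualFamily q) a]
  refine Finset.sum_subset (fun la h => ?_) fun la _ h => ?_
  · rw [mem_sizeLE] at h ⊢
    exact h.trans hM
  · rw [coeff_Gfun_eq_zero_of_notMem h, zero_smul]

theorem isProductExpansion_iff {q : Bool} {μ ν : StrictPartition} {c : StrictPartition → ℤ} :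
    IsProductExpansion (Gfun q) μ ν c ↔ (∀ la, la.size < μ.size + ν.size → c la = 0) ∧
      ∀ a : ℕ →₀ ℕ, MvPowerSeries.coeff a (Gfun q μ * Gfun q ν) = ∑ la ∈ sizeLE a.degree,
        Polynomial.C (c la) * β ^ (la.size - (μ.size + ν.size)) *
          MvPowerSeries.coeff a (Gfun q la) := by
  rw [IsProductExpansion, hasSum_series_iff (s := fun a => sizeLE a.degree)]
  · simp only [MvPowerSeries.coeff_C_mul]
  · intro a la h
    rw [MvPowerSeries.coeff_C_mul, coeff_Gfun_eq_zero_of_notMem h, mul_zero]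

theorem leadCoeff_eq_C (q : Bool) (la : StrictPartition) :
    ∃ m : ℤ, m ≠ 0 ∧ leadCoeff q la = Polynomial.C m := by
  cases q
  · exact ⟨1, one_ne_zero, by simp [leadCoeff]⟩
  · exact ⟨2 ^ la.expo.support.card, by positivity, by simp [leadCoeff]⟩

/-- Homogeneity makes the coefficients integers times powers of `β`. -/
theorem exists_isProductExpansion (q : Bool) (μ ν : StrictPartition) :
    ∃ c, IsProductExpansion (Gfun q) μ ν c := by
  set D := μ.size + ν.size
  obtain ⟨c, hcA, hc⟩ := exists_expansion (q := q)
    (K := (Gring q).toAddSubgroup ⊓ homogeneous D)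
    (A := fun la => {x | ∀ j, x.coeff j ≠ 0 → j + D = la.size})
    (fun f hf => Gring_le_cancellationRing q hf.1)
    (fun f hf la h => by
      obtain ⟨c, hc⟩ := leadCoeff_dvd (q := q) hf.1 h
      obtain ⟨m, hm, hm'⟩ := leadCoeff_eq_C q la
      refine ⟨c, fun j hj => ?_, hc.trans (mul_comm _ _)⟩
      rw [← degree_expo]
      refine hf.2 _ j ?_
      rw [hc, hm', Polynomial.coeff_C_mul]
      exact mul_ne_zero hm hj)
    (fun la c hc => by
      refine ⟨(Gring q).mul_mem (C_mem_Gring q c) (Gfun_mem_Gring q la), fun a j hj => ?_⟩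
      rw [MvPowerSeries.coeff_C_mul, Polynomial.coeff_mul] at hj
      obtain ⟨⟨j1, j2⟩, hj', hne⟩ := Finset.exists_ne_zero_of_sum_ne_zero hj
      rw [Finset.HasAntidiagonal.mem_antidiagonal] at hj'
      have h1 := hc j1 (left_ne_zero_of_mul hne)
      have h2 := Gfun_mem_homogeneous q la a j2 (right_ne_zero_of_mul hne)
      simp only at hj'
      omega)
    (f := Gfun q μ * Gfun q ν)
    ⟨(Gring q).mul_mem (Gfun_mem_Gring q μ) (Gfun_mem_Gring q ν),
      mul_mem_homogeneous (Gfun_mem_homogeneous q μ) (Gfun_mem_homogeneous q ν)⟩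
  refine ⟨fun la => if la.size < D then 0 else (c la).coeff (la.size - D),
    isProductExpansion_iff.2 ⟨fun la h => if_pos h, fun a => ?_⟩⟩
  rw [hc]
  refine Finset.sum_congr rfl fun la _ => ?_
  congr 1
  ext j
  rw [Polynomial.coeff_C_mul, β, Polynomial.coeff_X_pow]
  by_cases hj : (c la).coeff j = 0
  · rw [hj]
    by_cases h1 : j = la.size - D
    · rw [← h1, hj, ite_self, zero_mul]
    · rw [if_neg h1, mul_zero]
  · have := hcA la j hj
    rw [if_neg (by omega), if_pos (by omega), mul_one]
    congr 1
    omega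

theorem existsUnique_isProductExpansion (q : Bool) (μ ν : StrictPartition) :
    ∃! c, IsProductExpansion (Gfun q) μ ν c := by
  obtain ⟨c, hc⟩ := exists_isProductExpansion q μ ν
  refine ⟨c, hc, fun c' hc' => ?_⟩
  rw [isProductExpansion_iff] at hc hc'
  funext la
  by_cases hla : la.size < μ.size + ν.size
  · rw [hc.1 la hla, hc'.1 la hla]
  set w : StrictPartition → ℕ := fun la => la.size - (μ.size + ν.size)
  have hzero : ∀ a : ℕ →₀ ℕ, ∑ la ∈ sizeLE a.degree, MvPowerSeries.coeff a (Gfun q la) *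
      (Polynomial.C (c' la) * β ^ w la - Polynomial.C (c la) * β ^ w la) = 0 := by
    intro a
    have h1 := hc.2 a
    rw [hc'.2 a, ← sub_eq_zero, ← Finset.sum_sub_distrib] at h1
    rw [← h1]
    exact Finset.sum_congr rfl fun la _ => by ring
  have h := eq_zero_of_forall_sum_mul_eq_zero (q := q) hzero la
  rw [sub_eq_zero] at h
  simpa [β, Polynomial.coeff_C_mul] using congrArg (fun p => Polynomial.coeff p (w la)) h

theorem isProductExpansion_structureCoeff (q : Bool) (μ ν : StrictPartition) :
    IsProductExpansion (Gfun q) μ ν (structureCoeff (Gfun q) μ ν) :=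
  Classical.epsilon_spec (exists_isProductExpansion q μ ν)

/-- The coefficient of `G_λ` in the product `G_μ G_ν`. -/
def structurePoly (q : Bool) (la μ ν : StrictPartition) : Polynomial ℤ :=
  Polynomial.C (structureCoeff (Gfun q) μ ν la) * β ^ (la.size - (μ.size + ν.size))

theorem structurePoly_eq_zero {q : Bool} {la μ ν : StrictPartition}
    (h : la.size < μ.size + ν.size) : structurePoly q la μ ν = 0 := by
  rw [structurePoly, (isProductExpansion_structureCoeff q μ ν).1 la h, map_zero, zero_mul]

theorem coeff_Gfun_mul_Gfun (q : Bool) (μ ν : StrictPartition) (a : ℕ →₀ ℕ) :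
    MvPowerSeries.coeff a (Gfun q μ * Gfun q ν) = ∑ la ∈ sizeLE a.degree,
      structurePoly q la μ ν * MvPowerSeries.coeff a (Gfun q la) :=
  (isProductExpansion_iff.1 (isProductExpansion_structureCoeff q μ ν)).2 a

/-- `gp_{λ/μ}` if `q`, else `gq_{λ/μ}`. -/
def dualSkew (q : Bool) (la μ : StrictPartition) : Series :=
  ∑ᶠ ν, MvPowerSeries.C (structurePoly q la μ ν) * dualFamily (Gfun q) ν

theorem dualSkew_eq_sum {q : Bool} {la μ : StrictPartition} {M : ℕ} (hM : la.size ≤ M) :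
    dualSkew q la μ = ∑ ν ∈ sizeLE M, structurePoly q la μ ν • dualFamily (Gfun q) ν := by
  rw [dualSkew, finsum_eq_sum_of_support_subset (s := sizeLE M)]
  · simp only [MvPowerSeries.smul_eq_C_mul]
  · intro ν hν
    rw [Finset.mem_coe, mem_sizeLE]
    by_contra h
    refine hν ?_
    simp only
    rw [structurePoly_eq_zero (by omega), map_zero, zero_mul]

/-! ### The skew Cauchy identity -/

/-- The generating function of the `g_{μ/κ}` is `G_κ` times the Cauchy kernel. -/
theorem sum_coeff_smul_dualSkew (q : Bool) (z : ℕ →₀ ℕ) (κ : StrictPartition) :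
    ∑ μ ∈ sizeLE z.degree, MvPowerSeries.coeff z (Gfun q μ) • dualSkew q μ κ =
      ∑ p ∈ Finset.HasAntidiagonal.antidiagonal z,
        MvPowerSeries.coeff p.1 (Gfun q κ) • xcoeff p.2 Δ := by
  classical
  have h1 : ∀ μ ∈ sizeLE z.degree, MvPowerSeries.coeff z (Gfun q μ) • dualSkew q μ κ =
      ∑ ρ ∈ sizeLE z.degree, (structurePoly q μ κ ρ * MvPowerSeries.coeff z (Gfun q μ)) •
        dualFamily (Gfun q) ρ := by
    intro μ hμ
    rw [dualSkew_eq_sum (mem_sizeLE.1 hμ), Finset.smul_sum]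
    refine Finset.sum_congr rfl fun ρ _ => ?_
    rw [smul_smul, mul_comm]
  rw [Finset.sum_congr rfl h1, Finset.sum_comm]
  simp only [← Finset.sum_smul, ← coeff_Gfun_mul_Gfun, MvPowerSeries.coeff_mul]
  simp only [Finset.sum_smul]
  rw [Finset.sum_comm]
  refine Finset.sum_congr rfl fun p hp => ?_
  have hp2 : p.2.degree ≤ z.degree := by
    rw [Finset.HasAntidiagonal.mem_antidiagonal] at hp
    rw [← hp, map_add]
    omega
  rw [xcoeff_Δ_eq q hp2, Finset.smul_sum]
  simp only [smul_smul]

/-- The left side of the skew Cauchy identity, multiplied by `G_μ(z)` and summed over `μ`, is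
`∑_λ G_λ(z, x) g_{λ/ν}(y)`. -/
theorem sum_coeff_smul_left (q : Bool) (ν : StrictPartition) {n : ℕ} {z : ℕ →₀ ℕ}
    (hz : ∀ i ∈ z.support, i < n) (a : ℕ →₀ ℕ) :
    ∑ μ ∈ sizeLE z.degree, MvPowerSeries.coeff z (Gfun q μ) •
      ∑ la ∈ sizeLE (a.degree + μ.size), MvPowerSeries.coeff a (Gsskew q la μ) • dualSkew q la ν =
      ∑ la ∈ sizeLE (splice n z a).degree,
        MvPowerSeries.coeff (splice n z a) (Gfun q la) • dualSkew q la ν := by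
  have h1 : ∀ μ ∈ sizeLE z.degree, MvPowerSeries.coeff z (Gfun q μ) •
      ∑ la ∈ sizeLE (a.degree + μ.size), MvPowerSeries.coeff a (Gsskew q la μ) • dualSkew q la ν =
      ∑ la ∈ sizeLE (splice n z a).degree, (MvPowerSeries.coeff z (Gfun q μ) *
        MvPowerSeries.coeff a (Gsskew q la μ)) • dualSkew q la ν := by
    intro μ hμ
    rw [Finset.smul_sum]
    simp only [smul_smul]
    rw [mem_sizeLE] at hμ
    refine Finset.sum_subset (fun la hla => ?_) fun la _ hla => ?_
    · rw [mem_sizeLE] at hla ⊢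
      rw [degree_splice]
      omega
    · have : MvPowerSeries.coeff a (Gsskew q la μ) = 0 := by
        by_contra h
        exact hla (mem_sizeLE.2 (size_le_of_coeff_Gsskew_ne_zero h))
      rw [this, mul_zero, zero_smul]
  rw [Finset.sum_congr rfl h1, Finset.sum_comm]
  refine Finset.sum_congr rfl fun la _ => ?_
  rw [← Finset.sum_smul, coeff_splice_Gfun hz]
  congr 1
  classical
  -- Both sums reduce to the partitions in the intersection of their ranges.
  refine (Finset.sum_subset (Finset.inter_subset_left (s₂ := la.lower)) ?_).symm.trans
    (Finset.sum_subset (Finset.inter_subset_right (s₁ := sizeLE z.degree)) ?_)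
  · intro κ hκ h
    have : MvPowerSeries.coeff a (Gsskew q la κ) = 0 := by
      by_contra h'
      exact h (Finset.mem_inter.2 ⟨hκ, mem_lower.2 (subset_of_coeff_Gsskew_ne_zero h')⟩)
    rw [this, mul_zero]
  · intro κ hκ h
    have : κ ∉ sizeLE z.degree := fun h' => h (Finset.mem_inter.2 ⟨h', hκ⟩)
    rw [coeff_Gfun_eq_zero_of_notMem this, zero_mul]

/-- The right side of the skew Cauchy identity, multiplied by `G_μ(z)` and summed over `μ`, is
`G_ν(z, x) Δ(z, x; y)`. -/
theorem sum_coeff_smul_right (q : Bool) (ν : StrictPartition) {n : ℕ} {z : ℕ →₀ ℕ}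
    (hz : ∀ i ∈ z.support, i < n) (a : ℕ →₀ ℕ) :
    ∑ μ ∈ sizeLE z.degree, MvPowerSeries.coeff z (Gfun q μ) •
      ∑ r ∈ Finset.HasAntidiagonal.antidiagonal a, xcoeff r.2 Δ *
        ∑ κ ∈ ν.lower, MvPowerSeries.coeff r.1 (Gsskew q ν κ) • dualSkew q μ κ =
      ∑ e ∈ Finset.HasAntidiagonal.antidiagonal (splice n z a),
        MvPowerSeries.coeff e.1 (Gfun q ν) • xcoeff e.2 Δ := by
  classical
  rw [sum_antidiagonal_splice hz a fun e e' => MvPowerSeries.coeff e (Gfun q ν) • xcoeff e' Δ,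
    Finset.sum_comm]
  simp only [Finset.smul_sum]
  rw [Finset.sum_comm]
  refine Finset.sum_congr rfl fun r _ => ?_
  have h1 : ∀ μ, MvPowerSeries.coeff z (Gfun q μ) • (xcoeff r.2 Δ *
        ∑ κ ∈ ν.lower, MvPowerSeries.coeff r.1 (Gsskew q ν κ) • dualSkew q μ κ) =
      ∑ κ ∈ ν.lower, MvPowerSeries.coeff r.1 (Gsskew q ν κ) • (xcoeff r.2 Δ *
        (MvPowerSeries.coeff z (Gfun q μ) • dualSkew q μ κ)) := by
    intro μ
    rw [Finset.mul_sum, Finset.smul_sum]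
    refine Finset.sum_congr rfl fun κ _ => ?_
    rw [mul_smul_comm, mul_smul_comm, smul_comm]
  simp only [h1]
  rw [Finset.sum_comm]
  have h2 : ∀ κ, ∑ μ ∈ sizeLE z.degree, MvPowerSeries.coeff r.1 (Gsskew q ν κ) • (xcoeff r.2 Δ *
        (MvPowerSeries.coeff z (Gfun q μ) • dualSkew q μ κ)) =
      ∑ p ∈ Finset.HasAntidiagonal.antidiagonal z, (MvPowerSeries.coeff p.1 (Gfun q κ) *
        MvPowerSeries.coeff r.1 (Gsskew q ν κ)) • (xcoeff p.2 Δ * xcoeff r.2 Δ) := by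
    intro κ
    rw [← Finset.smul_sum, ← Finset.mul_sum, sum_coeff_smul_dualSkew, Finset.mul_sum,
      Finset.smul_sum]
    refine Finset.sum_congr rfl fun p _ => ?_
    rw [mul_smul_comm, smul_smul, mul_comm (xcoeff p.2 Δ), mul_comm (MvPowerSeries.coeff p.1 _)]
  simp only [h2]
  rw [Finset.sum_comm]
  refine Finset.sum_congr rfl fun p hp => ?_
  obtain ⟨hp1, hp2⟩ := forall_mem_support_lt_of_antidiagonal hz hp
  rw [← Finset.sum_smul, coeff_splice_Gfun hp1, xcoeff_splice_Δ hp2]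

theorem hasSum_skewCauchy (q : Bool) (μ ν : StrictPartition) :
    HasSum (fun la => inX (Gsskew q la μ) * inY (dualSkew q la ν))
      (Δ * ∑ᶠ κ, inX (Gsskew q ν κ) * inY (dualSkew q μ κ)) := by
  classical
  rw [hasSum_series₂_iff (s := fun a => sizeLE (a.degree + μ.size))]
  swap
  · intro a la hla
    rw [xcoeff_inX_mul_inY]
    have : MvPowerSeries.coeff a (Gsskew q la μ) = 0 := by
      by_contra h
      exact hla (mem_sizeLE.2 (size_le_of_coeff_Gsskew_ne_zero h))
    rw [this, zero_smul]
  intro a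
  have hfin : ∀ μ, ∑ᶠ κ, inX (Gsskew q ν κ) * inY (dualSkew q μ κ) =
      ∑ κ ∈ ν.lower, inX (Gsskew q ν κ) * inY (dualSkew q μ κ) := by
    intro μ
    refine finsum_eq_sum_of_support_subset _ fun κ hκ => ?_
    by_contra h
    refine hκ ?_
    have h0 : Gsskew q ν κ = 0 := by
      ext1 d
      by_contra h'
      exact h (mem_lower.2 (subset_of_coeff_Gsskew_ne_zero h'))
    simp only [h0]
    rw [show inX 0 = 0 from map_zero (MvPowerSeries.rename _), zero_mul]
  have hright : ∀ μ, xcoeff a (Δ * ∑ᶠ κ, inX (Gsskew q ν κ) * inY (dualSkew q μ κ)) =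
      ∑ r ∈ Finset.HasAntidiagonal.antidiagonal a, xcoeff r.2 Δ *
        ∑ κ ∈ ν.lower, MvPowerSeries.coeff r.1 (Gsskew q ν κ) • dualSkew q μ κ := by
    intro μ
    rw [hfin, mul_comm, xcoeff_mul]
    simp only [map_sum, xcoeff_inX_mul_inY, mul_comm]
  simp only [hright, xcoeff_inX_mul_inY]
  rw [← sub_eq_zero]
  refine eq_zero_of_forall_sum_smul_eq_zero (q := q) (E := fun μ =>
    (∑ r ∈ Finset.HasAntidiagonal.antidiagonal a, xcoeff r.2 Δ *
        ∑ κ ∈ ν.lower, MvPowerSeries.coeff r.1 (Gsskew q ν κ) • dualSkew q μ κ) -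
      ∑ la ∈ sizeLE (a.degree + μ.size),
        MvPowerSeries.coeff a (Gsskew q la μ) • dualSkew q la ν) (fun z => ?_) μ
  obtain ⟨n, hn⟩ := exists_forall_mem_support_lt z
  simp only [smul_sub]
  rw [Finset.sum_sub_distrib, sum_coeff_smul_right q ν hn a, sum_coeff_smul_left q ν hn a,
    sum_coeff_smul_dualSkew, sub_self]

end

theorem mainTheorem3 :
    -- the dual functions and the structure constants are well defined
    ((∃! g, IsDualFamily GP g) ∧ (∃! g, IsDualFamily GQ g) ∧
      (∀ μ ν, ∃! a, IsProductExpansion GP μ ν a) ∧ (∀ μ ν, ∃! b, IsProductExpansion GQ μ ν b)) ∧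
    -- the two skew Cauchy identities
    ∀ μ ν : StrictPartition,
      HasSum (fun la => inX (GPsskew la μ) * inY (gqSkew la ν))
        (Δ * ∑ᶠ κ, inX (GPsskew ν κ) * inY (gqSkew μ κ)) ∧
      HasSum (fun la => inX (GQsskew la μ) * inY (gpSkew la ν))
        (Δ * ∑ᶠ κ, inX (GQsskew ν κ) * inY (gpSkew μ κ)) :=
  ⟨⟨existsUnique_isDualFamily false, existsUnique_isDualFamily true,
    existsUnique_isProductExpansion false, existsUnique_isProductExpansion true⟩,
    fun μ ν => ⟨hasSum_skewCauchy false μ ν, hasSum_skewCauchy true μ ν⟩⟩
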